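/- **Sharing calculus.** Terms, bags and expressions (with a success constant $\checkmark$) are $$M,N ::= x \mid \lambda x.(M[\widetilde x\leftarrow x]) \mid (M\,B) \mid M\langle| N/x|\rangle \mid \mathtt{fail}^{\widetilde x} \mid M[\widetilde x\leftarrow x] \mid (M[\widetilde x\leftarrow x])\langle\!\langle B/x\rangle\!\rangle \mid \checkmark,$$ $$B ::= \mathtt 1 \mid ⟅M⟆\cdot B, \qquad \mathbb M ::= M \mid \mathbb M+\mathbb M,$$ up to $\alpha$-equivalence, with bags and sums up to reordering; $|B|$ is the number of elements of $B$, and $\mathrm{perm}(B)$ is the collection of its orderings $B_i=(B_i(1),\dots,B_i(|B|))$. Here $\widetilde x=x_1,\dots,x_k$ ($k\ge 0$) are distinct; in $M[\widetilde x\leftarrow x]$ the $x_j$ are bound in $M$; $\lambda x$ and the substitutions for $x$ bind $x$. No variable occurs more than once in a term; each $x_j$ in $M[\widetilde x\leftarrow x]$, and $x$ in $M\langle|N/x|\rangle$, occurs in $M$ exactly once and is not itself a sharing variable (the $x$ of a construct $[\widetilde y\leftarrow x]$). $\mathrm{fv}$ denotes the set of free variables, with $\mathrm{fv}(\mathtt{fail}^{\widetilde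 x})=\widetilde x$ and $\mathrm{fv}(M[\widetilde x\leftarrow x])=(\mathrm{fv}(M)\setminus\widetilde x)\cup\{x\}$; an expression is closed if it has no free variables. *Head.* $x$, $\lambda x.(\cdots)$, $\mathtt{fail}^{\widetilde x}$ and $\checkmark$ are their own heads; $\mathrm{head}(M\,B)=\mathrm{head}(M\langle|N/x|\rangle)=\mathrm{head}(M)$; $\mathrm{head}(M[\widetilde x\leftarrow x])$ is $x$ if $\mathrm{head}(M)\in\widetilde x$ and $\mathrm{head}(M)$ otherwise; $\mathrm{head}((M[\widetilde x\leftarrow x])\langle\!\langle B/x\rangle\!\rangle)$ is $\mathrm{head}(M[\widetilde x\leftarrow x])$ if $|\widetilde x|=|B|$ and $\mathtt{fail}^{\emptyset}$ otherwise. *Reduction* $\longrightarrow$ is generated by (with $\widetilde x=x_1,\dots,x_k$) - $(\lambda x.(M[\widetilde x\leftarrow x]))B\longrightarrow (M[\widetilde x\leftarrow x])\langle\!\langle B/x\rangle\!\rangle$; - $(M[\widetilde x\leftarrow x])\langle\!\langle B/x\rangle\!\rangle\longrightarrow\sum_{B_i\in\mathrm{perm}(B)}M\langle|B_i(1)/x_1|\rangle\cdots\langle|B_i(k)/x_k|\rangle$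 if $|B|=k\ge1$ and $M$ is not a term $\mathtt{fail}^{\widetilde y}$; - $M\langle|N/x|\rangle\longrightarrow M\{|N/x|\}$ if $\mathrm{head}(M)=x$, where $M\{|N/x|\}$ replaces the head occurrence of $x$ by $N$, without capture; - $(M[\widetilde x\leftarrow x])\langle\!\langle B/x\rangle\!\rangle\longrightarrow\sum_{\mathrm{perm}(B)}\mathtt{fail}^{(\mathrm{fv}(M)\setminus\widetilde x)\cup\mathrm{fv}(B)}$ if $k\neq|B|$; - $\mathtt{fail}^{\widetilde y}\,B\longrightarrow\sum_{\mathrm{perm}(B)}\mathtt{fail}^{\widetilde y\cup\mathrm{fv}(B)}$; - $(\mathtt{fail}^{\widetilde x\cup\widetilde y}[\widetilde x\leftarrow x])\langle\!\langle B/x\rangle\!\rangle\longrightarrow\sum_{\mathrm{perm}(B)}\mathtt{fail}^{\widetilde y\cup\mathrm{fv}(B)}$ if $|B|+k\neq0$ ($\widetilde x\cap\widetilde y=\emptyset$); - $\mathtt{fail}^{\widetilde y\cup\{x\}}\langle|N/x|\rangle\longrightarrow\mathtt{fail}^{\widetilde y\cup\mathrm{fv}(N)}$ ($x\notin\widetilde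 y$); and closed under the term contexts $C::=[\cdot]B\mid[\cdot]\langle|N/x|\rangle\mid[\cdot][\widetilde x\leftarrow x]\mid([\cdot][\leftarrow x])\langle\!\langle\mathtt 1/x\rangle\!\rangle$ (if $M\longrightarrow\sum_jM_j$ then $C[M]\longrightarrow\sum_jC[M_j]$) and under sums. The *precongruence* $\succeq$ is the least preorder closed under these contexts and sums with $(M[\leftarrow x])\langle\!\langle\mathtt 1/x\rangle\!\rangle\succeq M$; $(M\,B)\langle|N/x|\rangle\equiv(M\langle|N/x|\rangle)B$ if $x\notin\mathrm{fv}(B)$; $M\langle|N_2/y|\rangle\langle|N_1/x|\rangle\equiv M\langle|N_1/x|\rangle\langle|N_2/y|\rangle$ if $x\notin\mathrm{fv}(N_2)$ and $y\notin\mathrm{fv}(N_1)$; $((M\,A)[\widetilde x\leftarrow x])\langle\!\langle B/x\rangle\!\rangle\equiv((M[\widetilde x\leftarrow x])\langle\!\langle B/x\rangle\!\rangle)A$ if $\widetilde x\cap\mathrm{fv}(A)=\emptyset$; $((M[\widetilde y\leftarrow y])\langle\!\langle A/y\rangle\!\rangle[\widetilde x\leftarrow x])\langle\!\langle B/x\rangle\!\rangle\succeq((M[\widetilde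 x\leftarrow x])\langle\!\langle B/x\rangle\!\rangle[\widetilde y\leftarrow y])\langle\!\langle A/y\rangle\!\rangle$ if $\widetilde x\cap\mathrm{fv}(A)=\emptyset$ and $\widetilde y\cap\mathrm{fv}(B)=\emptyset$ ($\equiv$ means $\succeq$ in both directions). Write $\mathbb N\longrightarrow_{\succeq}\mathbb N'$ if $\mathbb N\succeq\mathbb N_1\longrightarrow\mathbb N_2\succeq\mathbb N'$ for some $\mathbb N_1,\mathbb N_2$. Define $\mathbb M\Downarrow_\checkmark$ iff $\mathbb M\longrightarrow_{\succeq}^*M_1+\cdots+M_k$ for some $M_1,\dots,M_k$ with $\mathrm{head}(M_j)=\checkmark$ for some $j$. *Well-formedness.* Strict types are $\sigma,\tau::=\mathbf{unit}\mid\pi\to\tau$, where $\pi$ is a finite multiset of strict types ($\omega$ is the empty one; $\sigma^k$ is $k$ copies of $\sigma$; $\sigma^1$ is identified with $\sigma$). $\mathbb M$ is well-formed if $\Gamma\models\mathbb M:\tau$ is derivable for some $\Gamma,\tau$. The rules for $\models$ are: - $x:\sigma\models x:\sigma$; $\models\mathtt1:\omega$; $\models\checkmark:\tau$; $\Gamma\models\mathtt{fail}^{\widetilde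 x}:\tau$ if $\mathrm{dom}(\Gamma)=\widetilde x$; - from $\Gamma\models M:\tau$ infer $\Gamma,x:\omega\models M[\leftarrow x]:\tau$; - from $\Gamma,x_1:\sigma,\dots,x_k:\sigma\models M:\tau$ with $k\ne0$ and $x\notin\mathrm{dom}(\Gamma)$ infer $\Gamma,x:\sigma^k\models M[x_1,\dots,x_k\leftarrow x]:\tau$; - from $\Gamma,x:\sigma^k\models M[\widetilde x\leftarrow x]:\tau$ with $x\notin\mathrm{dom}(\Gamma)$ infer $\Gamma\models\lambda x.(M[\widetilde x\leftarrow x]):\sigma^k\to\tau$; - from $\Gamma\models M:\sigma^j\to\tau$ and $\Delta\models B:\sigma^k$ infer $\Gamma,\Delta\models M\,B:\tau$; - from $\Gamma\models M:\sigma$ and $\Delta\models B:\sigma^k$ infer $\Gamma,\Delta\models⟅M⟆\cdot B:\sigma^{k+1}$; - from $\Gamma,x:\sigma\models M:\tau$ and $\Delta\models N:\sigma$ infer $\Gamma,\Delta\models M\langle|N/x|\rangle:\tau$; - from $\Gamma,x:\sigma^k\models M[\widetilde x\leftarrow x]:\tau$ and $\Delta\models B:\sigma^j$ infer $\Gamma,\Delta\models(M[\widetilde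 x\leftarrow x])\langle\!\langle B/x\rangle\!\rangle:\tau$; - from $\Gamma\models\mathbb M:\tau$ and $\Gamma\models\mathbb N:\tau$ infer $\Gamma\models\mathbb M+\mathbb N:\tau$; moreover every judgement $\Gamma\vdash M:\tau$ or $\Gamma\vdash B:\pi$ of the ordinary type system (the same rules without those for $\mathtt{fail}$ and $\checkmark$, where application requires $M:\pi\to\tau$ and $B:\pi$, and explicit substitution requires $j=k$) is a judgement of $\models$. **Processes.** $P,Q::=\mathbf0\mid\overline x(y).P\mid x(y).P\mid(P\mid Q)\mid(\nu x)P\mid[x\leftrightarrow y]\mid x.\overline{\mathtt{close}}\mid x.\mathtt{close};P\mid x.\overline{\mathtt{some}};P\mid x.\overline{\mathtt{none}}\mid x.\mathtt{some}_{(w_1,\dots,w_n)};P\mid P\oplus Q\mid\checkmark$, where the tuples $(w_1,\dots,w_n)$ are regarded as sets. Structural congruence $\equiv$ is the least congruence containing $\alpha$-equivalence such that $\mid$ is commutative and associative with unit $\mathbf0$; $\oplus$ is commutative and associative; and $[x\leftrightarrow y]\equiv[y\leftrightarrow x]$; $((\nu x)P)\mid Q\equiv(\nu x)(P\mid Q)$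 for $x\notin\mathrm{fn}(Q)$; $(\nu x)(P\mid(Q\oplus R))\equiv(\nu x)(P\mid Q)\oplus(\nu x)(P\mid R)$; $\mathbf0\oplus\mathbf0\equiv\mathbf0$; $(\nu x)\mathbf0\equiv\mathbf0$; $(\nu x)(\nu y)P\equiv(\nu y)(\nu x)P$. Reduction is closed under $\equiv$, $\mid$, $\nu$ and $\oplus$ and generated by $\overline x(y).Q\mid x(y).P\longrightarrow(\nu y)(Q\mid P)$; $(\nu x)([x\leftrightarrow y]\mid P)\longrightarrow P\{y/x\}$ ($x\ne y$); $x.\overline{\mathtt{close}}\mid x.\mathtt{close};P\longrightarrow P$; $x.\overline{\mathtt{some}};P\mid x.\mathtt{some}_{\widetilde w};Q\longrightarrow P\mid Q$; $x.\overline{\mathtt{none}}\mid x.\mathtt{some}_{(w_1,\dots,w_n)};Q\longrightarrow w_1.\overline{\mathtt{none}}\mid\cdots\mid w_n.\overline{\mathtt{none}}$. Define $P\Downarrow_\checkmark$ iff $P\longrightarrow^*P'$ for some $P'$ with an occurrence of $\checkmark$ that is not behind a prefix. **Translation.** With fresh bound names, - $⟦\checkmark⟧_u=\checkmark$, $⟦x⟧_u=x.\overline{\mathtt{some}};[x\leftrightarrow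 u]$, $⟦\lambda x.(M[\widetilde x\leftarrow x])⟧_u=u.\overline{\mathtt{some}};u(x).⟦M[\widetilde x\leftarrow x]⟧_u$; - $⟦M\,B⟧_u=\bigoplus_{B_i\in\mathrm{perm}(B)}(\nu v)(⟦M⟧_v\mid v.\mathtt{some}_{u,\mathrm{fv}(B)};\overline v(x).([v\leftrightarrow u]\mid⟦B_i⟧_x))$; - $⟦(M[\widetilde x\leftarrow x])\langle\!\langle B/x\rangle\!\rangle⟧_u=\bigoplus_{B_i\in\mathrm{perm}(B)}(\nu x)(⟦M[\widetilde x\leftarrow x]⟧_u\mid⟦B_i⟧_x)$; - $⟦M\langle|N/x|\rangle⟧_u=(\nu x)(⟦M⟧_u\mid x.\mathtt{some}_{\mathrm{fv}(N)};⟦N⟧_x)$; - $⟦\mathtt{fail}^{x_1,\dots,x_k}⟧_u=u.\overline{\mathtt{none}}\mid x_1.\overline{\mathtt{none}}\mid\cdots\mid x_k.\overline{\mathtt{none}}$; - $⟦M[x_1,\dots,x_k\leftarrow x]⟧_u=S_1$, where $S_{k+1}=x.\overline{\mathtt{some}};\overline x(y).(y.\mathtt{some}_{u,\mathrm{fv}(M)};y.\mathtt{close};⟦M⟧_u\mid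 x.\overline{\mathtt{none}})$ and, for $1\le j\le k$, $S_j=x.\overline{\mathtt{some}};\overline x(y_j).(y_j.\mathtt{some}_\emptyset;y_j.\mathtt{close};\mathbf0\mid x.\overline{\mathtt{some}};x.\mathtt{some}_{u,\mathrm{fv}(M)\setminus\{x_j,\dots,x_k\}};x(x_j).S_{j+1})$; - $⟦\mathtt1⟧_x=x.\mathtt{some}_\emptyset;x(y).(y.\overline{\mathtt{some}};y.\overline{\mathtt{close}}\mid x.\mathtt{some}_\emptyset;x.\overline{\mathtt{none}})$; - $⟦⟅M⟆\cdot B⟧_x=x.\mathtt{some}_{\mathrm{fv}(⟅M⟆\cdot B)};x(y).x.\mathtt{some}_{y,\mathrm{fv}(⟅M⟆\cdot B)};x.\overline{\mathtt{some}};\overline x(z).(z.\mathtt{some}_{\mathrm{fv}(M)};⟦M⟧_z\mid⟦B⟧_x\mid y.\overline{\mathtt{none}})$; - $⟦\mathbb M+\mathbb N⟧_u=⟦\mathbb M⟧_u\oplus⟦\mathbb N⟧_u$. **Theorem (Success Sensitivity).** For every closed well-formed expression $\mathbb M$ of the sharing calculus and every name $u$, $$\mathbb M\Downarrow_\checkmark\iff⟦\mathbb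 M⟧_u\Downarrow_\checkmark .$$ -/

import Mathlib

/-!
Terms of the sharing calculus and processes are represented with de Bruijn indices, so that
alpha-equivalent objects are equal. Free variables (names) are the indices that point past all
enclosing binders; a construct that binds `k` variables `x₁, …, x_k` gives `x_j` the index `j - 1`
and shifts all other variables by `k`.
-/

namespace SharingPi

/-! ### Variables and index bookkeeping -/

/-- Extend a renaming under `k` binders. -/
def liftN (k : ℕ) (f : ℕ → ℕ) (i : ℕ) : ℕ := if i < k then i else f (i - k) + k

/-- Exchange the block of the `a` innermost binders with the block of the next `b` binders. -/
def blockSwap (a b i : ℕ) : ℕ := if i < a then i + b else if i < a + b then i - a else i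

/-- Remove the `k` innermost variables from a set of variables: `S \ {x₁, …, x_k}`, seen from
outside the binder. -/
def down (k : ℕ) (S : Finset ℕ) : Finset ℕ := (S.filter (fun i => k ≤ i)).image (fun i => i - k)

/-! ### The sharing calculus: syntax -/

/-- Terms, including the success constant `✓`. A bag is the list of its elements; the list stands
for the multiset: all uses of a bag below go through all its permutations, its length or its free
variables. -/
inductive Term : Type
  /-- `x` -/
  | var (x : ℕ) : Term
  /-- `λ x. (M[x₁, …, x_k ← x])`; `x₁, …, x_k` are bound in `M` (and `x` does not occur in `M`). -/
  | lam (k : ℕ) (M : Term) : Term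
  /-- `M B` -/
  | app (M : Term) (B : List Term) : Term
  /-- The explicit linear substitution `M⟨|N / x|⟩`; `x` is bound in `M`. -/
  | lsub (M N : Term) : Term
  /-- `fail^{S}` -/
  | fail (S : Finset ℕ) : Term
  /-- The sharing construct `M[x₁, …, x_k ← x]`; `x₁, …, x_k` are bound in `M`. -/
  | share (k : ℕ) (M : Term) (x : ℕ) : Term
  /-- The explicit substitution `(M[x₁, …, x_k ← x])⟨⟨B / x⟩⟩`; `x₁, …, x_k` are bound in `M`
  (and `x` does not occur in `M`). -/
  | esub (k : ℕ) (M : Term) (B : List Term) : Term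
  /-- `✓` -/
  | tick : Term

/-- A bag, as the list of its elements. The empty bag `1` is `[]`, the bag `⟅M⟆ · B` is `M :: B`. -/
abbrev Bag := List Term

/-- An expression `M₁ + ⋯ + M_k`, as the list of its summands. -/
abbrev Expr := List Term

mutual
/-- Renaming of free variables. -/
def Term.rename (f : ℕ → ℕ) : Term → Term
  | .var x => .var (f x)
  | .lam k M => .lam k (M.rename (liftN k f))
  | .app M B => .app (M.rename f) (renameBag f B)
  | .lsub M N => .lsub (M.rename (liftN 1 f)) (N.rename f)
  | .fail S => .fail (S.image f)
  | .share k M x => .share k (M.rename (liftN k f)) (f x)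
  | .esub k M B => .esub k (M.rename (liftN k f)) (renameBag f B)
  | .tick => .tick
/-- Renaming of free variables in a bag. -/
def renameBag (f : ℕ → ℕ) : List Term → List Term
  | [] => []
  | M :: B => M.rename f :: renameBag f B
end

/-- `M`, seen from under `k` further binders. -/
def Term.shift (k : ℕ) (M : Term) : Term := M.rename (fun i => i + k)

/-- `B`, seen from under `k` further binders. -/
def shiftBag (k : ℕ) (B : Bag) : Bag := renameBag (fun i => i + k) B

/-- The term `M[x₁, …, x_k ← x]` in the scope of a binder for `x`. -/
def Term.shareBound (k : ℕ) (M : Term) : Term :=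
  .share k (M.rename (fun i => if i < k then i else i + 1)) 0

mutual
/-- Free variables of a term. -/
def Term.fv : Term → Finset ℕ
  | .var x => {x}
  | .lam k M => down k M.fv
  | .app M B => M.fv ∪ fvBag B
  | .lsub M N => down 1 M.fv ∪ N.fv
  | .fail S => S
  | .share k M x => down k M.fv ∪ {x}
  | .esub k M B => down k M.fv ∪ fvBag B
  | .tick => ∅
/-- Free variables of a bag. -/
def fvBag : List Term → Finset ℕ
  | [] => ∅
  | M :: B => M.fv ∪ fvBag B
end

mutual
/-- Number of free occurrences of the variable `x` in a term. -/
def Term.occ : ℕ → Term → ℕ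
  | x, .var y => if x = y then 1 else 0
  | x, .lam k M => M.occ (x + k)
  | x, .app M B => M.occ x + occBag x B
  | x, .lsub M N => M.occ (x + 1) + N.occ x
  | x, .fail S => if x ∈ S then 1 else 0
  | x, .share k M y => M.occ (x + k) + if x = y then 1 else 0
  | x, .esub k M B => M.occ (x + k) + occBag x B
  | _, .tick => 0
/-- Number of free occurrences of the variable `x` in a bag. -/
def occBag : ℕ → List Term → ℕ
  | _, [] => 0
  | x, M :: B => M.occ x + occBag x B
end

mutual
/-- The free variable `x` is used as a sharing variable somewhere in the term. -/
def Term.Shares : ℕ → Term → Prop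
  | _, .var _ => False
  | x, .lam k M => M.Shares (x + k)
  | x, .app M B => M.Shares x ∨ SharesBag x B
  | x, .lsub M N => M.Shares (x + 1) ∨ N.Shares x
  | _, .fail _ => False
  | x, .share k M y => M.Shares (x + k) ∨ x = y
  | x, .esub k M B => M.Shares (x + k) ∨ SharesBag x B
  | _, .tick => False
/-- The free variable `x` is used as a sharing variable somewhere in the bag. -/
def SharesBag : ℕ → List Term → Prop
  | _, [] => False
  | x, M :: B => M.Shares x ∨ SharesBag x B
end

/-- Each of the `k` innermost variables occurs exactly once in `M`, and not as a sharing
variable. -/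
def Term.BindsLinearly (k : ℕ) (M : Term) : Prop := ∀ i < k, M.occ i = 1 ∧ ¬ M.Shares i

mutual
/-- The side conditions on the binding constructs, at every subterm. -/
def Term.BindersOk : Term → Prop
  | .var _ => True
  | .lam k M => M.BindsLinearly k ∧ M.BindersOk
  | .app M B => M.BindersOk ∧ BindersOkBag B
  | .lsub M N => M.BindsLinearly 1 ∧ M.BindersOk ∧ N.BindersOk
  | .fail _ => True
  | .share k M _ => M.BindsLinearly k ∧ M.BindersOk
  | .esub k M B => M.BindsLinearly k ∧ M.BindersOk ∧ BindersOkBag B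
  | .tick => True
/-- The side conditions on the binding constructs, in a bag. -/
def BindersOkBag : List Term → Prop
  | [] => True
  | M :: B => M.BindersOk ∧ BindersOkBag B
end

/-- The syntactic conditions that single out the terms of the calculus: shared and linearly
substituted variables occur exactly once and are not sharing variables, and no variable occurs
more than once. -/
def Term.Proper (M : Term) : Prop := M.BindersOk ∧ ∀ x, M.occ x ≤ 1

/-- The expression is a (non-empty) sum of terms of the calculus. -/
def Expr.Proper (E : Expr) : Prop := E ≠ [] ∧ ∀ M ∈ E, M.Proper

/-- An expression without free variables. -/
def Expr.Closed (E : Expr) : Prop := ∀ M ∈ E, M.fv = ∅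

/-! ### The sharing calculus: semantics -/

/-- What is inspected of the head of a term: whether it is a free variable, a variable bound by one
of the surrounding substitutions, an abstraction, a failure term or `✓`. -/
inductive Head : Type
  | free (x : ℕ) : Head
  | bound : Head
  | lam : Head
  | fail : Head
  | tick : Head

/-- Leave the scope of the `k` innermost variables: a head that is one of them becomes `h`. -/
def Head.exit : Head → ℕ → Head → Head
  | .free i, k, h => if i < k then h else .free (i - k)
  | h', _, _ => h'

/-- The head of a term. -/
def Term.head : Term → Head
  | .var x => .free x
  | .lam _ _ => .lam
  | .app M _ => M.head
  | .lsub M _ => M.head.exit 1 .bound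
  | .fail _ => .fail
  | .share k M x => M.head.exit k (.free x)
  | .esub k M B => if k = B.length then M.head.exit k .bound else .fail
  | .tick => .tick

/-- The linear head substitution `M{|N / x|}`, for a term `M` whose head is the free variable `x`. -/
def Term.headSubst : Term → ℕ → Term → Term
  | .var y, x, N => if y = x then N else .var y
  | .app M B, x, N => .app (M.headSubst x N) B
  | .lsub M L, x, N => .lsub (M.headSubst (x + 1) (N.shift 1)) L
  | .share k M y, x, N => .share k (M.headSubst (x + k) (N.shift k)) y
  | .esub k M B, x, N => .esub k (M.headSubst (x + k) (N.shift k)) B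
  | .lam k M, _, _ => .lam k M
  | .fail S, _, _ => .fail S
  | .tick, _, _ => .tick

/-- `M⟨|N₁ / x₁|⟩ ⋯ ⟨|N_k / x_k|⟩`, for `M` in the scope of `x₁, …, x_k` and `N₁, …, N_k` outside
of it. -/
def Term.lsubs : Term → List Term → Term
  | M, [] => M
  | M, N :: Ns => Term.lsubs (.lsub M (N.shift Ns.length)) Ns

/-- Reduction of a term to a sum, `M ⟶ M₁ + ⋯ + M_k`. -/
inductive Red : Term → Expr → Prop
  | beta (k : ℕ) (M : Term) (B : Bag) : Red (.app (.lam k M) B) [.esub k M B]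
  | exSub (k : ℕ) (M : Term) (B : Bag) :
      B.length = k → 1 ≤ k → (∀ S, M ≠ .fail S) →
      Red (.esub k M B) (B.permutations.map (fun B' => M.lsubs B'))
  | linFetch (M N : Term) :
      M.head = .free 0 →
      Red (.lsub M N) [(M.headSubst 0 (N.shift 1)).rename (fun i => i - 1)]
  | fail (k : ℕ) (M : Term) (B : Bag) :
      k ≠ B.length →
      Red (.esub k M B) (B.permutations.map (fun _ => .fail (down k M.fv ∪ fvBag B)))
  | cons₁ (S : Finset ℕ) (B : Bag) :
      Red (.app (.fail S) B) (B.permutations.map (fun _ => .fail (S ∪ fvBag B)))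
  | cons₂ (k : ℕ) (S : Finset ℕ) (B : Bag) :
      (∀ i < k, i ∈ S) → B.length + k ≠ 0 →
      Red (.esub k (.fail S) B) (B.permutations.map (fun _ => .fail (down k S ∪ fvBag B)))
  | cons₃ (S : Finset ℕ) (N : Term) :
      0 ∈ S → Red (.lsub (.fail S) N) [.fail (down 1 S ∪ N.fv)]
  | ctxApp (M : Term) (E : Expr) (B : Bag) :
      Red M E → Red (.app M B) (E.map (fun M' => .app M' B))
  | ctxLsub (M : Term) (E : Expr) (N : Term) :
      Red M E → Red (.lsub M N) (E.map (fun M' => .lsub M' N))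
  | ctxShare (k : ℕ) (M : Term) (E : Expr) (x : ℕ) :
      Red M E → Red (.share k M x) (E.map (fun M' => .share k M' x))
  | ctxEsub (M : Term) (E : Expr) :
      Red M E → Red (.esub 0 M []) (E.map (fun M' => .esub 0 M' []))

/-- Reduction of expressions. -/
inductive Expr.Red : Expr → Expr → Prop
  | ctx (E₁ E₂ : Expr) (M : Term) (E : Expr) :
      SharingPi.Red M E → Expr.Red (E₁ ++ M :: E₂) (E₁ ++ E ++ E₂)

/-- The precongruence `⪰` on terms. Side conditions of the form `x ∉ fv(B)` appear as shifts. -/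
inductive Pre : Term → Term → Prop
  | refl (M : Term) : Pre M M
  | trans (M M' M'' : Term) : Pre M M' → Pre M' M'' → Pre M M''
  | vacuous (M : Term) : Pre (.esub 0 M []) M
  | appLsub (M N : Term) (B : Bag) :
      Pre (.lsub (.app M (shiftBag 1 B)) N) (.app (.lsub M N) B)
  | lsubApp (M N : Term) (B : Bag) :
      Pre (.app (.lsub M N) B) (.lsub (.app M (shiftBag 1 B)) N)
  /-- This rule is its own converse, since `blockSwap 1 1` is an involution. -/
  | lsubLsub (M N₁ N₂ : Term) :
      Pre (.lsub (.lsub M (N₂.shift 1)) N₁)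
        (.lsub (.lsub (M.rename (blockSwap 1 1)) (N₁.shift 1)) N₂)
  | appEsub (k : ℕ) (M : Term) (A B : Bag) :
      Pre (.esub k (.app M (shiftBag k A)) B) (.app (.esub k M B) A)
  | esubApp (k : ℕ) (M : Term) (A B : Bag) :
      Pre (.app (.esub k M B) A) (.esub k (.app M (shiftBag k A)) B)
  | esubEsub (k l : ℕ) (M : Term) (A B : Bag) :
      Pre (.esub k (.esub l M (shiftBag k A)) B)
        (.esub l (.esub k (M.rename (blockSwap l k)) (shiftBag l B)) A)
  | ctxApp (M M' : Term) (B : Bag) : Pre M M' → Pre (.app M B) (.app M' B)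
  | ctxLsub (M M' N : Term) : Pre M M' → Pre (.lsub M N) (.lsub M' N)
  | ctxShare (k : ℕ) (M M' : Term) (x : ℕ) : Pre M M' → Pre (.share k M x) (.share k M' x)
  | ctxEsub (M M' : Term) : Pre M M' → Pre (.esub 0 M []) (.esub 0 M' [])

/-- The precongruence `⪰` on expressions; sums are taken up to reordering. -/
inductive Expr.Pre : Expr → Expr → Prop
  | refl (E : Expr) : Expr.Pre E E
  | trans (E E' E'' : Expr) : Expr.Pre E E' → Expr.Pre E' E'' → Expr.Pre E E''
  | perm (E E' : Expr) : List.Perm E E' → Expr.Pre E E'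
  | ctx (E₁ E₂ : Expr) (M M' : Term) :
      SharingPi.Pre M M' → Expr.Pre (E₁ ++ M :: E₂) (E₁ ++ M' :: E₂)

/-- One reduction step up to the precongruence: `E ⪰ E₁ ⟶ E₂ ⪰ E'`. -/
def Expr.Step (E E' : Expr) : Prop := ∃ E₁ E₂, E.Pre E₁ ∧ E₁.Red E₂ ∧ E₂.Pre E'

/-- Success: some reduct of `E` has a summand whose head is `✓`. -/
def Expr.Success (E : Expr) : Prop :=
  ∃ E', Relation.ReflTransGen Expr.Step E E' ∧ ∃ M ∈ E', M.head = .tick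

/-! ### The sharing calculus: intersection types and well-formedness -/

/-- Representatives of strict types, with intersections written as lists. -/
inductive PreType : Type
  | unit : PreType
  | arr (π : List PreType) (τ : PreType) : PreType

/-- Commutativity of intersections, anywhere in a type. -/
inductive PreType.Rel : PreType → PreType → Prop
  | perm (π π' : List PreType) (τ : PreType) :
      List.Perm π π' → PreType.Rel (.arr π τ) (.arr π' τ)
  | dom (π₁ π₂ : List PreType) (σ σ' τ : PreType) :
      PreType.Rel σ σ' → PreType.Rel (.arr (π₁ ++ σ :: π₂) τ) (.arr (π₁ ++ σ' :: π₂) τ)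
  | cod (π : List PreType) (τ τ' : PreType) :
      PreType.Rel τ τ' → PreType.Rel (.arr π τ) (.arr π τ')

/-- Strict types `σ ::= unit | π → σ`. -/
def SType : Type := Quot PreType.Rel

/-- Multiset types: finite intersections of strict types, the empty one being `ω`. -/
abbrev MType : Type := Multiset SType

/-- The strict type `π → τ`. -/
noncomputable def SType.arr (π : MType) (τ : SType) : SType :=
  Quot.mk _ (.arr (π.toList.map Quot.out) (Quot.out τ))

/-- The multiset type `σ^k = σ ∧ ⋯ ∧ σ`. -/
def SType.pow (σ : SType) (k : ℕ) : MType := Multiset.replicate k σ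

/-- Type assignments; an assignment `x : σ` of a strict type is `x : σ^1`. The union of
assignments is `+`. -/
abbrev Ctx : Type := Multiset (ℕ × MType)

/-- The multiset of variables in an assignment. -/
def Ctx.dom (Γ : Ctx) : Multiset ℕ := Γ.map Prod.fst

/-- An assignment, seen from under `k` further binders. -/
def Ctx.shift (k : ℕ) (Γ : Ctx) : Ctx := Γ.map (fun p => (p.1 + k, p.2))

/-- The assignment `x₁ : σ, …, x_k : σ` for the `k` innermost variables. -/
def Ctx.block (k : ℕ) (σ : SType) : Ctx := (Multiset.range k).map (fun i => (i, σ.pow 1))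

mutual
/-- The typing judgement `Γ ⊢ M : τ` of the fail-free calculus. -/
inductive Typed : Ctx → Term → SType → Prop
  | var (x : ℕ) (σ : SType) : Typed {(x, σ.pow 1)} (.var x) σ
  | weak (Γ : Ctx) (x : ℕ) (M : Term) (τ : SType) :
      Typed Γ M τ → Typed (Γ + {(x, 0)}) (.share 0 M x) τ
  | abs (Γ : Ctx) (k n : ℕ) (M : Term) (σ τ : SType) :
      Typed (Γ.shift 1 + {(0, σ.pow k)}) (M.shareBound n) τ →
      Typed Γ (.lam n M) (.arr (σ.pow k) τ)
  | app (Γ Δ : Ctx) (M : Term) (B : List Term) (π : MType) (τ : SType) :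
      Typed Γ M (.arr π τ) → TypedBag Δ B π → Typed (Γ + Δ) (.app M B) τ
  | lsub (Γ Δ : Ctx) (M N : Term) (σ τ : SType) :
      Typed Δ N σ → Typed (Γ.shift 1 + {(0, σ.pow 1)}) M τ → Typed (Γ + Δ) (.lsub M N) τ
  | esub (Γ Δ : Ctx) (k n : ℕ) (M : Term) (B : List Term) (σ τ : SType) :
      TypedBag Δ B (σ.pow k) → Typed (Γ.shift 1 + {(0, σ.pow k)}) (M.shareBound n) τ →
      Typed (Γ + Δ) (.esub n M B) τ
  | share (Γ : Ctx) (k x : ℕ) (M : Term) (σ τ : SType) :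
      Typed (Γ.shift k + Ctx.block k σ) M τ → x ∉ Γ.dom → k ≠ 0 →
      Typed (Γ + {(x, σ.pow k)}) (.share k M x) τ
/-- The typing judgement `Γ ⊢ B : π` for bags of the fail-free calculus. -/
inductive TypedBag : Ctx → List Term → MType → Prop
  | one : TypedBag 0 [] 0
  | bag (Γ Δ : Ctx) (k : ℕ) (M : Term) (B : List Term) (σ : SType) :
      Typed Γ M σ → TypedBag Δ B (σ.pow k) → TypedBag (Γ + Δ) (M :: B) (σ.pow (k + 1))
end

mutual
/-- The well-formedness judgement `Γ ⊨ M : τ`. -/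
inductive WF : Ctx → Term → SType → Prop
  | wfExpr (Γ : Ctx) (M : Term) (τ : SType) : Typed Γ M τ → WF Γ M τ
  | weak (Γ : Ctx) (x : ℕ) (M : Term) (τ : SType) :
      WF Γ M τ → WF (Γ + {(x, 0)}) (.share 0 M x) τ
  | abs (Γ : Ctx) (k n : ℕ) (M : Term) (σ τ : SType) :
      WF (Γ.shift 1 + {(0, σ.pow k)}) (M.shareBound n) τ →
      WF Γ (.lam n M) (.arr (σ.pow k) τ)
  | fail (Γ : Ctx) (S : Finset ℕ) (τ : SType) : Γ.dom = S.val → WF Γ (.fail S) τ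
  | app (Γ Δ : Ctx) (j k : ℕ) (M : Term) (B : List Term) (σ τ : SType) :
      WF Γ M (.arr (σ.pow j) τ) → WFBag Δ B (σ.pow k) → WF (Γ + Δ) (.app M B) τ
  | lsub (Γ Δ : Ctx) (M N : Term) (σ τ : SType) :
      WF (Γ.shift 1 + {(0, σ.pow 1)}) M τ → WF Δ N σ → WF (Γ + Δ) (.lsub M N) τ
  | esub (Γ Δ : Ctx) (j k n : ℕ) (M : Term) (B : List Term) (σ τ : SType) :
      WF (Γ.shift 1 + {(0, σ.pow k)}) (M.shareBound n) τ → WFBag Δ B (σ.pow j) →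
      WF (Γ + Δ) (.esub n M B) τ
  | share (Γ : Ctx) (k x : ℕ) (M : Term) (σ τ : SType) :
      WF (Γ.shift k + Ctx.block k σ) M τ → x ∉ Γ.dom → k ≠ 0 →
      WF (Γ + {(x, σ.pow k)}) (.share k M x) τ
  /-- `✓` is well-formed, with any type. -/
  | tick (τ : SType) : WF 0 .tick τ
/-- The well-formedness judgement `Γ ⊨ B : π` for bags. -/
inductive WFBag : Ctx → List Term → MType → Prop
  | wfBag (Γ : Ctx) (B : List Term) (π : MType) : TypedBag Γ B π → WFBag Γ B π
  | bag (Γ Δ : Ctx) (k : ℕ) (M : Term) (B : List Term) (σ : SType) :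
      WF Γ M σ → WFBag Δ B (σ.pow k) → WFBag (Γ + Δ) (M :: B) (σ.pow (k + 1))
end

/-- The well-formedness judgement `Γ ⊨ E : τ` for expressions. -/
inductive Expr.WF : Ctx → Expr → SType → Prop
  | term (Γ : Ctx) (M : Term) (τ : SType) : SharingPi.WF Γ M τ → Expr.WF Γ [M] τ
  | sum (Γ : Ctx) (E E' : Expr) (τ : SType) :
      Expr.WF Γ E τ → Expr.WF Γ E' τ → Expr.WF Γ (E ++ E') τ

/-- Well-formed expressions. -/
def Expr.WellFormed (E : Expr) : Prop := ∃ Γ τ, Expr.WF Γ E τ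

/-! ### The session π-calculus -/

/-- Processes, including the success constant `✓`. -/
inductive Proc : Type
  /-- inaction `0` -/
  | nil : Proc
  /-- output of a fresh name, `x̄(y).P`; `y` is bound in `P` -/
  | out (x : ℕ) (P : Proc) : Proc
  /-- input `x(y).P`; `y` is bound in `P` -/
  | inp (x : ℕ) (P : Proc) : Proc
  /-- `P | Q` -/
  | par (P Q : Proc) : Proc
  /-- `(ν x) P` -/
  | nu (P : Proc) : Proc
  /-- the forwarder `[x ↔ y]` -/
  | fwd (x y : ℕ) : Proc
  /-- `x.close̅` -/
  | closeBar (x : ℕ) : Proc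
  /-- `x.close; P` -/
  | close (x : ℕ) (P : Proc) : Proc
  /-- `x.some̅; P` -/
  | someBar (x : ℕ) (P : Proc) : Proc
  /-- `x.none̅` -/
  | noneBar (x : ℕ) : Proc
  /-- `x.some_{(w₁, …, w_n)}; P`, the dependencies being given as a finite set -/
  | some (x : ℕ) (W : Finset ℕ) (P : Proc) : Proc
  /-- non-deterministic choice `P ⊕ Q` -/
  | choice (P Q : Proc) : Proc
  /-- `✓` -/
  | tick : Proc

/-- Renaming of free names. -/
def Proc.rename (f : ℕ → ℕ) : Proc → Proc
  | .nil => .nil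
  | .out x P => .out (f x) (P.rename (liftN 1 f))
  | .inp x P => .inp (f x) (P.rename (liftN 1 f))
  | .par P Q => .par (P.rename f) (Q.rename f)
  | .nu P => .nu (P.rename (liftN 1 f))
  | .fwd x y => .fwd (f x) (f y)
  | .closeBar x => .closeBar (f x)
  | .close x P => .close (f x) (P.rename f)
  | .someBar x P => .someBar (f x) (P.rename f)
  | .noneBar x => .noneBar (f x)
  | .some x W P => .some (f x) (W.image f) (P.rename f)
  | .choice P Q => .choice (P.rename f) (Q.rename f)
  | .tick => .tick

/-- `P`, seen from under a further binder. -/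
def Proc.shift (P : Proc) : Proc := P.rename (fun i => i + 1)

/-- `P{y / x}`, for the innermost name `x` of `P`, leaving the scope of `x`. -/
def Proc.inst (y : ℕ) (P : Proc) : Proc := P.rename (fun i => if i = 0 then y else i - 1)

/-- `x₁.none̅ | ⋯ | x_k.none̅` for a list of names. -/
def Proc.noneList : List ℕ → Proc
  | [] => .nil
  | x :: l => .par (.noneBar x) (Proc.noneList l)

/-- `x₁.none̅ | ⋯ | x_k.none̅` for a finite set of names. -/
def Proc.noneAll (W : Finset ℕ) : Proc := Proc.noneList (W.sort (· ≤ ·))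

/-- `P₁ ⊕ ⋯ ⊕ P_n` for a non-empty list of processes. -/
def Proc.bigChoice : List Proc → Proc
  | [] => .nil
  | [P] => P
  | P :: Q :: l => .choice P (Proc.bigChoice (Q :: l))

/-- Structural congruence: the least congruence containing the listed laws. -/
inductive Proc.Cong : Proc → Proc → Prop
  | refl (P : Proc) : Cong P P
  | symm (P Q : Proc) : Cong P Q → Cong Q P
  | trans (P Q R : Proc) : Cong P Q → Cong Q R → Cong P R
  | out (x : ℕ) (P P' : Proc) : Cong P P' → Cong (.out x P) (.out x P')
  | inp (x : ℕ) (P P' : Proc) : Cong P P' → Cong (.inp x P) (.inp x P')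
  | par (P P' Q Q' : Proc) : Cong P P' → Cong Q Q' → Cong (.par P Q) (.par P' Q')
  | nu (P P' : Proc) : Cong P P' → Cong (.nu P) (.nu P')
  | close (x : ℕ) (P P' : Proc) : Cong P P' → Cong (.close x P) (.close x P')
  | someBar (x : ℕ) (P P' : Proc) : Cong P P' → Cong (.someBar x P) (.someBar x P')
  | some (x : ℕ) (W : Finset ℕ) (P P' : Proc) : Cong P P' → Cong (.some x W P) (.some x W P')
  | choice (P P' Q Q' : Proc) : Cong P P' → Cong Q Q' → Cong (.choice P Q) (.choice P' Q')
  | parNil (P : Proc) : Cong (.par P .nil) P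
  | parComm (P Q : Proc) : Cong (.par P Q) (.par Q P)
  | parAssoc (P Q R : Proc) : Cong (.par (.par P Q) R) (.par P (.par Q R))
  | fwdComm (x y : ℕ) : Cong (.fwd x y) (.fwd y x)
  | extrude (P Q : Proc) : Cong (.par (.nu P) Q) (.nu (.par P Q.shift))
  | distrib (P Q R : Proc) :
      Cong (.nu (.par P (.choice Q R))) (.choice (.nu (.par P Q)) (.nu (.par P R)))
  | choiceNil : Cong (.choice .nil .nil) .nil
  | choiceComm (P Q : Proc) : Cong (.choice P Q) (.choice Q P)
  | choiceAssoc (P Q R : Proc) : Cong (.choice (.choice P Q) R) (.choice P (.choice Q R))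
  | nuNil : Cong (.nu .nil) .nil
  | nuNu (P : Proc) : Cong (.nu (.nu P)) (.nu (.nu (P.rename (blockSwap 1 1))))

/-- Reduction of processes. -/
inductive Proc.Red : Proc → Proc → Prop
  | comm (x : ℕ) (P Q : Proc) : Red (.par (.out x Q) (.inp x P)) (.nu (.par Q P))
  /-- `(ν x)([x ↔ y] | P) ⟶ P{y / x}` with `y ≠ x`: outside the restriction the name is `y`. -/
  | forw (y : ℕ) (P : Proc) : Red (.nu (.par (.fwd 0 (y + 1)) P)) (P.inst y)
  | close (x : ℕ) (P : Proc) : Red (.par (.closeBar x) (.close x P)) P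
  | some (x : ℕ) (W : Finset ℕ) (P Q : Proc) :
      Red (.par (.someBar x P) (.some x W Q)) (.par P Q)
  | none (x : ℕ) (W : Finset ℕ) (Q : Proc) :
      Red (.par (.noneBar x) (.some x W Q)) (Proc.noneAll W)
  | cong (P P' Q' Q : Proc) : Proc.Cong P P' → Red P' Q' → Proc.Cong Q' Q → Red P Q
  | par (P Q Q' : Proc) : Red Q Q' → Red (.par P Q) (.par P Q')
  | nu (P Q : Proc) : Red P Q → Red (.nu P) (.nu Q)
  | choice (P Q Q' : Proc) : Red Q Q' → Red (.choice P Q) (.choice P Q')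

/-- `P` contains an occurrence of `✓` that is not behind a prefix. -/
def Proc.Unguarded : Proc → Prop
  | .tick => True
  | .par P Q => P.Unguarded ∨ Q.Unguarded
  | .nu P => P.Unguarded
  | .choice P Q => P.Unguarded ∨ Q.Unguarded
  | _ => False

/-- Success: `P` reduces to a process with an unguarded occurrence of `✓`. -/
def Proc.Success (P : Proc) : Prop := ∃ P', Relation.ReflTransGen Proc.Red P P' ∧ P'.Unguarded

/-! ### The translation

The translation of a term depends on an environment `ρ`, which gives the name that stands for each
free variable, and on the name `u`. -/

/-- The translation of a term, as a function of the environment and of the name `u`. -/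
abbrev Sem : Type := (ℕ → ℕ) → ℕ → Proc

/-- The part of the translation of a sharing `M[x₁, …, x_k ← x]` that remains after the names for
`x₁, …, x_i` have been received, where `k = i + r`; `F` is the translation of `M`, `V` the set of
free variables of `M`, and `ρ` the environment for the free variables of `M` other than
`x_{i+1}, …, x_k`. -/
def encShareAux (F : Sem) (V : Finset ℕ) : (r i : ℕ) → (ℕ → ℕ) → (x u : ℕ) → Proc
  | 0, _, ρ, x, u =>
      .someBar x (.out x (.par
        (.some 0 (insert (u + 1) (V.image (fun j => ρ j + 1)))
          (.close 0 (F (fun j => ρ j + 1) (u + 1))))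
        (.noneBar (x + 1))))
  | r + 1, i, ρ, x, u =>
      .someBar x (.out x (.par
        (.some 0 ∅ (.close 0 .nil))
        (.someBar (x + 1)
          (.some (x + 1)
            (insert (u + 1)
              ((V.filter (fun j => ¬ (i ≤ j ∧ j < i + (r + 1)))).image (fun j => ρ j + 1)))
            (.inp (x + 1)
              (encShareAux F V r (i + 1) (fun j => if j = i then 0 else ρ j + 2)
                (x + 2) (u + 2)))))))

/-- The translation of `M[x₁, …, x_k ← x]`, where `F` is the translation of `M` and `V` its set of
free variables; `x` is the name for the sharing variable. -/
def encShare (F : Sem) (V : Finset ℕ) (k : ℕ) (ρ : ℕ → ℕ) (x u : ℕ) : Proc :=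
  encShareAux F V k 0 (fun j => ρ (j - k)) x u

/-- The union of the sets of free variables of the elements of a bag. -/
def fvSem : List (Finset ℕ × Sem) → Finset ℕ
  | [] => ∅
  | p :: B => p.1 ∪ fvSem B

/-- The translation of a bag at the name `x`, in the order of the given list; each element is given
by its set of free variables and its translation. -/
def encBag : List (Finset ℕ × Sem) → (ℕ → ℕ) → ℕ → Proc
  | [], _, x =>
      .some x ∅ (.inp x (.par (.someBar 0 (.closeBar 0)) (.some (x + 1) ∅ (.noneBar (x + 1)))))
  | p :: B, ρ, x =>
      .some x ((fvSem (p :: B)).image ρ) (.inp x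
        (.some (x + 1) (insert 0 ((fvSem (p :: B)).image (fun j => ρ j + 1)))
          (.someBar (x + 1) (.out (x + 1) (.par
            (.some 0 (p.1.image (fun j => ρ j + 2)) (p.2 (fun j => ρ j + 2) 0))
            (.par (encBag B (fun j => ρ j + 2) (x + 2)) (.noneBar 1)))))))

mutual
/-- The translation of terms. -/
def Term.enc : Term → Sem
  | .var x => fun ρ u => .someBar (ρ x) (.fwd (ρ x) u)
  | .lam k M => fun ρ u =>
      .someBar u (.inp u (encShare M.enc M.fv k (fun j => ρ j + 1) 0 (u + 1)))
  | .app M B => fun ρ u =>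
      .bigChoice ((semBag B).permutations.map (fun B' =>
        .nu (.par (M.enc (fun j => ρ j + 1) 0)
          (.some 0 (insert (u + 1) ((fvBag B).image (fun j => ρ j + 1)))
            (.out 0 (.par (.fwd 1 (u + 2)) (encBag B' (fun j => ρ j + 2) 0)))))))
  | .lsub M N => fun ρ u =>
      .nu (.par (M.enc (liftN 1 ρ) (u + 1))
        (.some 0 (N.fv.image (fun j => ρ j + 1)) (N.enc (fun j => ρ j + 1) 0)))
  | .fail S => fun ρ u => .par (.noneBar u) (.noneAll (S.image ρ))
  | .share k M x => fun ρ u => encShare M.enc M.fv k ρ (ρ x) u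
  | .esub k M B => fun ρ u =>
      .bigChoice ((semBag B).permutations.map (fun B' =>
        .nu (.par (encShare M.enc M.fv k (fun j => ρ j + 1) 0 (u + 1))
          (encBag B' (fun j => ρ j + 1) 0))))
  | .tick => fun _ _ => .tick
/-- The elements of a bag, each with its free variables and its translation. -/
def semBag : List Term → List (Finset ℕ × Sem)
  | [] => []
  | M :: B => (M.fv, M.enc) :: semBag B
end

/-- The translation of an expression at the name `u`; a free variable is its own name. -/
def Expr.enc (E : Expr) (u : ℕ) : Proc := .bigChoice (E.map (fun M => M.enc id u))

end SharingPi

namespace SharingPi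

/-! ### Renaming of processes -/

-- Both notions of success are shown equivalent to acceptance by one abstract machine. A state of
-- the machine (`Eval`) is a term, an environment of closures and a stack of bags. It follows the
-- head of the term in the style of Krivine, guesses an ordering of each bag, and gets stuck on
-- `fail` and on a bag of the wrong length. What makes the argument work is affinity: in a closed
-- proper term no variable is used by two components of a node, and no sharing construct stands
-- apart from its binder (`Term.Proper.ok`).
--
-- Source calculus. A term evaluates iff some summand of its reduct evaluates (`Red.eval_iff`), the
-- precongruence does not affect evaluation (`Pre.eval_iff`), and a term with head ✓ evaluates.
-- Conversely, a closed term that evaluates on the empty stack has head ✓ or steps, up to the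
-- precongruence, to smaller terms only (`Eval.progress`), because substitution copies nothing. So
-- an expression succeeds iff one of its summands evaluates.
--
-- From processes to the machine. Reductions of independent sessions interleave, so reduction
-- sequences are hard to invert. They are replaced by a compositional trace semantics: `Proc.Run γ
-- b` describes a partial execution by the finite session it shows at each free name and by whether
-- it reaches ✓; a restriction demands that the two users of the name show the same session. Runs
-- are invariant under structural congruence (`Proc.Cong.run_iff`) and, for processes that use names
-- linearly, a run of a reduct lifts to the process it came from (`Proc.Red.run_of_run`). A
-- successful translation therefore has a run that reaches ✓. Such a run can be read in the order of
-- the machine: a session that is idle or only says `none` never leads to success, so the live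
-- sessions start at the head, and each machine step can be inverted (`StateAns.eval`). The heart is
-- `served_or_dead`, on the protocol between a sharing construct and a bag.
--
-- From the machine to processes. By induction on the evaluation, every machine step is matched by
-- reductions of a parallel composition of the translated term, the closures, the stack frames and
-- garbage, below restrictions (`Eval.simulates`); `Win.serve` plays the sharing protocol forwards.

theorem liftN_one_zero (f : ℕ → ℕ) : liftN 1 f 0 = 0 := by simp [liftN]

theorem liftN_one_succ (f : ℕ → ℕ) (i : ℕ) : liftN 1 f (i + 1) = f i + 1 := by simp [liftN]

theorem liftN_comp (k : ℕ) (f g : ℕ → ℕ) : liftN k f ∘ liftN k g = liftN k (f ∘ g) := by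
  funext i
  by_cases h : i < k
  · simp [liftN, h]
  · have : ¬ g (i - k) + k < k := by omega
    simp [liftN, h]

theorem liftN_id (k : ℕ) : liftN k id = id := by
  funext i
  by_cases h : i < k
  · simp [liftN, h]
  · simp only [liftN, h, if_false, id]
    omega

theorem liftN_injective {f : ℕ → ℕ} (hf : f.Injective) (k : ℕ) : (liftN k f).Injective := by
  intro i j h
  simp only [liftN] at h
  split_ifs at h
  · exact h
  · omega
  · omega
  · have := hf (by omega : f (i - k) = f (j - k))
    omega

theorem Proc.rename_rename (f g : ℕ → ℕ) (P : Proc) :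
    (P.rename g).rename f = P.rename (f ∘ g) := by
  induction P generalizing f g <;>
    simp_all [Proc.rename, liftN_comp, Finset.image_image]

theorem Proc.rename_id (P : Proc) : P.rename id = P := by
  induction P <;> simp_all [Proc.rename, liftN_id]

/-- The number of parallel components of a process that use a name. -/
def Proc.cnt : Proc → ℕ → ℕ
  | .nil, _ => 0
  | .out x P, i => max (if i = x then 1 else 0) (P.cnt (i + 1))
  | .inp x P, i => max (if i = x then 1 else 0) (P.cnt (i + 1))
  | .par P Q, i => P.cnt i + Q.cnt i
  | .nu P, i => P.cnt (i + 1)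
  | .fwd x y, i => (if i = x then 1 else 0) + (if i = y then 1 else 0)
  | .closeBar x, i => if i = x then 1 else 0
  | .close x P, i => max (if i = x then 1 else 0) (P.cnt i)
  | .someBar x P, i => max (if i = x then 1 else 0) (P.cnt i)
  | .noneBar x, i => if i = x then 1 else 0
  | .some x W P, i => max (if i = x ∨ i ∈ W then 1 else 0) (P.cnt i)
  | .choice P Q, i => max (P.cnt i) (Q.cnt i)
  | .tick, _ => 0

/-- Bound names are used linearly: at most once after a communication prefix, and by at most two
components below a restriction. -/
def Proc.Lin : Proc → Prop
  | .nil => True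
  | .out _ P => P.cnt 0 ≤ 1 ∧ P.Lin
  | .inp _ P => P.cnt 0 ≤ 1 ∧ P.Lin
  | .par P Q => P.Lin ∧ Q.Lin
  | .nu P => P.cnt 0 ≤ 2 ∧ P.Lin
  | .fwd _ _ => True
  | .closeBar _ => True
  | .close _ P => P.Lin
  | .someBar _ P => P.Lin
  | .noneBar _ => True
  | .some _ _ P => P.Lin
  | .choice P Q => P.Lin ∧ Q.Lin
  | .tick => True

theorem Proc.rename_congr {f g : ℕ → ℕ} {P : Proc} (h : ∀ i, P.cnt i ≠ 0 → f i = g i) :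
    P.rename f = P.rename g := by
  induction P generalizing f g with
  | nil => rfl
  | out x P ih =>
    simp only [Proc.rename, Proc.out.injEq]
    refine ⟨h x (by simp [Proc.cnt]), ih fun i hi => ?_⟩
    cases i with
    | zero => simp [liftN_one_zero]
    | succ i => simp [liftN_one_succ, h i (by simp [Proc.cnt, hi])]
  | inp x P ih =>
    simp only [Proc.rename, Proc.inp.injEq]
    refine ⟨h x (by simp [Proc.cnt]), ih fun i hi => ?_⟩
    cases i with
    | zero => simp [liftN_one_zero]
    | succ i => simp [liftN_one_succ, h i (by simp [Proc.cnt, hi])]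
  | par P Q ihP ihQ =>
    simp only [Proc.rename, Proc.par.injEq]
    exact ⟨ihP fun i hi => h i (by simp [Proc.cnt, hi]), ihQ fun i hi => h i (by simp [Proc.cnt, hi])⟩
  | nu P ih =>
    simp only [Proc.rename, Proc.nu.injEq]
    refine ih fun i hi => ?_
    cases i with
    | zero => simp [liftN_one_zero]
    | succ i => simp [liftN_one_succ, h i (by simp [Proc.cnt, hi])]
  | fwd x y => simp [Proc.rename, h x (by simp [Proc.cnt]), h y (by simp [Proc.cnt])]
  | closeBar x => simp [Proc.rename, h x (by simp [Proc.cnt])]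
  | close x P ih =>
    simp only [Proc.rename, Proc.close.injEq]
    exact ⟨h x (by simp [Proc.cnt]), ih fun i hi => h i (by simp [Proc.cnt, hi])⟩
  | someBar x P ih =>
    simp only [Proc.rename, Proc.someBar.injEq]
    exact ⟨h x (by simp [Proc.cnt]), ih fun i hi => h i (by simp [Proc.cnt, hi])⟩
  | noneBar x => simp [Proc.rename, h x (by simp [Proc.cnt])]
  | some x W P ih =>
    simp only [Proc.rename, Proc.some.injEq]
    exact ⟨h x (by simp [Proc.cnt]), Finset.image_congr fun i hi => h i (by
      have : i ∈ W := hi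
      simp [Proc.cnt, this]), ih fun i hi => h i (by simp [Proc.cnt, hi])⟩
  | choice P Q ihP ihQ =>
    simp only [Proc.rename, Proc.choice.injEq]
    exact ⟨ihP fun i hi => h i (by simp [Proc.cnt, hi]), ihQ fun i hi => h i (by simp [Proc.cnt, hi])⟩
  | tick => rfl

theorem Proc.rename_eq_self {f : ℕ → ℕ} {P : Proc} (h : ∀ i, P.cnt i ≠ 0 → f i = i) :
    P.rename f = P := by
  rw [Proc.rename_congr (g := id) h, Proc.rename_id]

/-! ### Counting uses under renaming -/

theorem liftN_one_eq_succ {f : ℕ → ℕ} {i n : ℕ} (h : liftN 1 f i = n + 1) :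
    ∃ j, i = j + 1 ∧ f j = n := by
  cases i with
  | zero => simp [liftN_one_zero] at h
  | succ i => exact ⟨i, rfl, by simpa [liftN_one_succ] using h⟩

theorem liftN_one_eq_zero {f : ℕ → ℕ} {i : ℕ} (h : liftN 1 f i = 0) : i = 0 := by
  cases i with
  | zero => rfl
  | succ i => simp [liftN_one_succ] at h

/-- A renaming may identify names, so the uses of all preimages accumulate; only preimages that are
really used have to lie in `S`. The sum is just an upper bound, since a prefix counts by a maximum.
-/
theorem Proc.cnt_rename_le {f : ℕ → ℕ} {P : Proc} {n : ℕ} {S : Finset ℕ}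
    (h : ∀ i, f i = n → i ∈ S ∨ P.cnt i = 0) : (P.rename f).cnt n ≤ ∑ i ∈ S, P.cnt i := by
  induction P generalizing f n S with
  | nil => simp [Proc.rename, Proc.cnt]
  | out x P ih | inp x P ih =>
    simp only [Proc.rename, Proc.cnt] at h ⊢
    refine max_le ?_ ?_
    · split_ifs with hn
      · have hx : x ∈ S := (h x hn.symm).resolve_right (by simp)
        exact le_trans (by simp) (Finset.single_le_sum
          (f := fun i => max (if i = x then 1 else 0) (P.cnt (i + 1))) (fun _ _ => Nat.zero_le _) hx)
      · exact Nat.zero_le _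
    · refine (ih (S := S.map ⟨_, Nat.succ_injective⟩) fun i hi => ?_).trans ?_
      · obtain ⟨j, rfl, hj⟩ := liftN_one_eq_succ hi
        rcases h j hj with h | h
        · left; simpa using h
        · right; omega
      · rw [Finset.sum_map]
        exact Finset.sum_le_sum fun i _ => le_max_right _ _
  | par P Q ihP ihQ =>
    simp only [Proc.rename, Proc.cnt, Finset.sum_add_distrib] at h ⊢
    exact add_le_add (ihP fun i hi => (h i hi).imp_right fun h => by omega)
      (ihQ fun i hi => (h i hi).imp_right fun h => by omega)
  | nu P ih =>
    simp only [Proc.rename, Proc.cnt] at h ⊢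
    refine (ih (S := S.map ⟨_, Nat.succ_injective⟩) fun i hi => ?_).trans ?_
    · obtain ⟨j, rfl, hj⟩ := liftN_one_eq_succ hi
      rcases h j hj with h | h
      · left; simpa using h
      · right; omega
    · rw [Finset.sum_map]; rfl
  | fwd x y =>
    simp only [Proc.rename, Proc.cnt, Finset.sum_add_distrib] at h ⊢
    refine add_le_add ?_ ?_
    · split_ifs with hn
      · have hx : x ∈ S := (h x hn.symm).resolve_right (by simp)
        simp [hx]
      · exact Nat.zero_le _
    · split_ifs with hn
      · have hx : y ∈ S := (h y hn.symm).resolve_right (by simp)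
        simp [hx]
      · exact Nat.zero_le _
  | closeBar x | noneBar x =>
    simp only [Proc.rename, Proc.cnt] at h ⊢
    split_ifs with hn
    · have hx : x ∈ S := (h x hn.symm).resolve_right (by simp)
      simp [hx]
    · exact Nat.zero_le _
  | close x P ih | someBar x P ih =>
    simp only [Proc.rename, Proc.cnt] at h ⊢
    refine max_le ?_ ?_
    · split_ifs with hn
      · have hx : x ∈ S := (h x hn.symm).resolve_right (by simp)
        exact le_trans (by simp) (Finset.single_le_sum
          (f := fun i => max (if i = x then 1 else 0) (P.cnt i)) (fun _ _ => Nat.zero_le _) hx)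
      · exact Nat.zero_le _
    · refine (ih (S := S) fun i hi => (h i hi).imp_right fun h => by omega).trans ?_
      exact Finset.sum_le_sum fun i _ => le_max_right _ _
  | some x W P ih =>
    simp only [Proc.rename, Proc.cnt] at h ⊢
    refine max_le ?_ ?_
    · split_ifs with hn
      · obtain ⟨w, hw, hn⟩ : ∃ w, (w = x ∨ w ∈ W) ∧ f w = n := by
          rcases hn with hn | hn
          · exact ⟨x, Or.inl rfl, hn.symm⟩
          · obtain ⟨w, hw, hn⟩ := Finset.mem_image.1 hn
            exact ⟨w, Or.inr hw, hn⟩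
        have hx : w ∈ S := (h w hn).resolve_right (by simp [hw])
        exact le_trans (by simp [hw]) (Finset.single_le_sum
          (f := fun i => max (if i = x ∨ i ∈ W then 1 else 0) (P.cnt i))
          (fun _ _ => Nat.zero_le _) hx)
      · exact Nat.zero_le _
    · refine (ih (S := S) fun i hi => (h i hi).imp_right fun h => by omega).trans ?_
      exact Finset.sum_le_sum fun i _ => le_max_right _ _
  | choice P Q ihP ihQ =>
    simp only [Proc.rename, Proc.cnt] at h ⊢
    refine max_le ?_ ?_
    · refine (ihP (S := S) fun i hi => (h i hi).imp_right fun h => by omega).trans ?_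
      exact Finset.sum_le_sum fun i _ => le_max_left _ _
    · refine (ihQ (S := S) fun i hi => (h i hi).imp_right fun h => by omega).trans ?_
      exact Finset.sum_le_sum fun i _ => le_max_right _ _
  | tick => simp [Proc.rename, Proc.cnt]

theorem Proc.cnt_le_rename (f : ℕ → ℕ) (P : Proc) (i : ℕ) : P.cnt i ≤ (P.rename f).cnt (f i) := by
  have one : ∀ {x : ℕ}, (if i = x then 1 else 0) ≤ (if f i = f x then 1 else 0) := by
    intro x; split_ifs <;> simp_all
  induction P generalizing f i with
  | nil => simp [Proc.rename, Proc.cnt]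
  | out x P ih | inp x P ih =>
    simp only [Proc.rename, Proc.cnt]
    refine max_le_max (by split_ifs <;> simp_all) ?_
    have := ih (liftN 1 f) (i + 1) (by intro x; split_ifs <;> simp_all)
    rwa [liftN_one_succ] at this
  | par P Q ihP ihQ =>
    simp only [Proc.rename, Proc.cnt]
    exact add_le_add (ihP f i one) (ihQ f i one)
  | nu P ih =>
    simp only [Proc.rename, Proc.cnt]
    have := ih (liftN 1 f) (i + 1) (by intro x; split_ifs <;> simp_all)
    rwa [liftN_one_succ] at this
  | fwd x y => exact add_le_add one one
  | closeBar x | noneBar x => exact one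
  | close x P ih | someBar x P ih => exact max_le_max one (ih f i one)
  | some x W P ih =>
    refine max_le_max ?_ (ih f i one)
    split_ifs with h1 h2 <;> simp_all
    rcases h1 with rfl | h1
    · exact h2.1 rfl
    · exact h2.2 i h1 rfl
  | choice P Q ihP ihQ => exact max_le_max (ihP f i one) (ihQ f i one)
  | tick => simp [Proc.rename, Proc.cnt]

theorem Proc.cnt_rename_of_not_mem {f : ℕ → ℕ} {P : Proc} {n : ℕ}
    (h : ∀ i, f i = n → P.cnt i = 0) : (P.rename f).cnt n = 0 :=
  Nat.le_zero.1 (by simpa using P.cnt_rename_le (S := ∅) fun i hi => Or.inr (h i hi))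

theorem Proc.cnt_rename_of_unique {f : ℕ → ℕ} {P : Proc} {i : ℕ}
    (h : ∀ j, f j = f i → j = i) : (P.rename f).cnt (f i) = P.cnt i :=
  le_antisymm (by simpa using P.cnt_rename_le (S := {i}) fun j hj => Or.inl (by simp [h j hj]))
    (P.cnt_le_rename f i)

theorem Proc.cnt_shift_succ (P : Proc) (i : ℕ) : P.shift.cnt (i + 1) = P.cnt i :=
  P.cnt_rename_of_unique (f := fun i => i + 1) fun j hj => by simpa using hj

theorem Proc.cnt_shift_zero (P : Proc) : P.shift.cnt 0 = 0 :=
  P.cnt_rename_of_not_mem fun i hi => by simp at hi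

theorem Proc.cnt_rename_lift_zero (f : ℕ → ℕ) (P : Proc) :
    (P.rename (liftN 1 f)).cnt 0 = P.cnt 0 := by
  have := P.cnt_rename_of_unique (f := liftN 1 f) (i := 0)
    fun j hj => liftN_one_eq_zero (by simpa [liftN_one_zero] using hj)
  rwa [liftN_one_zero] at this

theorem Proc.lin_rename (f : ℕ → ℕ) (P : Proc) : (P.rename f).Lin ↔ P.Lin := by
  induction P generalizing f <;> simp_all [Proc.rename, Proc.Lin, Proc.cnt_rename_lift_zero]

theorem blockSwap_one_one_invol (i : ℕ) : blockSwap 1 1 (blockSwap 1 1 i) = i := by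
  simp only [blockSwap]; split_ifs <;> omega

theorem Proc.cnt_rename_swap (P : Proc) (i : ℕ) :
    (P.rename (blockSwap 1 1)).cnt i = P.cnt (blockSwap 1 1 i) := by
  have := P.cnt_rename_of_unique (f := blockSwap 1 1) (i := blockSwap 1 1 i) fun j hj => by
    rw [blockSwap_one_one_invol] at hj
    rw [← hj, blockSwap_one_one_invol]
  rwa [blockSwap_one_one_invol] at this

/-! ### Linearity along structural congruence and reduction -/

/-- The law `distrib` copies `P`, which is harmless because the branches of a choice are counted by
a maximum and not by a sum. -/
theorem Proc.Cong.cnt_eq {P Q : Proc} (h : P.Cong Q) : ∀ i, P.cnt i = Q.cnt i := by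
  induction h with
  | refl => exact fun _ => rfl
  | symm _ _ _ ih => exact fun i => (ih i).symm
  | trans _ _ _ _ _ ih1 ih2 => exact fun i => (ih1 i).trans (ih2 i)
  | extrude P Q => intro i; simp [Proc.cnt, Proc.cnt_shift_succ]
  | distrib P Q R => intro i; simp only [Proc.cnt]; omega
  | nuNu P =>
    intro i
    simp only [Proc.cnt, Proc.cnt_rename_swap]
    congr 1
  | _ => intro i; simp_all [Proc.cnt] <;> omega

theorem Proc.Cong.lin_iff {P Q : Proc} (h : P.Cong Q) : P.Lin ↔ Q.Lin := by
  induction h with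
  | refl => rfl
  | symm _ _ _ ih => exact ih.symm
  | trans _ _ _ _ _ ih1 ih2 => exact ih1.trans ih2
  | out _ _ _ h ih | inp _ _ _ h ih | nu _ _ h ih => simp [Proc.Lin, h.cnt_eq, ih]
  | extrude P Q =>
    simp [Proc.Lin, Proc.cnt, Proc.cnt_shift_zero]
    simp only [Proc.shift, Proc.lin_rename]; tauto
  | distrib P Q R => simp only [Proc.cnt, Proc.Lin]; constructor <;> intro h <;> grind
  | nuNu P =>
    simp only [Proc.Lin, Proc.cnt, Proc.cnt_rename_swap, Proc.lin_rename]
    simp [blockSwap]; tauto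
  | _ => simp_all [Proc.Lin, Proc.cnt] <;> tauto

theorem Proc.cnt_noneList {l : List ℕ} (i : ℕ) : (Proc.noneList l).cnt i = l.count i := by
  induction l with
  | nil => rfl
  | cons x l ih =>
    simp only [Proc.noneList, Proc.cnt, ih, List.count_cons, beq_iff_eq]
    rw [add_comm]; simp [eq_comm]

theorem Proc.cnt_noneAll (W : Finset ℕ) (i : ℕ) :
    (Proc.noneAll W).cnt i = if i ∈ W then 1 else 0 := by
  rw [Proc.noneAll, Proc.cnt_noneList]
  split_ifs with h
  · exact List.count_eq_one_of_mem (Finset.sort_nodup _ _) ((Finset.mem_sort _).2 h)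
  · exact List.count_eq_zero_of_not_mem (by simpa using h)

theorem Proc.lin_noneList (l : List ℕ) : (Proc.noneList l).Lin := by
  induction l <;> simp_all [Proc.noneList, Proc.Lin]

theorem Proc.cnt_inst_le (P : Proc) (y i : ℕ) :
    (P.inst y).cnt i ≤ P.cnt (i + 1) + if i = y then P.cnt 0 else 0 := by
  split_ifs with h
  · subst h
    refine (P.cnt_rename_le (S := {i + 1, 0}) fun j hj => ?_).trans (by simp)
    left
    split_ifs at hj <;> simp_all; omega
  · refine (P.cnt_rename_le (S := {i + 1}) fun j hj => ?_).trans (by simp)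
    left
    split_ifs at hj
    · exact absurd hj.symm h
    · simp; omega

/-- Subject reduction for linearity. The name passed in a communication is held at most once on
either side, so its new restriction has at most two users. A restricted forwarder is itself one of
the two users of `x`, so substituting `y` for `x` gives `y` at most one new user, which replaces the
forwarder. -/
theorem Proc.Red.lin_and_cnt_le {P P' : Proc} (h : P.Red P') :
    P.Lin → (∀ i, P.cnt i ≤ 2) → P'.Lin ∧ ∀ i, P'.cnt i ≤ P.cnt i := by
  induction h with
  | comm x P Q =>
    simp only [Proc.Lin, Proc.cnt]
    intro h _
    exact ⟨by grind, fun i => by omega⟩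
  | forw y P =>
    simp only [Proc.Lin, Proc.cnt]
    intro h h2
    refine ⟨(Proc.lin_rename _ _).2 h.2.2, fun i => (P.cnt_inst_le y i).trans ?_⟩
    have := h.1
    simp at this ⊢
    split_ifs <;> omega
  | close x P | some x W P Q =>
    simp only [Proc.Lin, Proc.cnt]
    exact fun h _ => ⟨by tauto, fun i => by omega⟩
  | none x W Q =>
    simp only [Proc.Lin, Proc.cnt]
    refine fun h _ => ⟨Proc.lin_noneList _, fun i => ?_⟩
    rw [Proc.cnt_noneAll]
    split_ifs <;> simp_all
  | cong P P' Q' Q h1 _ h2 ih =>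
    intro h hc
    obtain ⟨h3, h4⟩ := ih (h1.lin_iff.1 h) fun i => by rw [← h1.cnt_eq]; exact hc i
    exact ⟨h2.lin_iff.1 h3, fun i => by rw [← h2.cnt_eq, h1.cnt_eq]; exact h4 i⟩
  | par P Q Q' _ ih | choice P Q Q' _ ih =>
    simp only [Proc.Lin, Proc.cnt]
    intro h hc
    obtain ⟨h3, h4⟩ := ih h.2 fun i => by have := hc i; omega
    exact ⟨⟨h.1, h3⟩, fun i => by have := h4 i; omega⟩
  | nu P Q _ ih =>
    simp only [Proc.Lin, Proc.cnt]
    intro h hc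
    obtain ⟨h3, h4⟩ := ih h.2 fun i => by
      cases i with
      | zero => exact h.1
      | succ i => exact hc i
    exact ⟨⟨(h4 0).trans h.1, h3⟩, fun i => h4 _⟩

end SharingPi


namespace SharingPi

/-! ### Traces and runs of processes -/

/-- The (non-empty) interaction that takes place at a name, seen as a finite session. The absence
of further interaction is `Option.none`. -/
inductive Trace : Type
  /-- a name is passed, on which `a` happens; the session continues with `c` -/
  | comm (a c : Option Trace) : Trace
  | close : Trace
  | some (c : Option Trace) : Trace
  | none : Trace

/-- What one user contributes to a name on which the session `t` takes place. -/
def sess (t : Option Trace) : Multiset Trace := t.elim 0 fun a => {a}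

/-- The contributions at a name come from two users that agree on the session. -/
def Balanced (α : Multiset Trace) : Prop := ∃ t, α = sess t + sess t

/-- The contributions to all names; the head is the contribution to the innermost name. -/
def consUse (α : Multiset Trace) (γ : ℕ → Multiset Trace) : ℕ → Multiset Trace
  | 0 => α
  | i + 1 => γ i

/-- `P.Run γ b`: some partial execution of `P` contributes `γ` to the sessions at its free names;
`b` tells whether it reaches `✓`. -/
def Proc.Run : Proc → (ℕ → Multiset Trace) → Bool → Prop
  | .nil, γ, b => γ = 0 ∧ b = false
  | .out x P, γ, b | .inp x P, γ, b =>
      (γ = 0 ∧ b = false) ∨ ∃ a c γ', P.Run (consUse (sess a) γ') b ∧ γ' x = sess c ∧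
        γ = Function.update γ' x {Trace.comm a c}
  | .par P Q, γ, b =>
      ∃ γ₁ γ₂ b₁ b₂, γ = γ₁ + γ₂ ∧ b = (b₁ || b₂) ∧ P.Run γ₁ b₁ ∧ Q.Run γ₂ b₂
  | .nu P, γ, b => ∃ α, Balanced α ∧ P.Run (consUse α γ) b
  | .fwd x y, γ, b => b = false ∧ ∃ t, γ = Pi.single x (sess t) + Pi.single y (sess t)
  | .closeBar x, γ, b => b = false ∧ (γ = 0 ∨ γ = Pi.single x {Trace.close})
  | .close x P, γ, b =>
      (γ = 0 ∧ b = false) ∨ ∃ γ', P.Run γ' b ∧ γ' x = 0 ∧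
        γ = Function.update γ' x {Trace.close}
  | .someBar x P, γ, b =>
      (γ = 0 ∧ b = false) ∨ ∃ c γ', P.Run γ' b ∧ γ' x = sess c ∧
        γ = Function.update γ' x {Trace.some c}
  | .noneBar x, γ, b => b = false ∧ (γ = 0 ∨ γ = Pi.single x {Trace.none})
  | .some x W P, γ, b =>
      ((γ = 0 ∧ b = false) ∨ ∃ c γ', P.Run γ' b ∧ γ' x = sess c ∧
        γ = Function.update γ' x {Trace.some c}) ∨
      (b = false ∧ γ x = {Trace.none} ∧ ∀ n, n ≠ x → γ n = 0 ∨ (n ∈ W ∧ γ n = {Trace.none}))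
  | .choice P Q, γ, b => P.Run γ b ∨ Q.Run γ b
  | .tick, γ, b => γ = 0 ∧ b = true

theorem sess_none : sess Option.none = 0 := rfl

theorem card_sess_le (t : Option Trace) : (sess t).card ≤ 1 := by
  cases t <;> simp [sess]

theorem exists_sess_of_card_le {α : Multiset Trace} (h : α.card ≤ 1) : ∃ t, α = sess t := by
  rcases Nat.le_one_iff_eq_zero_or_eq_one.1 h with h | h
  · exact ⟨.none, by simpa [sess] using h⟩
  · obtain ⟨t, rfl⟩ := Multiset.card_eq_one.1 h
    exact ⟨.some t, rfl⟩

theorem balanced_zero : Balanced 0 := ⟨.none, rfl⟩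

theorem not_balanced_singleton (t : Trace) : ¬ Balanced {t} := by
  rintro ⟨s, h⟩
  have := congrArg Multiset.card h
  cases s <;> simp [sess] at this

/-- A balanced multiset is empty or of the form `{t, t}`, so neither side can act alone. This is how
linearity turns balance into agreement of the two users of a name. -/
theorem Balanced.eq_of_card_le {α β : Multiset Trace} (h : Balanced (α + β))
    (hα : α.card ≤ 1) (hβ : β.card ≤ 1) : α = β := by
  obtain ⟨s, rfl⟩ := exists_sess_of_card_le hα
  obtain ⟨t, rfl⟩ := exists_sess_of_card_le hβ
  obtain ⟨r, h⟩ := h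
  have hc := congrArg Multiset.card h
  cases s <;> cases t <;> cases r <;> simp [sess] at hc h ⊢
  rename_i a b c
  have h1 : a ∈ ({a} + {b} : Multiset Trace) := by simp
  have h2 : b ∈ ({a} + {b} : Multiset Trace) := by simp
  have h' : ({a} + {b} : Multiset Trace) = {c} + {c} := h
  rw [h'] at h1 h2
  simp at h1 h2
  rw [h1, h2]

theorem Balanced.eq_zero_of_card_le {α : Multiset Trace} (h : Balanced α) (hα : α.card ≤ 1) :
    α = 0 := by
  have := Balanced.eq_of_card_le (α := α) (β := 0) (by simpa using h) hα (by simp)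
  exact this

theorem consUse_add (α β : Multiset Trace) (γ δ : ℕ → Multiset Trace) :
    consUse α γ + consUse β δ = consUse (α + β) (γ + δ) := by
  funext i; cases i <;> rfl

theorem consUse_head_tail (γ : ℕ → Multiset Trace) : consUse (γ 0) (fun i => γ (i + 1)) = γ := by
  funext i; cases i <;> rfl

theorem consUse_eq_add {α : Multiset Trace} {γ γ₁ γ₂ : ℕ → Multiset Trace}
    (h : consUse α γ = γ₁ + γ₂) : α = γ₁ 0 + γ₂ 0 ∧ ∀ i, γ i = γ₁ (i + 1) + γ₂ (i + 1) :=
  ⟨congrFun h 0, fun i => congrFun h (i + 1)⟩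

theorem consUse_zero_zero : consUse 0 0 = 0 := by
  funext i; cases i <;> rfl

theorem card_update_le {x i : ℕ} {t : Trace} {γ : ℕ → Multiset Trace} {c : ℕ}
    (h : (γ i).card ≤ c) :
    ((Function.update γ x {t}) i).card ≤ max (if i = x then 1 else 0) c := by
  by_cases hx : i = x
  · subst hx; simp
  · simp [hx, h]

/-- A component that uses a name contributes one trace at most, namely its whole session there,
however many prefixes are involved. -/
theorem Proc.Run.card_le {P : Proc} {γ : ℕ → Multiset Trace} {b : Bool} (h : P.Run γ b) (i : ℕ) :
    (γ i).card ≤ P.cnt i := by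
  induction P generalizing γ b i with
  | nil | tick => simp [h.1]
  | out x P ih | inp x P ih =>
    rcases h with h | ⟨a, c, γ', h, -, rfl⟩
    · simp [h.1]
    · exact card_update_le (ih h (i + 1))
  | par P Q ihP ihQ =>
    obtain ⟨γ₁, γ₂, b₁, b₂, rfl, -, h1, h2⟩ := h
    simpa [Proc.cnt] using add_le_add (ihP h1 i) (ihQ h2 i)
  | nu P ih =>
    obtain ⟨α, -, h⟩ := h
    exact ih h (i + 1)
  | fwd x y =>
    obtain ⟨-, t, rfl⟩ := h
    simp only [Proc.cnt, Pi.add_apply, Multiset.card_add]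
    refine add_le_add ?_ ?_ <;> by_cases hx : i = ‹ℕ› <;> simp [Pi.single_apply]
    all_goals split_ifs <;> simp_all [card_sess_le]
  | closeBar x | noneBar x =>
    rcases h with ⟨-, rfl | rfl⟩
    · simp
    · simp only [Pi.single_apply, Proc.cnt]; split_ifs <;> simp
  | close x P ih =>
    rcases h with h | ⟨γ', h, -, rfl⟩
    · simp [h.1]
    · exact card_update_le (ih h i)
  | someBar x P ih =>
    rcases h with h | ⟨c, γ', h, -, rfl⟩
    · simp [h.1]
    · exact card_update_le (ih h i)
  | some x W P ih =>
    rcases h with (h | ⟨c, γ', h, -, rfl⟩) | ⟨-, hx, hn⟩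
    · simp [h.1]
    · refine (card_update_le (ih h i)).trans (max_le_max ?_ le_rfl)
      split_ifs <;> simp_all
    · by_cases hi : i = x
      · subst hi; simp [hx, Proc.cnt]
      · rcases hn i hi with h | h <;> simp [h, Proc.cnt]
  | choice P Q ihP ihQ =>
    rcases h with h | h
    · exact (ihP h i).trans (le_max_left _ _)
    · exact (ihQ h i).trans (le_max_right _ _)

theorem Proc.Run.eq_zero {P : Proc} {γ : ℕ → Multiset Trace} {b : Bool} (h : P.Run γ b) {i : ℕ}
    (hi : P.cnt i = 0) : γ i = 0 := by
  have := h.card_le i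
  rw [hi] at this
  simpa using this

-- Runs under injective renaming

theorem consUse_comp_liftN (α : Multiset Trace) (γ : ℕ → Multiset Trace) (f : ℕ → ℕ) :
    consUse α γ ∘ liftN 1 f = consUse α (γ ∘ f) := by
  funext i
  cases i <;> simp [liftN_one_zero, liftN_one_succ, consUse]

theorem single_comp {f : ℕ → ℕ} (hf : f.Injective) (x : ℕ) (α : Multiset Trace) :
    (Pi.single (f x) α : ℕ → Multiset Trace) ∘ f = Pi.single x α := by
  funext i
  simp only [Function.comp, Pi.single_apply, hf.eq_iff]

theorem Proc.Run.of_rename {f : ℕ → ℕ} (hf : f.Injective) {P : Proc} {γ : ℕ → Multiset Trace}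
    {b : Bool} (h : (P.rename f).Run γ b) : P.Run (γ ∘ f) b := by
  induction P generalizing f γ b with
  | nil | tick => exact ⟨by rw [h.1]; rfl, h.2⟩
  | out x P ih | inp x P ih =>
    rcases h with h | ⟨a, c, γ', h, hc, rfl⟩
    · exact Or.inl ⟨by rw [h.1]; rfl, h.2⟩
    · refine Or.inr ⟨a, c, γ' ∘ f, ?_, hc, Function.update_comp_eq_of_injective _ hf _ _⟩
      rw [← consUse_comp_liftN]
      exact ih (liftN_injective hf 1) h
  | par P Q ihP ihQ =>
    obtain ⟨γ₁, γ₂, b₁, b₂, rfl, hb, h1, h2⟩ := h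
    exact ⟨_, _, _, _, rfl, hb, ihP hf h1, ihQ hf h2⟩
  | nu P ih =>
    obtain ⟨α, hα, h⟩ := h
    refine ⟨α, hα, ?_⟩
    rw [← consUse_comp_liftN]
    exact ih (liftN_injective hf 1) h
  | fwd x y =>
    obtain ⟨hb, t, rfl⟩ := h
    refine ⟨hb, t, ?_⟩
    exact congrArg₂ (· + ·) (single_comp hf x _) (single_comp hf y _)
  | closeBar x | noneBar x =>
    refine ⟨h.1, h.2.imp ?_ ?_⟩
    · rintro rfl; rfl
    · rintro rfl; exact single_comp hf _ _
  | close x P ih =>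
    rcases h with h | ⟨γ', h, hc, rfl⟩
    · exact Or.inl ⟨by rw [h.1]; rfl, h.2⟩
    · exact Or.inr ⟨γ' ∘ f, ih hf h, hc, Function.update_comp_eq_of_injective _ hf _ _⟩
  | someBar x P ih =>
    rcases h with h | ⟨c, γ', h, hc, rfl⟩
    · exact Or.inl ⟨by rw [h.1]; rfl, h.2⟩
    · exact Or.inr ⟨c, γ' ∘ f, ih hf h, hc, Function.update_comp_eq_of_injective _ hf _ _⟩
  | some x W P ih =>
    rcases h with (h | ⟨c, γ', h, hc, rfl⟩) | ⟨hb, hx, hn⟩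
    · exact Or.inl (Or.inl ⟨by rw [h.1]; rfl, h.2⟩)
    · exact Or.inl (Or.inr ⟨c, γ' ∘ f, ih hf h, hc, Function.update_comp_eq_of_injective _ hf _ _⟩)
    · refine Or.inr ⟨hb, hx, fun n hnx => (hn (f n) (hf.ne hnx)).imp_right ?_⟩
      rintro ⟨h1, h2⟩
      exact ⟨(Finset.mem_image.1 h1).elim fun i hi => hf hi.2 ▸ hi.1, h2⟩
  | choice P Q ihP ihQ => exact h.imp (ihP hf) (ihQ hf)

theorem extend_update {f : ℕ → ℕ} (hf : f.Injective) (γ : ℕ → Multiset Trace) (x : ℕ)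
    (α : Multiset Trace) :
    Function.extend f (Function.update γ x α) 0 = Function.update (Function.extend f γ 0) (f x) α := by
  funext n
  by_cases h : ∃ i, f i = n
  · obtain ⟨i, rfl⟩ := h
    simp [hf.extend_apply, Function.update_apply, hf.eq_iff]
  · have : n ≠ f x := fun hn => h ⟨x, hn.symm⟩
    simp [Function.extend_apply' _ _ _ h, this]

theorem extend_zero (f : ℕ → ℕ) : Function.extend f (0 : ℕ → Multiset Trace) 0 = 0 := by
  funext n
  simp [Function.extend]

theorem extend_add {f : ℕ → ℕ} (hf : f.Injective) (γ δ : ℕ → Multiset Trace) :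
    Function.extend f (γ + δ) 0 = Function.extend f γ 0 + Function.extend f δ 0 := by
  funext n
  by_cases h : ∃ i, f i = n
  · obtain ⟨i, rfl⟩ := h
    simp [hf.extend_apply]
  · simp [Function.extend_apply' _ _ _ h]

theorem extend_single {f : ℕ → ℕ} (hf : f.Injective) (x : ℕ) (α : Multiset Trace) :
    Function.extend f (Pi.single x α : ℕ → Multiset Trace) 0 = Pi.single (f x) α := by
  rw [Pi.single, extend_update hf, extend_zero, Pi.single]

theorem extend_consUse {f : ℕ → ℕ} (hf : f.Injective) (α : Multiset Trace)
    (γ : ℕ → Multiset Trace) :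
    Function.extend (liftN 1 f) (consUse α γ) 0 = consUse α (Function.extend f γ 0) := by
  have hl := liftN_injective hf 1
  funext n
  cases n with
  | zero =>
    have := hl.extend_apply (consUse α γ) 0 0
    rwa [liftN_one_zero] at this
  | succ n =>
    by_cases h : ∃ i, f i = n
    · obtain ⟨i, rfl⟩ := h
      have := hl.extend_apply (consUse α γ) 0 (i + 1)
      rw [liftN_one_succ] at this
      rw [this]
      simp [consUse, hf.extend_apply]
    · rw [Function.extend_apply' _ _ _ fun ⟨i, hi⟩ => h
        (let ⟨j, _, hj⟩ := liftN_one_eq_succ hi; ⟨j, hj⟩)]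
      simp [consUse, Function.extend_apply' _ _ _ h]

theorem Proc.Run.rename {f : ℕ → ℕ} (hf : f.Injective) {P : Proc} {γ : ℕ → Multiset Trace}
    {b : Bool} (h : P.Run γ b) : (P.rename f).Run (Function.extend f γ 0) b := by
  induction P generalizing f γ b with
  | nil | tick => exact ⟨by rw [h.1, extend_zero], h.2⟩
  | out x P ih | inp x P ih =>
    rcases h with h | ⟨a, c, γ', h, hc, rfl⟩
    · exact Or.inl ⟨by rw [h.1, extend_zero], h.2⟩
    · refine Or.inr ⟨a, c, Function.extend f γ' 0, ?_, by rw [hf.extend_apply, hc],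
        extend_update hf _ _ _⟩
      rw [← extend_consUse hf]
      exact ih (liftN_injective hf 1) h
  | par P Q ihP ihQ =>
    obtain ⟨γ₁, γ₂, b₁, b₂, rfl, hb, h1, h2⟩ := h
    exact ⟨_, _, _, _, extend_add hf _ _, hb, ihP hf h1, ihQ hf h2⟩
  | nu P ih =>
    obtain ⟨α, hα, h⟩ := h
    refine ⟨α, hα, ?_⟩
    rw [← extend_consUse hf]
    exact ih (liftN_injective hf 1) h
  | fwd x y =>
    obtain ⟨hb, t, rfl⟩ := h
    exact ⟨hb, t, by rw [extend_add hf, extend_single hf, extend_single hf]⟩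
  | closeBar x | noneBar x =>
    refine ⟨h.1, h.2.imp ?_ ?_⟩
    · rintro rfl; exact extend_zero f
    · rintro rfl; exact extend_single hf _ _
  | close x P ih =>
    rcases h with h | ⟨γ', h, hc, rfl⟩
    · exact Or.inl ⟨by rw [h.1, extend_zero], h.2⟩
    · exact Or.inr ⟨_, ih hf h, by rw [hf.extend_apply, hc], extend_update hf _ _ _⟩
  | someBar x P ih =>
    rcases h with h | ⟨c, γ', h, hc, rfl⟩
    · exact Or.inl ⟨by rw [h.1, extend_zero], h.2⟩
    · exact Or.inr ⟨c, _, ih hf h, by rw [hf.extend_apply, hc], extend_update hf _ _ _⟩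
  | some x W P ih =>
    rcases h with (h | ⟨c, γ', h, hc, rfl⟩) | ⟨hb, hx, hn⟩
    · exact Or.inl (Or.inl ⟨by rw [h.1, extend_zero], h.2⟩)
    · exact Or.inl (Or.inr ⟨c, _, ih hf h, by rw [hf.extend_apply, hc], extend_update hf _ _ _⟩)
    · refine Or.inr ⟨hb, by rw [hf.extend_apply, hx], fun n hnx => ?_⟩
      by_cases h : ∃ i, f i = n
      · obtain ⟨i, rfl⟩ := h
        rw [hf.extend_apply]
        exact (hn i fun hi => hnx (hi ▸ rfl)).imp_right fun h =>
          ⟨Finset.mem_image_of_mem _ h.1, h.2⟩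
      · exact Or.inl (Function.extend_apply' _ _ _ h)
  | choice P Q ihP ihQ => exact h.imp (ihP hf) (ihQ hf)

theorem Proc.run_shift_iff {P : Proc} {γ : ℕ → Multiset Trace} {b : Bool} :
    P.shift.Run γ b ↔ γ 0 = 0 ∧ P.Run (fun i => γ (i + 1)) b := by
  have hs : Function.Injective fun i : ℕ => i + 1 := fun _ _ h => by simpa using h
  constructor
  · exact fun h => ⟨h.eq_zero P.cnt_shift_zero, h.of_rename hs⟩
  · rintro ⟨h0, h⟩
    have h' := h.rename hs
    rw [Proc.shift]
    convert h' using 1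
    funext n
    cases n with
    | zero => rw [Function.extend_apply' _ _ _ (by simp)]; exact h0
    | succ n => exact (hs.extend_apply (fun i => γ (i + 1)) 0 n).symm

theorem Proc.run_swap_iff {P : Proc} {γ : ℕ → Multiset Trace} {b : Bool} :
    (P.rename (blockSwap 1 1)).Run γ b ↔ P.Run (γ ∘ blockSwap 1 1) b := by
  have hi : Function.Injective (blockSwap 1 1) :=
    Function.LeftInverse.injective blockSwap_one_one_invol
  refine ⟨fun h => h.of_rename hi, fun h => ?_⟩
  have h' := h.rename hi
  convert h' using 1
  funext n
  have := hi.extend_apply (γ ∘ blockSwap 1 1) 0 (blockSwap 1 1 n)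
  simpa [blockSwap_one_one_invol] using this.symm

/-- In the trace semantics parallel composition is a sum, choice a disjunction and restriction an
existential quantifier over balanced contributions, so the laws become laws of these operations.
Scope extrusion holds because a process that does not know a name contributes nothing to it. -/
theorem Proc.Cong.run_iff {P Q : Proc} (h : P.Cong Q) :
    ∀ {γ : ℕ → Multiset Trace} {b : Bool}, P.Run γ b ↔ Q.Run γ b := by
  induction h with
  | refl => exact Iff.rfl
  | symm _ _ _ ih => exact ih.symm
  | trans _ _ _ _ _ ih1 ih2 => exact ih1.trans ih2
  | out _ _ _ _ ih | inp _ _ _ _ ih | nu _ _ _ ih | close _ _ _ _ ih | someBar _ _ _ _ ih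
  | some _ _ _ _ _ ih => intro γ b; simp only [Proc.Run, ih]
  | par _ _ _ _ _ _ ih1 ih2 | choice _ _ _ _ _ _ ih1 ih2 =>
    intro γ b; simp only [Proc.Run, ih1, ih2]
  | parNil P =>
    intro γ b
    constructor
    · rintro ⟨γ₁, γ₂, b₁, b₂, rfl, rfl, h1, rfl, rfl⟩
      simpa using h1
    · exact fun h => ⟨γ, 0, b, false, by simp, by simp, h, rfl, rfl⟩
  | parComm P Q =>
    intro γ b
    constructor <;>
    · rintro ⟨γ₁, γ₂, b₁, b₂, rfl, rfl, h1, h2⟩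
      exact ⟨γ₂, γ₁, b₂, b₁, add_comm _ _, Bool.or_comm _ _, h2, h1⟩
  | parAssoc P Q R =>
    intro γ b
    constructor
    · rintro ⟨_, γ₃, _, b₃, rfl, rfl, ⟨γ₁, γ₂, b₁, b₂, rfl, rfl, h1, h2⟩, h3⟩
      exact ⟨_, _, _, _, add_assoc _ _ _, Bool.or_assoc _ _ _, h1, _, _, _, _, rfl, rfl, h2, h3⟩
    · rintro ⟨γ₁, _, b₁, _, rfl, rfl, h1, γ₂, γ₃, b₂, b₃, rfl, rfl, h2, h3⟩
      exact ⟨_, _, _, _, (add_assoc _ _ _).symm, (Bool.or_assoc _ _ _).symm,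
        ⟨_, _, _, _, rfl, rfl, h1, h2⟩, h3⟩
  | fwdComm x y =>
    intro γ b
    simp only [Proc.Run]
    simp only [add_comm]
  | extrude P Q =>
    intro γ b
    simp only [Proc.Run, Proc.run_shift_iff]
    constructor
    · rintro ⟨γ₁, γ₂, b₁, b₂, rfl, rfl, ⟨α, hα, h1⟩, h2⟩
      exact ⟨α, hα, consUse α γ₁, consUse 0 γ₂, b₁, b₂, by rw [consUse_add, add_zero], rfl, h1,
        rfl, h2⟩
    · rintro ⟨α, hα, γ₁, γ₂, b₁, b₂, h, rfl, h1, h0, h2⟩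
      obtain ⟨h3, h4⟩ := consUse_eq_add h
      rw [h0, add_zero] at h3
      subst h3
      refine ⟨fun i => γ₁ (i + 1), fun i => γ₂ (i + 1), b₁, b₂, funext h4, rfl, ⟨_, hα, ?_⟩, h2⟩
      rwa [consUse_head_tail]
  | distrib P Q R =>
    intro γ b
    simp only [Proc.Run]
    constructor
    · rintro ⟨α, hα, γ₁, γ₂, b₁, b₂, h, hb, h1, h2 | h2⟩
      · exact Or.inl ⟨α, hα, γ₁, γ₂, b₁, b₂, h, hb, h1, h2⟩
      · exact Or.inr ⟨α, hα, γ₁, γ₂, b₁, b₂, h, hb, h1, h2⟩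
    · rintro (⟨α, hα, γ₁, γ₂, b₁, b₂, h, hb, h1, h2⟩ | ⟨α, hα, γ₁, γ₂, b₁, b₂, h, hb, h1, h2⟩)
      · exact ⟨α, hα, γ₁, γ₂, b₁, b₂, h, hb, h1, Or.inl h2⟩
      · exact ⟨α, hα, γ₁, γ₂, b₁, b₂, h, hb, h1, Or.inr h2⟩
  | choiceNil => intro γ b; exact or_self_iff
  | choiceComm P Q => intro γ b; exact or_comm
  | choiceAssoc P Q R => intro γ b; exact or_assoc
  | nuNil =>
    intro γ b
    simp only [Proc.Run]
    constructor
    · rintro ⟨α, -, h, rfl⟩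
      exact ⟨funext fun i => congrFun h (i + 1), rfl⟩
    · rintro ⟨rfl, rfl⟩
      exact ⟨0, balanced_zero, consUse_zero_zero, rfl⟩
  | nuNu P =>
    intro γ b
    have key : ∀ α β, consUse α (consUse β γ) ∘ blockSwap 1 1 = consUse β (consUse α γ) := by
      intro α β
      funext i
      match i with
      | 0 => rfl
      | 1 => rfl
      | i + 2 => simp [blockSwap, consUse]
    simp only [Proc.Run, Proc.run_swap_iff, key]
    constructor <;> exact fun ⟨α, hα, β, hβ, h⟩ => ⟨β, hβ, α, hα, h⟩

-- Runs under the identification of two names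

/-- `f` identifies `p` and `q`, and no other names. -/
structure Merges (f : ℕ → ℕ) (p q : ℕ) : Prop where
  ne : p ≠ q
  eq : f p = f q
  inj : ∀ i j, f i = f j → i = j ∨ (i = p ∧ j = q) ∨ (i = q ∧ j = p)

theorem Merges.lift {f : ℕ → ℕ} {p q : ℕ} (h : Merges f p q) :
    Merges (liftN 1 f) (p + 1) (q + 1) where
  ne := by simpa using h.ne
  eq := by simp [liftN_one_succ, h.eq]
  inj i j hij := by
    cases i with
    | zero =>
      rw [liftN_one_zero] at hij
      exact Or.inl (liftN_one_eq_zero hij.symm).symm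
    | succ i =>
      rw [liftN_one_succ] at hij
      obtain ⟨j, rfl, hj⟩ := liftN_one_eq_succ hij.symm
      simpa using h.inj i j hj.symm

theorem Merges.ne_of_ne {f : ℕ → ℕ} {p q i : ℕ} (h : Merges f p q) (hp : i ≠ p) (hq : i ≠ q) :
    f i ≠ f p := fun he => by
  rcases h.inj i p he with h | h | h
  · exact hp h
  · exact hp h.1
  · exact hq h.1

theorem Merges.cnt_rename_le {f : ℕ → ℕ} {p q : ℕ} (h : Merges f p q) (P : Proc) :
    (P.rename f).cnt (f p) ≤ P.cnt p + P.cnt q := by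
  rw [← Finset.sum_pair h.ne]
  refine P.cnt_rename_le fun i hi => Or.inl ?_
  by_cases hp : i = p
  · simp [hp]
  by_cases hq : i = q
  · simp [hq]
  exact absurd hi (h.ne_of_ne hp hq)

/-- `γ` is a preimage of `γ'` under the identification of `p` and `q`. -/
structure Splits (f : ℕ → ℕ) (p q : ℕ) (γ' γ : ℕ → Multiset Trace) : Prop where
  other : ∀ i, i ≠ p → i ≠ q → γ' (f i) = γ i
  merged : γ' (f p) = γ p + γ q

theorem Splits.zero (f : ℕ → ℕ) (p q : ℕ) : Splits f p q 0 0 := ⟨fun _ _ _ => rfl, rfl⟩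

theorem Splits.add {f : ℕ → ℕ} {p q : ℕ} {γ₁' γ₁ γ₂' γ₂ : ℕ → Multiset Trace}
    (h1 : Splits f p q γ₁' γ₁) (h2 : Splits f p q γ₂' γ₂) : Splits f p q (γ₁' + γ₂') (γ₁ + γ₂) :=
  ⟨fun i hp hq => by simp [h1.other i hp hq, h2.other i hp hq],
    by simp only [Pi.add_apply, h1.merged, h2.merged]; abel⟩

theorem Splits.single {f : ℕ → ℕ} {p q : ℕ} (hf : Merges f p q) (x : ℕ) (α : Multiset Trace) :
    Splits f p q (Pi.single (f x) α) (Pi.single x α) where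
  other i hp hq := by
    simp only [Pi.single_apply]
    refine if_congr ⟨fun h => ?_, fun h => h ▸ rfl⟩ rfl rfl
    rcases hf.inj i x h with h | h | h
    · exact h
    · exact absurd h.1 hp
    · exact absurd h.1 hq
  merged := by
    simp only [Pi.single_apply]
    by_cases hp : p = x
    · subst hp; simp [hf.ne.symm]
    by_cases hq : q = x
    · subst hq; simp [hf.ne, hf.eq]
    have := (hf.ne_of_ne (Ne.symm hp) (Ne.symm hq)).symm
    simp [hp, hq, this]

theorem Splits.consUse {f : ℕ → ℕ} {p q : ℕ} {α : Multiset Trace} {γ' γ : ℕ → Multiset Trace}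
    (h : Splits (liftN 1 f) (p + 1) (q + 1) (consUse α γ') γ) :
    γ = SharingPi.consUse α (fun i => γ (i + 1)) ∧ Splits f p q γ' fun i => γ (i + 1) := by
  have h0 := h.other 0 (by simp) (by simp)
  rw [liftN_one_zero] at h0
  refine ⟨?_, fun i hp hq => ?_, ?_⟩
  · conv_lhs => rw [← consUse_head_tail γ]
    rw [← h0]; rfl
  · have := h.other (i + 1) (by simpa using hp) (by simpa using hq)
    rwa [liftN_one_succ] at this
  · have := h.merged
    rwa [liftN_one_succ] at this

/-- Adding an interaction to the session at the subject `x` of a prefix. -/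
theorem Splits.update {f : ℕ → ℕ} {p q : ℕ} (hf : Merges f p q) {x : ℕ} {t : Trace}
    {γ' γ : ℕ → Multiset Trace} (h : Splits f p q γ' γ)
    (hbal : (x ≠ p ∧ x ≠ q) ∨ (x = p ∧ γ q = 0) ∨ (x = q ∧ γ p = 0)) :
    γ' (f x) = γ x ∧ Splits f p q (Function.update γ' (f x) {t}) (Function.update γ x {t}) := by
  rcases hbal with ⟨hp, hq⟩ | ⟨rfl, h0⟩ | ⟨rfl, h0⟩
  · refine ⟨h.other x hp hq, fun i hip hiq => ?_, ?_⟩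
    · by_cases hx : i = x
      · subst hx; simp
      · have : f i ≠ f x := fun he => by
          rcases hf.inj i x he with h | h | h
          · exact hx h
          · exact hip h.1
          · exact hiq h.1
        simp [hx, this, h.other i hip hiq]
    · simp [(hf.ne_of_ne hp hq).symm, hp.symm, hq.symm, h.merged]
  · refine ⟨by rw [h.merged, h0, add_zero], fun i hip hiq => ?_, ?_⟩
    · simp [hf.ne_of_ne hip hiq, hip, h.other i hip hiq]
    · simp [hf.ne.symm, h0]
  · refine ⟨by rw [← hf.eq, h.merged, h0, zero_add], fun i hip hiq => ?_, ?_⟩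
    · rw [← hf.eq]
      simp [hf.ne_of_ne hip hiq, hiq, h.other i hip hiq]
    · rw [← hf.eq]
      simp [hf.ne, h0]

/-- A prefix whose subject is one of two identified names does not hold the other one. -/
theorem Merges.subject_cases {f : ℕ → ℕ} {p q x : ℕ} (hf : Merges f p q) {t : Trace}
    {γ' : ℕ → Multiset Trace} {cp cq : ℕ}
    (hbal : max (if p = x then 1 else 0) cp = 0 ∨ max (if q = x then 1 else 0) cq = 0 ∨
      Balanced (Function.update γ' (f x) {t} (f p))) :
    (x ≠ p ∧ x ≠ q ∧ (cp = 0 ∨ cq = 0 ∨ Balanced (γ' (f p)))) ∨ (x = p ∧ cq = 0) ∨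
      (x = q ∧ cp = 0) := by
  by_cases hp : x = p
  · subst hp
    refine Or.inr (Or.inl ⟨rfl, ?_⟩)
    rcases hbal with h | h | h
    · simp at h
    · omega
    · exact absurd (by simpa using h) (not_balanced_singleton t)
  by_cases hq : x = q
  · subst hq
    refine Or.inr (Or.inr ⟨rfl, ?_⟩)
    rcases hbal with h | h | h
    · omega
    · simp at h
    · rw [hf.eq] at h
      exact absurd (by simpa using h) (not_balanced_singleton t)
  · refine Or.inl ⟨hp, hq, ?_⟩
    rw [Function.update_of_ne (hf.ne_of_ne hp hq).symm] at hbal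
    exact hbal.imp (fun h => by omega) (Or.imp_left fun h => by omega)

/-- A run of a process whose names `p` and `q` have been identified comes from a run of the
process, unless a single user holds both of them. -/
theorem Proc.Run.of_rename_merge {f : ℕ → ℕ} {p q : ℕ} {P : Proc} {γ' : ℕ → Multiset Trace}
    {b : Bool} (hf : Merges f p q) (hp : P.cnt p ≤ 1) (hq : P.cnt q ≤ 1)
    (hbal : P.cnt p = 0 ∨ P.cnt q = 0 ∨ Balanced (γ' (f p)))
    (h : (P.rename f).Run γ' b) : ∃ γ, P.Run γ b ∧ Splits f p q γ' γ := by
  induction P generalizing f p q γ' b with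
  | nil | tick => exact ⟨0, ⟨rfl, h.2⟩, by rw [h.1]; exact Splits.zero f p q⟩
  | out x P ih | inp x P ih =>
    simp only [Proc.cnt] at hp hq
    rcases h with h | ⟨a, c, γ', h, hc, rfl⟩
    · exact ⟨0, Or.inl ⟨rfl, h.2⟩, by rw [h.1]; exact Splits.zero f p q⟩
    · have hcase := hf.subject_cases hbal
      obtain ⟨γ, h1, h2⟩ := ih hf.lift (by omega) (by omega) (by
        rw [liftN_one_succ]
        rcases hcase with h | h | h
        · exact h.2.2
        · exact Or.inr (Or.inl h.2)
        · exact Or.inl h.2) h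
      obtain ⟨h3, h4⟩ := h2.consUse
      obtain ⟨h5, h6⟩ := h4.update hf (x := x) (t := .comm a c) (hcase.imp (fun h => ⟨h.1, h.2.1⟩)
        (Or.imp (fun h => ⟨h.1, h1.eq_zero h.2⟩) fun h => ⟨h.1, h1.eq_zero h.2⟩))
      exact ⟨_, Or.inr ⟨a, c, _, h3 ▸ h1, by rw [← h5, hc], rfl⟩, h6⟩
  | par P Q ihP ihQ =>
    simp only [Proc.cnt] at hp hq hbal
    obtain ⟨γ₁', γ₂', b₁, b₂, rfl, hb, h1, h2⟩ := h
    have c1 := h1.card_le (f p)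
    have c2 := h2.card_le (f p)
    have c3 := hf.cnt_rename_le P
    have c4 := hf.cnt_rename_le Q
    obtain ⟨γ₁, h3, h4⟩ := ihP hf (by omega) (by omega) (by
      by_cases h : P.cnt p = 0 ∨ P.cnt q = 0
      · tauto
      -- Here `P` holds both `p` and `q`, so by linearity `Q` holds neither and contributes nothing
      -- to the merged name; the balance is then a property of `P` alone.
      · have : γ₂' (f p) = 0 := Multiset.card_eq_zero.1 (by omega)
        rcases hbal with h | h | h
        · omega
        · omega
        · rw [Pi.add_apply, this, add_zero] at h
          tauto) h1
    obtain ⟨γ₂, h5, h6⟩ := ihQ hf (by omega) (by omega) (by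
      by_cases h : Q.cnt p = 0 ∨ Q.cnt q = 0
      · tauto
      · have : γ₁' (f p) = 0 := Multiset.card_eq_zero.1 (by omega)
        rcases hbal with h | h | h
        · omega
        · omega
        · rw [Pi.add_apply, this, zero_add] at h
          tauto) h2
    exact ⟨_, ⟨_, _, _, _, rfl, hb, h3, h5⟩, h4.add h6⟩
  | nu P ih =>
    obtain ⟨α, hα, h⟩ := h
    obtain ⟨γ, h1, h2⟩ := ih hf.lift hp hq (by rw [liftN_one_succ]; exact hbal) h
    obtain ⟨h3, h4⟩ := h2.consUse
    exact ⟨_, ⟨α, hα, h3 ▸ h1⟩, h4⟩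
  | fwd x y =>
    obtain ⟨hb, t, rfl⟩ := h
    exact ⟨_, ⟨hb, t, rfl⟩, (Splits.single hf x _).add (Splits.single hf y _)⟩
  | closeBar x | noneBar x =>
    obtain ⟨hb, rfl | rfl⟩ := h
    · exact ⟨0, ⟨hb, Or.inl rfl⟩, Splits.zero f p q⟩
    · exact ⟨_, ⟨hb, Or.inr rfl⟩, Splits.single hf x _⟩
  | close x P ih =>
    simp only [Proc.cnt] at hp hq
    rcases h with h | ⟨γ', h, hc, rfl⟩
    · exact ⟨0, Or.inl ⟨rfl, h.2⟩, by rw [h.1]; exact Splits.zero f p q⟩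
    · have hcase := hf.subject_cases hbal
      obtain ⟨γ, h1, h2⟩ := ih hf (by omega) (by omega) (by
        rcases hcase with h | h | h
        · exact h.2.2
        · exact Or.inr (Or.inl h.2)
        · exact Or.inl h.2) h
      obtain ⟨h5, h6⟩ := h2.update hf (x := x) (t := .close) (hcase.imp (fun h => ⟨h.1, h.2.1⟩)
        (Or.imp (fun h => ⟨h.1, h1.eq_zero h.2⟩) fun h => ⟨h.1, h1.eq_zero h.2⟩))
      exact ⟨_, Or.inr ⟨_, h1, by rw [← h5, hc], rfl⟩, h6⟩
  | someBar x P ih =>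
    simp only [Proc.cnt] at hp hq
    rcases h with h | ⟨c, γ', h, hc, rfl⟩
    · exact ⟨0, Or.inl ⟨rfl, h.2⟩, by rw [h.1]; exact Splits.zero f p q⟩
    · have hcase := hf.subject_cases hbal
      obtain ⟨γ, h1, h2⟩ := ih hf (by omega) (by omega) (by
        rcases hcase with h | h | h
        · exact h.2.2
        · exact Or.inr (Or.inl h.2)
        · exact Or.inl h.2) h
      obtain ⟨h5, h6⟩ := h2.update hf (x := x) (t := .some c) (hcase.imp (fun h => ⟨h.1, h.2.1⟩)
        (Or.imp (fun h => ⟨h.1, h1.eq_zero h.2⟩) fun h => ⟨h.1, h1.eq_zero h.2⟩))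
      exact ⟨_, Or.inr ⟨c, _, h1, by rw [← h5, hc], rfl⟩, h6⟩
  | some x W P ih =>
    simp only [Proc.cnt] at hp hq hbal
    rcases h with (h | ⟨c, γ', h, hc, rfl⟩) | ⟨hb, hx, hn⟩
    · exact ⟨0, Or.inl (Or.inl ⟨rfl, h.2⟩), by rw [h.1]; exact Splits.zero f p q⟩
    · have hcase := hf.subject_cases (cp := P.cnt p) (cq := P.cnt q) (hbal.imp
        (fun h => by split_ifs at h ⊢ <;> simp_all)
        (Or.imp_left (fun h => by split_ifs at h ⊢ <;> simp_all)))
      obtain ⟨γ, h1, h2⟩ := ih hf (by omega) (by omega) (by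
        rcases hcase with h | h | h
        · exact h.2.2
        · exact Or.inr (Or.inl h.2)
        · exact Or.inl h.2) h
      obtain ⟨h5, h6⟩ := h2.update hf (x := x) (t := .some c) (hcase.imp (fun h => ⟨h.1, h.2.1⟩)
        (Or.imp (fun h => ⟨h.1, h1.eq_zero h.2⟩) fun h => ⟨h.1, h1.eq_zero h.2⟩))
      exact ⟨_, Or.inl (Or.inr ⟨c, _, h1, by rw [← h5, hc], rfl⟩), h6⟩
    -- The contribution at the merged name has to be attributed to one of `p` and `q`: to the
    -- subject if it is one of them, otherwise to `p` if `p ∈ W`, and to `q` if not.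
    · obtain ⟨γ, hγ⟩ : ∃ γ : ℕ → Multiset Trace, γ = fun i =>
          if i = x then {Trace.none} else if f i = f x then 0 else
          if i = q ∧ p ∈ W then 0 else if i = p ∧ p ∉ W then 0 else γ' (f i) := ⟨_, rfl⟩
      refine ⟨γ, Or.inr ⟨hb, by simp [hγ], fun n hnx => ?_⟩, fun i hip hiq => ?_, ?_⟩
      · simp only [hγ, if_neg hnx]
        split_ifs with h1 h2 h3
        · exact Or.inl rfl
        · exact Or.inl rfl
        · exact Or.inl rfl
        · refine (hn (f n) h1).imp_right fun ⟨h4, h5⟩ => ⟨?_, h5⟩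
          obtain ⟨m, hm, hmn⟩ := Finset.mem_image.1 h4
          rcases hf.inj m n hmn with h | h | h
          · exact h ▸ hm
          · exact absurd ⟨h.2, h.1 ▸ hm⟩ h2
          · by_contra h6
            exact h3 ⟨h.2, h.2 ▸ h6⟩
      · simp only [hγ]
        split_ifs with h1 h2 h3 h4
        · rw [h1, hx]
        · rcases hf.inj i x h2 with h | h | h
          · exact absurd h h1
          · exact absurd h.1 hip
          · exact absurd h.1 hiq
        · exact absurd h3.1 hiq
        · exact absurd h4.1 hip
        · rfl
      · simp only [hγ, hf.eq, true_and]
        by_cases h1 : p = x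
        · subst h1
          simp [hf.ne.symm, hx, ← hf.eq]
        by_cases h2 : q = x
        · subst h2
          simp [h1, hx]
        have h3 : f q ≠ f x := hf.eq ▸ (hf.ne_of_ne (Ne.symm h1) (Ne.symm h2)).symm
        by_cases h4 : p ∈ W <;> simp [h1, h2, h3, h4, hf.ne, hf.ne.symm]
  | choice P Q ihP ihQ =>
    simp only [Proc.cnt] at hp hq hbal
    rcases h with h | h
    · obtain ⟨γ, h1, h2⟩ := ihP hf (by omega) (by omega)
        (hbal.imp (fun h => by omega) (Or.imp_left fun h => by omega)) h
      exact ⟨γ, Or.inl h1, h2⟩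
    · obtain ⟨γ, h1, h2⟩ := ihQ hf (by omega) (by omega)
        (hbal.imp (fun h => by omega) (Or.imp_left fun h => by omega)) h
      exact ⟨γ, Or.inr h1, h2⟩

end SharingPi


namespace SharingPi

/-! ### Runs along reduction -/

theorem Proc.Run.noneList {l : List ℕ} (hl : l.Nodup) {γ : ℕ → Multiset Trace} {b : Bool}
    (h : (Proc.noneList l).Run γ b) :
    b = false ∧ ∀ n, γ n = 0 ∨ (n ∈ l ∧ γ n = {Trace.none}) := by
  induction l generalizing γ b with
  | nil => exact ⟨h.2, fun n => Or.inl (by rw [h.1]; rfl)⟩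
  | cons x l ih =>
    obtain ⟨γ₁, γ₂, b₁, b₂, rfl, rfl, ⟨rfl, h1⟩, h2⟩ := h
    obtain ⟨rfl, h3⟩ := ih (List.nodup_cons.1 hl).2 h2
    refine ⟨rfl, fun n => ?_⟩
    rcases h1 with rfl | rfl
    · simpa using (h3 n).imp_right fun h => ⟨Or.inr h.1, h.2⟩
    · by_cases hx : n = x
      · subst hx
        have : γ₂ n = 0 := (h3 n).resolve_right fun h => (List.nodup_cons.1 hl).1 h.1
        simp [this]
      · simpa [hx] using h3 n

theorem Proc.Run.noneAll {W : Finset ℕ} {γ : ℕ → Multiset Trace} {b : Bool}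
    (h : (Proc.noneAll W).Run γ b) :
    b = false ∧ ∀ n, γ n = 0 ∨ (n ∈ W ∧ γ n = {Trace.none}) := by
  simpa using Proc.Run.noneList (Finset.sort_nodup _ _) h

theorem merges_inst (y : ℕ) : Merges (fun i => if i = 0 then y else i - 1) 0 (y + 1) where
  ne := by simp
  eq := by simp
  inj i j h := by
    by_cases hi : i = 0 <;> by_cases hj : j = 0 <;> simp [hi, hj] at h ⊢ <;> omega

theorem update_pair (γ₁ γ₂ : ℕ → Multiset Trace) (x : ℕ) (α β : Multiset Trace) :
    Function.update γ₁ x α + Function.update γ₂ x β = Function.update (γ₁ + γ₂) x (α + β) := by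
  funext i
  by_cases h : i = x
  · subst h; simp
  · simp [h]

/-- Runs are reflected by reduction; only the sessions at names held by two components of the
redex change. -/
theorem Proc.Red.run_of_run {P P' : Proc} (h : P.Red P') :
    P.Lin → (∀ i, P.cnt i ≤ 2) → ∀ {γ' : ℕ → Multiset Trace} {b : Bool},
      (∀ i, P.cnt i = 2 → Balanced (γ' i)) → P'.Run γ' b →
      ∃ γ, P.Run γ b ∧ (∀ i, P.cnt i ≤ 1 → γ i = γ' i) ∧ ∀ i, P.cnt i = 2 → Balanced (γ i) := by
  -- Both partners of a redex at `x` gain the same interaction `t`. The new contribution `{t, t}` is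
  -- balanced, and nothing changes at names held by a single component.
  have upd : ∀ {P : Proc} {γ' : ℕ → Multiset Trace} {x : ℕ} {t : Trace}, P.cnt x = 2 →
      (∀ i, P.cnt i = 2 → Balanced (γ' i)) →
      (∀ i, P.cnt i ≤ 1 → Function.update γ' x {t, t} i = γ' i) ∧
        ∀ i, P.cnt i = 2 → Balanced (Function.update γ' x {t, t} i) := by
    intro P γ' x t hx hbal
    refine ⟨fun i hi => Function.update_of_ne (fun h => by subst h; omega) _ _, fun i hi => ?_⟩
    by_cases h : i = x
    · subst h
      rw [Function.update_self]
      exact ⟨.some t, rfl⟩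
    · rw [Function.update_of_ne h]
      exact hbal i hi
  induction h with
  | comm x P Q =>
    intro hlin hcnt γ' b hbal hrun
    obtain ⟨α, hα, γ₁, γ₂, b₁, b₂, hγ, rfl, h1, h2⟩ := hrun
    obtain ⟨h0, hγ⟩ := consUse_eq_add hγ
    simp only [Proc.Lin] at hlin
    have c := hcnt x
    simp only [Proc.cnt, if_true] at c
    -- The passed name is balanced by the restriction in the reduct and held at most once by each
    -- side, so both sides show the same session on it. The same argument at `x` matches the two
    -- continuations.
    have h3 : γ₁ 0 = γ₂ 0 := Balanced.eq_of_card_le (h0 ▸ hα) ((h1.card_le 0).trans hlin.1.1)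
      ((h2.card_le 0).trans hlin.2.1)
    have hx : P.cnt (x + 1) ≤ 1 ∧ Q.cnt (x + 1) ≤ 1 := by omega
    have cx : (Proc.par (.out x Q) (.inp x P)).cnt x = 2 := by
      simp only [Proc.cnt, if_true]; omega
    have h4 : γ₁ (x + 1) = γ₂ (x + 1) := Balanced.eq_of_card_le (hγ x ▸ hbal x cx)
      ((h1.card_le _).trans hx.2) ((h2.card_le _).trans hx.1)
    obtain ⟨a, ha⟩ := exists_sess_of_card_le ((h1.card_le 0).trans hlin.1.1)
    obtain ⟨c, hc⟩ := exists_sess_of_card_le ((h1.card_le (x + 1)).trans hx.2)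
    refine ⟨Function.update γ' x {.comm a c, .comm a c},
      ⟨Function.update (fun i => γ₁ (i + 1)) x {.comm a c},
        Function.update (fun i => γ₂ (i + 1)) x {.comm a c}, b₁, b₂, ?_, rfl,
        Or.inr ⟨a, c, _, ?_, hc, rfl⟩, Or.inr ⟨a, c, _, ?_, h4 ▸ hc, rfl⟩⟩, upd cx hbal⟩
    · rw [update_pair, funext hγ]; rfl
    · rw [← ha, consUse_head_tail]; exact h1
    · rw [← ha, h3, consUse_head_tail]; exact h2
  | forw y P =>
    intro hlin hcnt γ' b hbal hrun
    simp only [Proc.Lin, Proc.cnt] at hlin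
    have hy := hcnt y
    have h0 : P.cnt 0 ≤ 1 := by have := hlin.1; simp at this; omega
    simp only [Proc.cnt] at hy
    simp at hy
    obtain ⟨γ, h1, h2⟩ := Proc.Run.of_rename_merge (merges_inst y) h0 (by omega) (by
      by_cases h : P.cnt (y + 1) = 0
      · exact Or.inr (Or.inl h)
      · refine Or.inr (Or.inr (hbal y ?_))
        simp only [Proc.cnt]
        simp; omega) hrun
    obtain ⟨t, ht⟩ := exists_sess_of_card_le ((h1.card_le 0).trans h0)
    have h3 := h2.merged
    simp only [if_true] at h3
    have h4 : ∀ i, i ≠ y → γ' i = γ (i + 1) := fun i hi => by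
      have := h2.other (i + 1) (by simp) (by simpa using hi)
      simpa using this
    -- `sess t` is what `P` contributed to `y` through the substituted name. The forwarder shows `t`
    -- at both of its ends: it balances `P` at the restricted name and stands in for `P` at `y`, so
    -- the total at `y` stays the same.
    refine ⟨γ', ⟨sess t + sess t, ⟨t, rfl⟩, Pi.single 0 (sess t) + Pi.single (y + 1) (sess t), γ,
      false, b, ?_, by simp, ⟨rfl, t, rfl⟩, h1⟩, fun _ _ => rfl, hbal⟩
    funext i
    cases i with
    | zero => simp [consUse, ht]
    | succ i =>
      by_cases hi : i = y
      · subst hi; simp [consUse, h3, ht]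
      · simp [consUse, h4 i hi, hi]
  | close x P =>
    intro hlin hcnt γ' b hbal hrun
    have c := hcnt x
    simp only [Proc.cnt, if_true] at c
    have cx : (Proc.par (.closeBar x) (.close x P)).cnt x = 2 := by
      simp only [Proc.cnt, if_true]; omega
    have hx : γ' x = 0 := (hbal x cx).eq_zero_of_card_le ((hrun.card_le x).trans (by omega))
    refine ⟨Function.update γ' x {.close, .close}, ⟨Pi.single x {.close}, Function.update γ' x {.close},
      false, b, ?_, by simp, ⟨rfl, Or.inr rfl⟩, Or.inr ⟨γ', hrun, hx, rfl⟩⟩, upd cx hbal⟩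
    rw [Pi.single, update_pair, zero_add]; rfl
  | some x W P Q =>
    intro hlin hcnt γ' b hbal hrun
    obtain ⟨γ₁, γ₂, b₁, b₂, rfl, rfl, h1, h2⟩ := hrun
    have c := hcnt x
    simp only [Proc.cnt, if_true, true_or] at c
    have cx : (Proc.par (.someBar x P) (.some x W Q)).cnt x = 2 := by
      simp only [Proc.cnt, if_true, true_or]; omega
    have hx : P.cnt x ≤ 1 ∧ Q.cnt x ≤ 1 := by omega
    have h4 : γ₁ x = γ₂ x := Balanced.eq_of_card_le (hbal x cx)
      ((h1.card_le _).trans hx.1) ((h2.card_le _).trans hx.2)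
    obtain ⟨c, hc⟩ := exists_sess_of_card_le ((h1.card_le x).trans hx.1)
    refine ⟨Function.update (γ₁ + γ₂) x {.some c, .some c}, ⟨Function.update γ₁ x {.some c},
      Function.update γ₂ x {.some c}, b₁, b₂, ?_, rfl, Or.inr ⟨c, γ₁, h1, hc, rfl⟩,
      Or.inl (Or.inr ⟨c, γ₂, h2, h4 ▸ hc, rfl⟩)⟩, upd cx hbal⟩
    rw [update_pair]; rfl
  | none x W Q =>
    intro hlin hcnt γ' b hbal hrun
    obtain ⟨rfl, hn⟩ := hrun.noneAll
    have c := hcnt x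
    simp only [Proc.cnt, if_true, true_or] at c
    have cx : (Proc.par (.noneBar x) (.some x W Q)).cnt x = 2 := by
      simp only [Proc.cnt, if_true, true_or]; omega
    have hx : γ' x = 0 := (hbal x cx).eq_zero_of_card_le (by
      rcases hn x with h | h
      · simp [h]
      · simp [h.2])
    refine ⟨Function.update γ' x {.none, .none}, ⟨Pi.single x {.none}, Function.update γ' x {.none},
      false, false, ?_, rfl, ⟨rfl, Or.inr rfl⟩, Or.inr ⟨rfl, by simp, fun n hnx => ?_⟩⟩, upd cx hbal⟩
    · rw [Pi.single, update_pair, zero_add]; rfl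
    · rw [Function.update_of_ne hnx]; exact hn n
  | cong P P' Q' Q h1 _ h2 ih =>
    intro hlin hcnt γ' b hbal hrun
    simp only [h1.cnt_eq] at hcnt hbal ⊢
    obtain ⟨γ, h3, h4⟩ := ih (h1.lin_iff.1 hlin) hcnt hbal (h2.run_iff.2 hrun)
    exact ⟨γ, h1.run_iff.2 h3, h4⟩
  | par P Q Q' _ ih =>
    intro hlin hcnt γ' b hbal hrun
    obtain ⟨γ₁, γ₂, b₁, b₂, rfl, rfl, h1, h2⟩ := hrun
    simp only [Proc.cnt] at hcnt hbal ⊢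
    obtain ⟨γ, h3, h4, h5⟩ := ih hlin.2 (fun i => by have := hcnt i; omega) (γ' := γ₂) (fun i hi => by
      have := hcnt i
      have h0 : γ₁ i = 0 := h1.eq_zero (by omega)
      simpa [h0] using hbal i (by omega)) h2
    refine ⟨γ₁ + γ, ⟨γ₁, γ, b₁, b₂, rfl, rfl, h1, h3⟩, fun i hi => ?_, fun i hi => ?_⟩
    · rw [Pi.add_apply, h4 i (by omega)]; rfl
    · by_cases hQ : Q.cnt i = 2
      · have h0 : γ₁ i = 0 := h1.eq_zero (by omega)
        simpa [h0] using h5 i hQ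
      · rw [Pi.add_apply, h4 i (by omega)]
        exact hbal i hi
  | nu P Q _ ih =>
    intro hlin hcnt γ' b hbal hrun
    obtain ⟨α, hα, h⟩ := hrun
    obtain ⟨γ, h3, h4, h5⟩ := ih hlin.2 (fun i => by
      cases i with
      | zero => exact hlin.1
      | succ i => exact hcnt i) (fun i hi => by
      cases i with
      | zero => exact hα
      | succ i => exact hbal i hi) h
    refine ⟨fun i => γ (i + 1), ⟨γ 0, ?_, by rwa [consUse_head_tail]⟩, fun i hi => h4 (i + 1) hi,
      fun i hi => h5 (i + 1) hi⟩
    by_cases h0 : P.cnt 0 = 2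
    · exact h5 0 h0
    · rw [h4 0 (by have := hlin.1; omega)]; exact hα
  | choice P Q Q' _ ih =>
    intro hlin hcnt γ' b hbal hrun
    simp only [Proc.cnt] at hcnt hbal ⊢
    rcases hrun with h | h
    · exact ⟨γ', Or.inl h, fun _ _ => rfl, hbal⟩
    · obtain ⟨γ, h3, h4, h5⟩ := ih hlin.2 (fun i => by have := hcnt i; omega)
        (fun i hi => hbal i (by have := hcnt i; omega)) h
      refine ⟨γ, Or.inr h3, fun i hi => h4 i (by omega), fun i hi => ?_⟩
      by_cases hQ : Q.cnt i = 2
      · exact h5 i hQ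
      · rw [h4 i (by have := hcnt i; omega)]
        exact hbal i hi

theorem Proc.exists_run_zero (P : Proc) : ∃ b, P.Run 0 b := by
  induction P with
  | nil => exact ⟨_, rfl, rfl⟩
  | tick => exact ⟨_, rfl, rfl⟩
  | out x P | inp x P | close x P | someBar x P => exact ⟨_, Or.inl ⟨rfl, rfl⟩⟩
  | some x W P => exact ⟨_, Or.inl (Or.inl ⟨rfl, rfl⟩)⟩
  | par P Q ihP ihQ =>
    obtain ⟨b, h1⟩ := ihP
    obtain ⟨c, h2⟩ := ihQ
    exact ⟨_, 0, 0, b, c, by simp, rfl, h1, h2⟩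
  | nu P ih =>
    obtain ⟨b, h⟩ := ih
    exact ⟨b, 0, balanced_zero, by rwa [consUse_zero_zero]⟩
  | fwd x y => exact ⟨_, rfl, Option.none, by simp [sess_none]⟩
  | closeBar x | noneBar x => exact ⟨_, rfl, Or.inl rfl⟩
  | choice P Q ihP ihQ =>
    obtain ⟨b, h⟩ := ihP
    exact ⟨b, Or.inl h⟩

theorem Proc.Unguarded.run {P : Proc} (h : P.Unguarded) : P.Run 0 true := by
  induction P with
  | tick => exact ⟨rfl, rfl⟩
  | par P Q ihP ihQ =>
    rcases h with h | h
    · obtain ⟨b, h2⟩ := Q.exists_run_zero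
      exact ⟨0, 0, true, b, by simp, by simp, ihP h, h2⟩
    · obtain ⟨b, h2⟩ := P.exists_run_zero
      exact ⟨0, 0, b, true, by simp, by simp, h2, ihQ h⟩
  | nu P ih => exact ⟨0, balanced_zero, by rw [consUse_zero_zero]; exact ih h⟩
  | choice P Q ihP ihQ => exact h.imp ihP ihQ
  | _ => exact h.elim

/-- When every free name has at most one user, lifting a run changes nothing at the free names. The
empty contribution of the final process, where ✓ is unguarded, is thus carried back through the
whole reduction sequence. -/
theorem Proc.Success.run {P : Proc} (h : P.Success) (hlin : P.Lin) (hcnt : ∀ i, P.cnt i ≤ 1) :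
    P.Run 0 true := by
  obtain ⟨P', h, hu⟩ := h
  induction h using Relation.ReflTransGen.head_induction_on with
  | refl => exact hu.run
  | head h _ ih =>
    have h2 := h.lin_and_cnt_le hlin fun i => (hcnt i).trans (by simp)
    obtain ⟨γ, h3, h4, -⟩ := h.run_of_run hlin (fun i => (hcnt i).trans (by simp))
      (fun i hi => absurd (hcnt i) (by omega)) (ih h2.1 fun i => (h2.2 i).trans (hcnt i))
    rwa [funext fun i => h4 i (hcnt i)] at h3

end SharingPi


namespace SharingPi

/-! ### Terms: induction, free variables, renaming -/

theorem renameBag_eq_map (f : ℕ → ℕ) (B : Bag) : renameBag f B = B.map (Term.rename f) := by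
  induction B with
  | nil => simp [renameBag]
  | cons M B ih => simp [renameBag, ih]

mutual
-- Terms are nested inside lists, so structural recursion needs a companion statement for bags; it
-- is fixed here to be that all elements satisfy `C`.
theorem Term.bagInduction {C : Term → Prop} (var : ∀ x, C (.var x))
    (lam : ∀ k M, C M → C (.lam k M)) (app : ∀ M B, C M → (∀ N ∈ B, C N) → C (.app M B))
    (lsub : ∀ M N, C M → C N → C (.lsub M N)) (fail : ∀ S, C (.fail S))
    (share : ∀ k M x, C M → C (.share k M x))
    (esub : ∀ k M B, C M → (∀ N ∈ B, C N) → C (.esub k M B)) (tick : C .tick) : ∀ M, C M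
  | .var x => var x
  | .lam k M => lam k M (Term.bagInduction var lam app lsub fail share esub tick M)
  | .app M B => app M B (Term.bagInduction var lam app lsub fail share esub tick M)
      (bag_forall_of_bagInduction var lam app lsub fail share esub tick B)
  | .lsub M N => lsub M N (Term.bagInduction var lam app lsub fail share esub tick M)
      (Term.bagInduction var lam app lsub fail share esub tick N)
  | .fail S => fail S
  | .share k M x => share k M x (Term.bagInduction var lam app lsub fail share esub tick M)
  | .esub k M B => esub k M B (Term.bagInduction var lam app lsub fail share esub tick M)
      (bag_forall_of_bagInduction var lam app lsub fail share esub tick B)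
  | .tick => tick
theorem bag_forall_of_bagInduction {C : Term → Prop} (var : ∀ x, C (.var x))
    (lam : ∀ k M, C M → C (.lam k M)) (app : ∀ M B, C M → (∀ N ∈ B, C N) → C (.app M B))
    (lsub : ∀ M N, C M → C N → C (.lsub M N)) (fail : ∀ S, C (.fail S))
    (share : ∀ k M x, C M → C (.share k M x))
    (esub : ∀ k M B, C M → (∀ N ∈ B, C N) → C (.esub k M B)) (tick : C .tick) :
    ∀ B : List Term, ∀ N ∈ B, C N
  | [] => fun _ h => absurd h (by simp)
  | M :: B => fun N h => (List.mem_cons.1 h).elim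
      (fun h => h ▸ Term.bagInduction var lam app lsub fail share esub tick M)
      (bag_forall_of_bagInduction var lam app lsub fail share esub tick B N)
end

theorem mem_down {k i : ℕ} {S : Finset ℕ} : i ∈ down k S ↔ i + k ∈ S := by
  simp only [down, Finset.mem_image, Finset.mem_filter]
  constructor
  · rintro ⟨j, ⟨hj, hk⟩, rfl⟩
    rwa [Nat.sub_add_cancel hk]
  · exact fun h => ⟨i + k, ⟨h, by omega⟩, by omega⟩

theorem mem_fvBag {i : ℕ} {B : Bag} : i ∈ fvBag B ↔ ∃ N ∈ B, i ∈ N.fv := by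
  induction B with
  | nil => simp [fvBag]
  | cons M B ih => simp [fvBag, ih]

theorem fvBag_perm {B B' : Bag} (h : B.Perm B') : fvBag B = fvBag B' := by
  ext i
  simp only [mem_fvBag, h.mem_iff]

theorem liftN_add (k : ℕ) (f : ℕ → ℕ) (i : ℕ) : liftN k f (i + k) = f i + k := by simp [liftN]

theorem liftN_of_lt {k i : ℕ} (f : ℕ → ℕ) (h : i < k) : liftN k f i = i := by simp [liftN, h]

theorem down_image (k : ℕ) (f : ℕ → ℕ) (S : Finset ℕ) :
    down k (S.image (liftN k f)) = (down k S).image f := by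
  ext i
  simp only [mem_down, Finset.mem_image]
  constructor
  · rintro ⟨j, hj, h⟩
    by_cases hk : j < k
    · rw [liftN_of_lt f hk] at h; omega
    · obtain ⟨j, rfl⟩ := Nat.exists_eq_add_of_le' (not_lt.1 hk)
      rw [liftN_add] at h
      exact ⟨j, hj, by omega⟩
  · rintro ⟨j, hj, rfl⟩
    exact ⟨j + k, hj, liftN_add k f j⟩

theorem Term.fv_rename (f : ℕ → ℕ) (M : Term) : (M.rename f).fv = M.fv.image f := by
  have bag : ∀ (f : ℕ → ℕ) (B : Bag), (∀ N ∈ B, (N.rename f).fv = N.fv.image f) →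
      fvBag (renameBag f B) = (fvBag B).image f := by
    intro f B h
    rw [renameBag_eq_map]
    ext i
    simp only [mem_fvBag, List.mem_map, Finset.mem_image]
    constructor
    · rintro ⟨_, ⟨N, hN, rfl⟩, hi⟩
      rw [h N hN] at hi
      obtain ⟨j, hj, rfl⟩ := Finset.mem_image.1 hi
      exact ⟨j, ⟨N, hN, hj⟩, rfl⟩
    · rintro ⟨j, ⟨N, hN, hj⟩, rfl⟩
      exact ⟨_, ⟨N, hN, rfl⟩, by rw [h N hN]; exact Finset.mem_image_of_mem f hj⟩
  induction M using Term.bagInduction generalizing f with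
  | var | fail | tick => simp [Term.rename, Term.fv]
  | lam k M ih => simp [Term.rename, Term.fv, ih, down_image]
  | app M B ihM ihB =>
    simp only [Term.rename, Term.fv, ihM, Finset.image_union, bag f B fun N hN => ihB N hN f]
  | lsub M N ihM ihN => simp [Term.rename, Term.fv, ihM, ihN, down_image, Finset.image_union]
  | share k M x ih => simp [Term.rename, Term.fv, ih, down_image]
  | esub k M B ihM ihB =>
    simp only [Term.rename, Term.fv, ihM, down_image, Finset.image_union,
      bag f B fun N hN => ihB N hN f]

theorem fvBag_rename (f : ℕ → ℕ) (B : Bag) : fvBag (renameBag f B) = (fvBag B).image f := by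
  induction B with
  | nil => simp [renameBag, fvBag]
  | cons M B ih => simp [renameBag, fvBag, ih, Term.fv_rename, Finset.image_union]

theorem Term.rename_rename (f g : ℕ → ℕ) (M : Term) :
    (M.rename g).rename f = M.rename (f ∘ g) := by
  induction M using Term.bagInduction generalizing f g with
  | var | tick => simp [Term.rename]
  | fail S => simp [Term.rename, Finset.image_image]
  | lam k M ih => simp [Term.rename, ih, liftN_comp]
  | lsub M N ihM ihN => simp [Term.rename, ihM, ihN, liftN_comp]
  | share k M x ih => simp [Term.rename, ih, liftN_comp]
  | app M B ihM ihB =>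
    simp only [Term.rename, ihM, renameBag_eq_map, List.map_map, Term.app.injEq, true_and]
    exact List.map_congr_left fun N hN => ihB N hN f g
  | esub k M B ihM ihB =>
    simp only [Term.rename, ihM, renameBag_eq_map, List.map_map, liftN_comp, Term.esub.injEq, true_and]
    exact List.map_congr_left fun N hN => ihB N hN f g

theorem Term.rename_id (M : Term) : M.rename id = M := by
  induction M using Term.bagInduction with
  | var | tick | fail => simp [Term.rename]
  | lam k M ih => simp [Term.rename, ih, liftN_id]
  | lsub M N ihM ihN => simp [Term.rename, ihM, ihN, liftN_id]
  | share k M x ih => simp [Term.rename, ih, liftN_id]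
  | app M B ihM ihB =>
    simp only [Term.rename, ihM, renameBag_eq_map, Term.app.injEq, true_and]
    exact (List.map_congr_left ihB).trans (List.map_id' B)
  | esub k M B ihM ihB =>
    simp only [Term.rename, ihM, renameBag_eq_map, liftN_id, Term.esub.injEq, true_and]
    exact (List.map_congr_left ihB).trans (List.map_id' B)

theorem exists_perm_of_perm_map {α β : Type*} (f : α → β) {B : List α} {B' : List β}
    (h : B'.Perm (B.map f)) : ∃ A : List α, A.Perm B ∧ B' = A.map f := by
  have h1 := congrFun (congrFun (List.eq_map_comp_perm f) B') B
  rw [← h1] at h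
  obtain ⟨A, h2, h3⟩ := h
  exact ⟨A, h3, h2⟩

theorem mem_fvBag_of_mem {i : ℕ} {B : Bag} {N : Term} (hN : N ∈ B) (hi : i ∈ N.fv) :
    i ∈ fvBag B := mem_fvBag.2 ⟨N, hN, hi⟩

/-! ### Affine terms -/

mutual
/-- Free variables are used by at most one component at each node, and there is no free-standing
sharing construct. -/
def Term.Ok : Term → Prop
  | .var _ => True
  | .lam _ M => M.Ok
  | .app M B => M.Ok ∧ OkBag B ∧ Disjoint M.fv (fvBag B)
  | .lsub M N => M.Ok ∧ N.Ok ∧ Disjoint (down 1 M.fv) N.fv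
  | .fail _ => True
  | .share _ _ _ => False
  | .esub k M B => M.Ok ∧ OkBag B ∧ Disjoint (down k M.fv) (fvBag B)
  | .tick => True
/-- The condition `Term.Ok`, for bags. -/
def OkBag : List Term → Prop
  | [] => True
  | M :: B => M.Ok ∧ OkBag B ∧ Disjoint M.fv (fvBag B)
end

theorem disjoint_fvBag {S : Finset ℕ} {B : Bag} :
    Disjoint S (fvBag B) ↔ ∀ N ∈ B, Disjoint S N.fv := by
  simp only [Finset.disjoint_left, mem_fvBag]
  grind

theorem okBag_iff {B : Bag} :
    OkBag B ↔ (∀ N ∈ B, N.Ok) ∧ B.Pairwise fun M N => Disjoint M.fv N.fv := by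
  induction B with
  | nil => simp [OkBag]
  | cons M B ih =>
    simp only [OkBag, ih, disjoint_fvBag, List.mem_cons, forall_eq_or_imp, List.pairwise_cons]
    tauto

theorem OkBag.perm {B B' : Bag} (h : OkBag B) (hp : B.Perm B') : OkBag B' := by
  rw [okBag_iff] at h ⊢
  exact ⟨fun N hN => h.1 N (hp.mem_iff.2 hN), h.2.perm hp fun h => h.symm⟩

theorem injOn_liftN {k : ℕ} {f : ℕ → ℕ} {S : Finset ℕ} (h : Set.InjOn f (down k S)) :
    Set.InjOn (liftN k f) S := by
  intro i hi j hj hij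
  by_cases hik : i < k <;> by_cases hjk : j < k
  · rwa [liftN_of_lt f hik, liftN_of_lt f hjk] at hij
  · obtain ⟨j, rfl⟩ := Nat.exists_eq_add_of_le' (not_lt.1 hjk)
    rw [liftN_of_lt f hik, liftN_add] at hij; omega
  · obtain ⟨i, rfl⟩ := Nat.exists_eq_add_of_le' (not_lt.1 hik)
    rw [liftN_of_lt f hjk, liftN_add] at hij; omega
  · obtain ⟨i, rfl⟩ := Nat.exists_eq_add_of_le' (not_lt.1 hik)
    obtain ⟨j, rfl⟩ := Nat.exists_eq_add_of_le' (not_lt.1 hjk)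
    rw [liftN_add, liftN_add] at hij
    rw [h (mem_down.2 hi) (mem_down.2 hj) (by omega)]

theorem disjoint_image_iff {f : ℕ → ℕ} {S T : Finset ℕ} (h : Set.InjOn f (S ∪ T : Finset ℕ)) :
    Disjoint (S.image f) (T.image f) ↔ Disjoint S T := by
  simp only [Finset.disjoint_left, Finset.mem_image]
  constructor
  · intro hd i hi hj
    exact hd ⟨i, hi, rfl⟩ ⟨i, hj, rfl⟩
  · rintro hd _ ⟨i, hi, rfl⟩ ⟨j, hj, hij⟩
    have := h (by simp [hj]) (by simp [hi]) hij
    exact hd hi (this ▸ hj)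

theorem Term.ok_rename {f : ℕ → ℕ} {M : Term} (hf : Set.InjOn f M.fv) :
    (M.rename f).Ok ↔ M.Ok := by
  have bag : ∀ {f : ℕ → ℕ} {B : Bag}, Set.InjOn f (fvBag B) →
      (∀ N ∈ B, ∀ {f : ℕ → ℕ}, Set.InjOn f N.fv → ((N.rename f).Ok ↔ N.Ok)) →
      (OkBag (renameBag f B) ↔ OkBag B) := by
    intro f B hf h
    induction B with
    | nil => simp [renameBag]
    | cons M B ih =>
      simp only [fvBag, Finset.coe_union] at hf
      simp only [renameBag, OkBag, Term.fv_rename, fvBag_rename]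
      rw [h M (by simp) (hf.mono Set.subset_union_left),
        ih (hf.mono Set.subset_union_right) fun N hN => h N (by simp [hN]),
        disjoint_image_iff (by simpa using hf)]
  induction M using Term.bagInduction generalizing f with
  | var | fail | tick | share => simp [Term.rename, Term.Ok]
  | lam k M ih =>
    simp only [Term.rename, Term.Ok]
    exact ih (injOn_liftN hf)
  | app M B ihM ihB =>
    simp only [Term.fv, Finset.coe_union] at hf
    simp only [Term.rename, Term.Ok, Term.fv_rename, fvBag_rename]
    exact and_congr (ihM (hf.mono Set.subset_union_left))
      (and_congr (bag (hf.mono Set.subset_union_right) ihB) (disjoint_image_iff (by simpa using hf)))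
  | lsub M N ihM ihN =>
    simp only [Term.fv, Finset.coe_union] at hf
    simp only [Term.rename, Term.Ok, Term.fv_rename, down_image]
    exact and_congr (ihM (injOn_liftN (hf.mono Set.subset_union_left)))
      (and_congr (ihN (hf.mono Set.subset_union_right)) (disjoint_image_iff (by simpa using hf)))
  | esub k M B ihM ihB =>
    simp only [Term.fv, Finset.coe_union] at hf
    simp only [Term.rename, Term.Ok, Term.fv_rename, down_image, fvBag_rename]
    exact and_congr (ihM (injOn_liftN (hf.mono Set.subset_union_left)))
      (and_congr (bag (hf.mono Set.subset_union_right) ihB) (disjoint_image_iff (by simpa using hf)))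

theorem okBag_shift {k : ℕ} {B : Bag} : OkBag (shiftBag k B) ↔ OkBag B := by
  have hinj : Function.Injective fun i => i + k := fun _ _ h => by simpa using h
  rw [shiftBag]
  induction B with
  | nil => simp [renameBag]
  | cons M B ih =>
    simp only [renameBag, OkBag, Term.fv_rename, fvBag_rename]
    exact and_congr (Term.ok_rename hinj.injOn) (and_congr ih (disjoint_image_iff hinj.injOn))

theorem Term.ok_shift {k : ℕ} {M : Term} : (M.shift k).Ok ↔ M.Ok :=
  Term.ok_rename fun _ _ _ _ h => by simpa using h

theorem Term.mem_fv_shift {k i : ℕ} {M : Term} : i ∈ (M.shift k).fv ↔ ∃ j ∈ M.fv, j + k = i := by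
  rw [Term.shift, Term.fv_rename, Finset.mem_image]

theorem mem_fvBag_shift {k i : ℕ} {B : Bag} :
    i ∈ fvBag (shiftBag k B) ↔ ∃ j ∈ fvBag B, j + k = i := by
  rw [shiftBag, fvBag_rename, Finset.mem_image]

theorem down_fvBag_shift (k : ℕ) (B : Bag) : down k (fvBag (shiftBag k B)) = fvBag B := by
  ext i
  simp [mem_down, mem_fvBag_shift]

theorem down_fv_shift (k : ℕ) (M : Term) : down k (M.shift k).fv = M.fv := by
  ext i
  simp [mem_down, Term.mem_fv_shift]

theorem down_union (k : ℕ) (S T : Finset ℕ) : down k (S ∪ T) = down k S ∪ down k T := by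
  ext i
  simp [mem_down]

theorem down_mono {k : ℕ} {S T : Finset ℕ} (h : S ⊆ T) : down k S ⊆ down k T := fun _ hi =>
  mem_down.2 (h (mem_down.1 hi))

theorem Term.fv_lsubs (M : Term) (B : Bag) :
    (M.lsubs B).fv = down B.length M.fv ∪ fvBag B := by
  induction B generalizing M with
  | nil =>
    ext i
    simp [Term.lsubs, fvBag, mem_down]
  | cons N B ih =>
    simp only [Term.lsubs, ih, Term.fv, fvBag, List.length_cons]
    rw [down_union, down_fv_shift]
    ext i
    simp only [Finset.mem_union, mem_down, show i + B.length + 1 = i + (B.length + 1) by omega]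
    tauto

theorem Term.ok_lsubs {M : Term} {B : Bag} (hM : M.Ok) (hB : OkBag B)
    (hd : Disjoint (down B.length M.fv) (fvBag B)) : (M.lsubs B).Ok := by
  induction B generalizing M with
  | nil => exact hM
  | cons N B ih =>
    simp only [OkBag, fvBag, List.length_cons, Finset.disjoint_left, Finset.mem_union,
      mem_down] at hB hd
    refine ih ⟨hM, Term.ok_shift.2 hB.1, ?_⟩ hB.2.1 ?_
    · rw [Finset.disjoint_left]
      intro i hi hj
      obtain ⟨j, hjN, rfl⟩ := Term.mem_fv_shift.1 hj
      exact hd (a := j) (by rw [mem_down] at hi; rwa [add_assoc] at hi) (Or.inl hjN)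
    · rw [Finset.disjoint_left]
      intro i hi hj
      simp only [Term.fv, mem_down, Finset.mem_union, Term.mem_fv_shift] at hi
      rcases hi with hi | ⟨j, hi, hij⟩
      · exact hd (a := i) (by rwa [add_assoc] at hi) (Or.inr hj)
      · exact hB.2.2 hi (by rwa [show j = i by omega])

/-! ### Heads -/

theorem Head.exit_eq_free {h h' : Head} {k x : ℕ} (hh : ∀ y, h' ≠ .free y)
    (he : h.exit k h' = .free x) : h = .free (x + k) := by
  cases h with
  | free i =>
    simp only [Head.exit] at he
    split_ifs at he with hi
    · exact absurd he (hh x)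
    · simp only [Head.free.injEq] at he
      rw [← he, Nat.sub_add_cancel (not_lt.1 hi)]
  | _ => simp [Head.exit] at he

theorem Head.exit_eq_tick {h h' : Head} {k : ℕ} (hh : h' ≠ .tick)
    (he : h.exit k h' = .tick) : h = .tick := by
  cases h with
  | free i =>
    simp only [Head.exit] at he
    split_ifs at he with hi
    exact absurd he hh
  | tick => rfl
  | _ => simp [Head.exit] at he

theorem Term.mem_fv_of_head {M : Term} {x : ℕ} (hM : M.Ok) (h : M.head = .free x) : x ∈ M.fv := by
  induction M using Term.bagInduction generalizing x with
  | var y => simpa [Term.head, Term.fv, eq_comm] using h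
  | app M B ihM _ => exact Finset.mem_union_left _ (ihM hM.1 h)
  | lsub M N ihM _ =>
    exact Finset.mem_union_left _ (mem_down.2 (ihM hM.1 (Head.exit_eq_free (by simp) h)))
  | esub k M B ihM _ =>
    simp only [Term.head] at h
    split_ifs at h
    exact Finset.mem_union_left _ (mem_down.2 (ihM hM.1 (Head.exit_eq_free (by simp) h)))
  | share => exact hM.elim
  | _ => simp [Term.head] at h

/-- By affinity the head occurrence of `x` is its only occurrence: the bags and arguments passed on
the way to the head do not contain `x`. So `x` disappears, and `N` is placed among variables that
are disjoint from its own. -/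
theorem Term.ok_headSubst {M N : Term} {x : ℕ} (hM : M.Ok) (hN : N.Ok) (h : M.head = .free x)
    (hd : ∀ i ∈ M.fv, i ≠ x → i ∉ N.fv) :
    (M.headSubst x N).Ok ∧ ∀ i ∈ (M.headSubst x N).fv, (i ∈ M.fv ∧ i ≠ x) ∨ i ∈ N.fv := by
  induction M using Term.bagInduction generalizing x N with
  | var y =>
    simp only [Term.head, Head.free.injEq] at h
    simp +contextual [Term.headSubst, h, hN]
  | app M B ihM _ =>
    simp only [Term.Ok, Term.fv, Finset.disjoint_left, Finset.mem_union] at hM hd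
    obtain ⟨h1, h2⟩ := ihM hM.1 hN h fun i hi => hd i (Or.inl hi)
    have hx : x ∉ fvBag B := hM.2.2 (Term.mem_fv_of_head hM.1 h)
    simp only [Term.headSubst, Term.Ok, Term.fv, Finset.disjoint_left, Finset.mem_union]
    refine ⟨⟨h1, hM.2.1, fun i hi hB => ?_⟩, fun i hi => ?_⟩
    · rcases h2 i hi with h | h
      · exact hM.2.2 h.1 hB
      · exact hd i (Or.inr hB) (fun h => hx (h ▸ hB)) h
    · rcases hi with hi | hi
      · rcases h2 i hi with h | h
        · exact Or.inl ⟨Or.inl h.1, h.2⟩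
        · exact Or.inr h
      · exact Or.inl ⟨Or.inr hi, fun h => hx (h ▸ hi)⟩
  | lsub M L ihM _ =>
    have h' : M.head = .free (x + 1) := Head.exit_eq_free (by simp) h
    simp only [Term.Ok, Term.fv, Finset.disjoint_left, Finset.mem_union, mem_down] at hM hd
    obtain ⟨h1, h2⟩ := ihM (N := N.shift 1) hM.1 (Term.ok_shift.2 hN) h' fun i hi hne hiN => by
      obtain ⟨j, hj, rfl⟩ := Term.mem_fv_shift.1 hiN
      exact hd j (Or.inl hi) (by simpa using hne) hj
    have hx : x ∉ L.fv := hM.2.2 (Term.mem_fv_of_head hM.1 h')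
    simp only [Term.headSubst, Term.Ok, Term.fv, Finset.disjoint_left, Finset.mem_union, mem_down]
    have h3 : ∀ i, i + 1 ∈ (M.headSubst (x + 1) (N.shift 1)).fv →
        (i + 1 ∈ M.fv ∧ i ≠ x) ∨ i ∈ N.fv := by
      intro i hi
      refine (h2 _ hi).imp (fun h => ⟨h.1, by simpa using h.2⟩) fun h => ?_
      obtain ⟨j, hj, hij⟩ := Term.mem_fv_shift.1 h
      rwa [show i = j by omega]
    refine ⟨⟨h1, hM.2.1, fun i hi hL => ?_⟩, fun i hi => ?_⟩
    · rcases h3 i hi with h | h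
      · exact hM.2.2 h.1 hL
      · exact hd i (Or.inr hL) (fun h => hx (h ▸ hL)) h
    · rcases hi with hi | hi
      · rcases h3 i hi with h | h
        · exact Or.inl ⟨Or.inl h.1, h.2⟩
        · exact Or.inr h
      · exact Or.inl ⟨Or.inr hi, fun h => hx (h ▸ hi)⟩
  | esub k M B ihM _ =>
    have h' : M.head = .free (x + k) := by
      simp only [Term.head] at h
      split_ifs at h
      exact Head.exit_eq_free (by simp) h
    simp only [Term.Ok, Term.fv, Finset.disjoint_left, Finset.mem_union, mem_down] at hM hd
    obtain ⟨h1, h2⟩ := ihM (N := N.shift k) hM.1 (Term.ok_shift.2 hN) h' fun i hi hne hiN => by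
      obtain ⟨j, hj, rfl⟩ := Term.mem_fv_shift.1 hiN
      exact hd j (Or.inl hi) (by simpa using hne) hj
    have hx : x ∉ fvBag B := hM.2.2 (Term.mem_fv_of_head hM.1 h')
    simp only [Term.headSubst, Term.Ok, Term.fv, Finset.disjoint_left, Finset.mem_union, mem_down]
    have h3 : ∀ i, i + k ∈ (M.headSubst (x + k) (N.shift k)).fv →
        (i + k ∈ M.fv ∧ i ≠ x) ∨ i ∈ N.fv := by
      intro i hi
      refine (h2 _ hi).imp (fun h => ⟨h.1, by simpa using h.2⟩) fun h => ?_
      obtain ⟨j, hj, hij⟩ := Term.mem_fv_shift.1 h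
      rwa [show i = j by omega]
    refine ⟨⟨h1, hM.2.1, fun i hi hL => ?_⟩, fun i hi => ?_⟩
    · rcases h3 i hi with h | h
      · exact hM.2.2 h.1 hL
      · exact hd i (Or.inr hL) (fun h => hx (h ▸ hL)) h
    · rcases hi with hi | hi
      · rcases h3 i hi with h | h
        · exact Or.inl ⟨Or.inl h.1, h.2⟩
        · exact Or.inr h
      · exact Or.inl ⟨Or.inr hi, fun h => hx (h ▸ hi)⟩
  | share => exact hM.elim
  | _ => simp [Term.head] at h

/-! ### Affinity along reduction and precongruence -/

theorem Red.ok {M : Term} {E : Expr} (h : Red M E) (hM : M.Ok) :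
    ∀ M' ∈ E, M'.Ok ∧ M'.fv ⊆ M.fv := by
  induction h with
  | beta k M B =>
    simp only [List.mem_singleton, forall_eq]
    exact ⟨hM, le_rfl⟩
  | exSub k M B hk _ _ =>
    simp only [List.mem_map, List.mem_permutations]
    rintro _ ⟨B', hB, rfl⟩
    have hl : B'.length = k := hB.length_eq.trans hk
    refine ⟨Term.ok_lsubs hM.1 (hM.2.1.perm hB.symm) ?_, ?_⟩
    · rw [fvBag_perm hB, hl]; exact hM.2.2
    · rw [Term.fv_lsubs, fvBag_perm hB, hl]; rfl
  | linFetch M N h =>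
    simp only [List.mem_singleton, forall_eq]
    simp only [Term.Ok, Finset.disjoint_left, mem_down] at hM
    obtain ⟨h1, h2⟩ := Term.ok_headSubst (N := N.shift 1) hM.1 (Term.ok_shift.2 hM.2.1) h
      fun i hi hne hiN => by
        obtain ⟨j, hj, rfl⟩ := Term.mem_fv_shift.1 hiN
        exact hM.2.2 hi hj
    -- The substituted variable is gone, so the truncated subtraction that closes the gap is
    -- injective on the remaining variables.
    have h0 : ∀ i ∈ (M.headSubst 0 (N.shift 1)).fv, i ≠ 0 := by
      intro i hi
      rcases h2 i hi with h | h
      · exact h.2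
      · obtain ⟨j, hj, rfl⟩ := Term.mem_fv_shift.1 h
        simp
    refine ⟨(Term.ok_rename fun i hi j hj hij => ?_).2 h1, fun i hi => ?_⟩
    · have := h0 i hi; have := h0 j hj; omega
    · rw [Term.fv_rename, Finset.mem_image] at hi
      obtain ⟨j, hj, rfl⟩ := hi
      simp only [Term.fv, Finset.mem_union, mem_down]
      have h3 := h0 j hj
      rcases h2 j hj with h | h
      · left
        rw [Nat.sub_add_cancel (by omega)]; exact h.1
      · obtain ⟨j, hjN, rfl⟩ := Term.mem_fv_shift.1 h
        exact Or.inr hjN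
  | fail | cons₁ | cons₂ | cons₃ =>
    simp [Term.Ok, Term.fv]
  | ctxApp M E B _ ih =>
    simp only [List.mem_map]
    rintro _ ⟨M', hM', rfl⟩
    obtain ⟨h1, h2⟩ := ih hM.1 M' hM'
    exact ⟨⟨h1, hM.2.1, hM.2.2.mono_left h2⟩, Finset.union_subset_union_left h2⟩
  | ctxLsub M E N _ ih =>
    simp only [List.mem_map]
    rintro _ ⟨M', hM', rfl⟩
    obtain ⟨h1, h2⟩ := ih hM.1 M' hM'
    exact ⟨⟨h1, hM.2.1, hM.2.2.mono_left (down_mono h2)⟩,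
      Finset.union_subset_union_left (down_mono h2)⟩
  | ctxShare => exact hM.elim
  | ctxEsub M E _ ih =>
    simp only [List.mem_map]
    rintro _ ⟨M', hM', rfl⟩
    obtain ⟨h1, h2⟩ := ih hM.1 M' hM'
    exact ⟨⟨h1, hM.2.1, hM.2.2.mono_left (down_mono h2)⟩,
      Finset.union_subset_union_left (down_mono h2)⟩

theorem blockSwap_invol (a b i : ℕ) : blockSwap b a (blockSwap a b i) = i := by
  simp only [blockSwap]; split_ifs <;> omega

theorem blockSwap_injective (a b : ℕ) : Function.Injective (blockSwap a b) :=
  Function.LeftInverse.injective (blockSwap_invol a b)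

theorem mem_image_blockSwap {a b i : ℕ} {S : Finset ℕ} :
    i ∈ S.image (blockSwap a b) ↔ blockSwap b a i ∈ S := by
  rw [Finset.mem_image]
  constructor
  · rintro ⟨j, hj, rfl⟩; rwa [blockSwap_invol]
  · exact fun h => ⟨_, h, blockSwap_invol b a i⟩

theorem Pre.ok {M M' : Term} (h : Pre M M') : M.Ok → M'.Ok ∧ M'.fv ⊆ M.fv := by
  induction h with
  | refl M => exact fun h => ⟨h, le_rfl⟩
  | trans _ _ _ _ _ ih1 ih2 =>
    intro h
    obtain ⟨h1, h2⟩ := ih1 h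
    obtain ⟨h3, h4⟩ := ih2 h1
    exact ⟨h3, h4.trans h2⟩
  | vacuous M =>
    intro h
    exact ⟨h.1, fun i hi => Finset.mem_union_left _ (mem_down.2 hi)⟩
  | appLsub M N B | lsubApp M N B | appEsub k M A B | esubApp k M A B =>
    simp only [Term.Ok, Term.fv, down_union, down_fvBag_shift, okBag_shift, Finset.disjoint_left,
      Finset.mem_union, mem_down, mem_fvBag_shift, Finset.subset_iff]
    grind
  | lsubLsub M N₁ N₂ =>
    have hb : ∀ i, blockSwap 1 1 (i + 1 + 1) = i + 1 + 1 := fun i => by simp [blockSwap]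
    simp only [Term.Ok, Term.fv, down_union, down_fv_shift, Term.ok_shift, Finset.disjoint_left,
      Finset.mem_union, mem_down, Term.mem_fv_shift, Finset.subset_iff, Term.fv_rename,
      mem_image_blockSwap, Term.ok_rename (blockSwap_injective 1 1).injOn, hb]
    have h1 : ∀ i, blockSwap 1 1 (i + 1) ∈ M.fv → ∀ j, j + 1 = i → i + 1 ∈ M.fv := by
      rintro _ h j rfl; rwa [hb] at h
    intro h
    refine ⟨⟨⟨h.1.1, h.2.1, fun i hi ⟨j, hj, hij⟩ => ?_⟩, h.1.2.1, fun i hi hN => ?_⟩, fun i hi => ?_⟩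
    · exact h.2.2 (Or.inl (h1 i hi j hij |> fun h => by subst hij; exact h)) hj
    · rcases hi with hi | hi
      · exact h.1.2.2 hi ⟨i, hN, rfl⟩
      · exact h.2.2 (Or.inr hN) hi
    · tauto
  | esubEsub k l M A B =>
    have hb : ∀ i, blockSwap k l (i + l + k) = i + k + l := fun i => by
      simp only [blockSwap]; split_ifs <;> omega
    have hb' : ∀ i, blockSwap k l (i + k + l) = i + k + l := fun i => by
      simp only [blockSwap]; split_ifs <;> omega
    simp only [Term.Ok, Term.fv, down_union, down_fvBag_shift, okBag_shift, Finset.disjoint_left,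
      Finset.mem_union, mem_down, mem_fvBag_shift, Finset.subset_iff, Term.fv_rename,
      mem_image_blockSwap, Term.ok_rename (blockSwap_injective l k).injOn, hb]
    intro h
    refine ⟨⟨⟨h.1.1, h.2.1, ?_⟩, h.1.2.1, fun i hi hN => ?_⟩, fun i hi => ?_⟩
    · rintro _ hi ⟨j, hj, rfl⟩
      rw [hb] at hi
      exact h.2.2 (Or.inl hi) hj
    · rcases hi with hi | hi
      · exact h.1.2.2 hi ⟨i, hN, rfl⟩
      · exact h.2.2 (Or.inr hN) hi
    · tauto
  | ctxApp M M' B _ ih =>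
    intro h
    obtain ⟨h1, h2⟩ := ih h.1
    exact ⟨⟨h1, h.2.1, h.2.2.mono_left h2⟩, Finset.union_subset_union_left h2⟩
  | ctxLsub M M' N _ ih =>
    intro h
    obtain ⟨h1, h2⟩ := ih h.1
    exact ⟨⟨h1, h.2.1, h.2.2.mono_left (down_mono h2)⟩,
      Finset.union_subset_union_left (down_mono h2)⟩
  | ctxShare => exact fun h => h.elim
  | ctxEsub M M' _ ih =>
    intro h
    obtain ⟨h1, h2⟩ := ih h.1
    exact ⟨⟨h1, h.2.1, h.2.2.mono_left (down_mono h2)⟩,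
      Finset.union_subset_union_left (down_mono h2)⟩

end SharingPi


namespace SharingPi

/-! ### An environment machine -/

/-- Closures: a term with an environment for its free variables. -/
inductive Clo : Type
  | none : Clo
  | mk (N : Term) (e : ℕ → Clo) : Clo

/-- The environment `e` extended by closures for the innermost variables. -/
def extEnv (cs : List Clo) (e : ℕ → Clo) (i : ℕ) : Clo := (cs[i]?).getD (e (i - cs.length))

/-- The closures of the elements of a bag. -/
def closures (B : Bag) (e : ℕ → Clo) : List Clo := B.map fun N => .mk N e

/-- A stack of arguments: bags with their environments. -/
abbrev Stack : Type := List (Bag × (ℕ → Clo))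

/-- The machine started at `M` may reach `✓`. -/
inductive Eval : Term → (ℕ → Clo) → Stack → Prop
  | tick (e : ℕ → Clo) (s : Stack) : Eval .tick e s
  | var (x : ℕ) (e : ℕ → Clo) (s : Stack) (N : Term) (e' : ℕ → Clo) :
      e x = .mk N e' → Eval N e' s → Eval (.var x) e s
  | app (M : Term) (B B' : Bag) (e : ℕ → Clo) (s : Stack) :
      B'.Perm B → Eval M e ((B', e) :: s) → Eval (.app M B) e s
  | lam (k : ℕ) (M : Term) (B : Bag) (e e' : ℕ → Clo) (s : Stack) :
      B.length = k → Eval M (extEnv (closures B e') e) s → Eval (.lam k M) e ((B, e') :: s)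
  | lsub (M N : Term) (e : ℕ → Clo) (s : Stack) :
      Eval M (extEnv [.mk N e] e) s → Eval (.lsub M N) e s
  | esub (k : ℕ) (M : Term) (B B' : Bag) (e : ℕ → Clo) (s : Stack) :
      B'.Perm B → B'.length = k → Eval M (extEnv (closures B' e) e) s → Eval (.esub k M B) e s

theorem eval_app {M : Term} {B : Bag} {e : ℕ → Clo} {s : Stack} :
    Eval (.app M B) e s ↔ ∃ B', B'.Perm B ∧ Eval M e ((B', e) :: s) :=
  ⟨fun h => by cases h with | app _ _ B' _ _ h1 h2 => exact ⟨B', h1, h2⟩,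
    fun ⟨B', h1, h2⟩ => .app M B B' e s h1 h2⟩

theorem eval_lsub {M N : Term} {e : ℕ → Clo} {s : Stack} :
    Eval (.lsub M N) e s ↔ Eval M (extEnv [.mk N e] e) s :=
  ⟨fun h => by cases h with | lsub _ _ _ _ h => exact h, .lsub M N e s⟩

theorem eval_esub {k : ℕ} {M : Term} {B : Bag} {e : ℕ → Clo} {s : Stack} :
    Eval (.esub k M B) e s ↔
      ∃ B', B'.Perm B ∧ B'.length = k ∧ Eval M (extEnv (closures B' e) e) s :=
  ⟨fun h => by cases h with | esub _ _ _ B' _ _ h1 h2 h3 => exact ⟨B', h1, h2, h3⟩,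
    fun ⟨B', h1, h2, h3⟩ => .esub k M B B' e s h1 h2 h3⟩

theorem eval_lam_cons {k : ℕ} {M : Term} {B : Bag} {e e' : ℕ → Clo} {s : Stack} :
    Eval (.lam k M) e ((B, e') :: s) ↔ B.length = k ∧ Eval M (extEnv (closures B e') e) s :=
  ⟨fun h => by cases h with | lam _ _ _ _ _ _ h1 h2 => exact ⟨h1, h2⟩,
    fun ⟨h1, h2⟩ => .lam k M B e e' s h1 h2⟩

theorem not_eval_lam_nil {k : ℕ} {M : Term} {e : ℕ → Clo} : ¬ Eval (.lam k M) e [] := nofun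

theorem not_eval_fail {S : Finset ℕ} {e : ℕ → Clo} {s : Stack} : ¬ Eval (.fail S) e s := nofun

theorem eval_var {x : ℕ} {e : ℕ → Clo} {s : Stack} :
    Eval (.var x) e s ↔ ∃ N e', e x = .mk N e' ∧ Eval N e' s :=
  ⟨fun h => by cases h with | var _ _ _ N e' h1 h2 => exact ⟨N, e', h1, h2⟩,
    fun ⟨N, e', h1, h2⟩ => .var x e s N e' h1 h2⟩

/-! ### Equivalent closures -/

/-- Closures that agree up to the names of the variables that occur in them. -/
inductive CloEq : Clo → Clo → Prop
  | none : CloEq .none .none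
  | mk (N : Term) (f g : ℕ → ℕ) (e e' : ℕ → Clo) :
      (∀ i ∈ N.fv, CloEq (e (f i)) (e' (g i))) → CloEq (.mk (N.rename f) e) (.mk (N.rename g) e')

theorem CloEq.symm {c c' : Clo} (h : CloEq c c') : CloEq c' c := by
  induction h with
  | none => exact .none
  | mk N f g e e' _ ih => exact .mk N g f e' e ih

theorem CloEq.of_env {N : Term} {e e' : ℕ → Clo} (h : ∀ i ∈ N.fv, CloEq (e i) (e' i)) :
    CloEq (.mk N e) (.mk N e') := by
  have := CloEq.mk N id id e e' h
  rwa [Term.rename_id] at this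

theorem CloEq.refl (c : Clo) : CloEq c c := by
  induction c with
  | none => exact .none
  | mk N e ih => exact .of_env fun i _ => ih i

theorem CloEq.rename {N : Term} (f : ℕ → ℕ) {e e' : ℕ → Clo}
    (h : ∀ i ∈ N.fv, CloEq (e (f i)) (e' i)) : CloEq (.mk (N.rename f) e) (.mk N e') := by
  have := CloEq.mk N f id e e' h
  rwa [Term.rename_id] at this

/-- Equivalent frames. -/
def FrameEq (p q : Bag × (ℕ → Clo)) : Prop :=
  List.Forall₂ (fun M N => CloEq (.mk M p.2) (.mk N q.2)) p.1 q.1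

theorem FrameEq.symm {p q : Bag × (ℕ → Clo)} (h : FrameEq p q) : FrameEq q p :=
  (List.Forall₂.flip h).imp fun _ _ h => CloEq.symm h

theorem FrameEq.map {B : Bag} {f g : ℕ → ℕ} {e e' : ℕ → Clo}
    (h : ∀ i ∈ fvBag B, CloEq (e (f i)) (e' (g i))) :
    FrameEq (B.map (Term.rename f), e) (B.map (Term.rename g), e') := by
  rw [FrameEq, List.forall₂_map_left_iff, List.forall₂_map_right_iff, List.forall₂_same]
  exact fun N hN => .mk N f g e e' fun i hi => h i (mem_fvBag_of_mem hN hi)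

theorem FrameEq.of_env {B : Bag} {e e' : ℕ → Clo} (h : ∀ i ∈ fvBag B, CloEq (e i) (e' i)) :
    FrameEq (B, e) (B, e') := by
  rw [FrameEq, List.forall₂_same]
  exact fun N hN => .of_env fun i hi => h i (mem_fvBag_of_mem hN hi)

theorem FrameEq.refl (p : Bag × (ℕ → Clo)) : FrameEq p p := .of_env fun _ _ => .refl _

abbrev StackEq : Stack → Stack → Prop := List.Forall₂ FrameEq

theorem StackEq.refl (s : Stack) : StackEq s s := List.forall₂_same.2 fun p _ => .refl p

theorem StackEq.symm {s s' : Stack} (h : StackEq s s') : StackEq s' s :=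
  (List.Forall₂.flip h).imp fun _ _ h => FrameEq.symm h

theorem extEnv_of_lt {cs : List Clo} {e : ℕ → Clo} {i : ℕ} (h : i < cs.length) :
    extEnv cs e i = cs[i] := by simp [extEnv, h]

theorem extEnv_add {cs : List Clo} {e : ℕ → Clo} {i : ℕ} :
    extEnv cs e (i + cs.length) = e i := by simp [extEnv]

theorem extEnv_add' {cs : List Clo} {e : ℕ → Clo} {i k : ℕ} (h : cs.length = k) :
    extEnv cs e (i + k) = e i := by subst h; exact extEnv_add

theorem extEnv_nil (e : ℕ → Clo) : extEnv [] e = e := by funext i; simp [extEnv]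

theorem extEnv_one_zero (c : Clo) (e : ℕ → Clo) : extEnv [c] e 0 = c := rfl

theorem extEnv_one_succ (c : Clo) (e : ℕ → Clo) (i : ℕ) : extEnv [c] e (i + 1) = e i := by
  simp [extEnv]

theorem length_closures (B : Bag) (e : ℕ → Clo) : (closures B e).length = B.length := by
  simp [closures]

theorem FrameEq.extEnv {B B' : Bag} {k : ℕ} {e e' : ℕ → Clo} (h : FrameEq (B, e) (B', e'))
    (hk : B.length = k) {M : Term} {f g : ℕ → ℕ} {d d' : ℕ → Clo}
    (hd : ∀ i ∈ down k M.fv, CloEq (d (f i)) (d' (g i))) : ∀ i ∈ M.fv,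
      CloEq (SharingPi.extEnv (closures B e) d (liftN k f i))
        (SharingPi.extEnv (closures B' e') d' (liftN k g i)) := by
  intro i hi
  have hl : B.length = B'.length := List.Forall₂.length_eq h
  by_cases hik : i < k
  · rw [liftN_of_lt f hik, liftN_of_lt g hik, extEnv_of_lt (by rw [length_closures]; omega),
      extEnv_of_lt (by rw [length_closures]; omega)]
    simp only [closures, List.getElem_map]
    exact h.get (i := i) (by simp only; omega) (by simp only; omega)
  · obtain ⟨i, rfl⟩ := Nat.exists_eq_add_of_le' (not_lt.1 hik)
    rw [liftN_add, liftN_add, extEnv_add' (by rw [length_closures, hk]),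
      extEnv_add' (by rw [length_closures, ← hl, hk])]
    exact hd i (mem_down.2 hi)

/-- Reduction and the precongruence move terms across binders, so closures that ought to be equal
differ by a shift. The machine only looks variables up and never inspects their names, so such
closures are interchangeable. Writing the term as `N.rename f` lets the induction hypothesis pass
below binders, where the renaming is lifted. -/
theorem Eval.congr {M : Term} {e : ℕ → Clo} {s : Stack} (h : Eval M e s) :
    ∀ {N : Term} {f : ℕ → ℕ}, M = N.rename f → ∀ {g : ℕ → ℕ} {e' : ℕ → Clo} {s' : Stack},
      (∀ i ∈ N.fv, CloEq (e (f i)) (e' (g i))) → StackEq s s' → Eval (N.rename g) e' s' := by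
  induction h with
  | tick e s =>
    intro N f hN g e' s' _ _
    cases N <;> simp [Term.rename] at hN
    exact .tick e' s'
  | var x e s N0 e0 hx _ ih =>
    intro N f hN g e' s' he hs
    cases N <;> simp only [Term.rename, Term.var.injEq, reduceCtorEq] at hN
    rename_i y
    have h1 := he y (by simp [Term.fv])
    rw [← hN, hx] at h1
    generalize hc : e' (g y) = c at h1
    generalize hd : Clo.mk N0 e0 = d at h1
    cases h1 with
    | none => cases hd
    | mk N1 f1 g1 e1 e1' h1 =>
      cases hd
      exact .var _ _ _ _ _ hc (ih rfl h1 hs)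
  | app M B B' e s hB _ ih =>
    intro N f hN g e' s' he hs
    cases N <;> simp only [Term.rename, Term.app.injEq, reduceCtorEq] at hN
    rename_i N A
    obtain ⟨rfl, rfl⟩ := hN
    rw [renameBag_eq_map] at hB
    obtain ⟨A', hA, rfl⟩ := exists_perm_of_perm_map _ hB
    refine .app _ _ (A'.map (Term.rename g)) _ _ ?_ (ih rfl (fun i hi => he i ?_) (.cons ?_ hs))
    · rw [renameBag_eq_map]; exact hA.map _
    · simp [Term.fv, hi]
    · exact .map fun i hi => he i (by rw [fvBag_perm hA] at hi; simp [Term.fv, hi])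
  | lam k M B e eB s hk _ ih =>
    intro N f hN g e' s' he hs
    cases N <;> simp only [Term.rename, Term.lam.injEq, reduceCtorEq] at hN
    obtain ⟨rfl, rfl⟩ := hN
    cases hs with
    | cons h1 hs =>
      rename_i p _
      obtain ⟨B', eB'⟩ := p
      have hl : B.length = B'.length := List.Forall₂.length_eq h1
      exact .lam _ _ _ _ _ _ (by omega) (ih rfl (h1.extEnv hk he) hs)
  | lsub M L e s _ ih =>
    intro N f hN g e' s' he hs
    cases N <;> simp only [Term.rename, Term.lsub.injEq, reduceCtorEq] at hN
    rename_i N A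
    obtain ⟨rfl, rfl⟩ := hN
    refine .lsub _ _ _ _ (ih rfl ?_ hs)
    exact FrameEq.extEnv (B := [A.rename f]) (B' := [A.rename g])
      (.cons (.mk A f g e e' fun i hi => he i (by simp [Term.fv, hi])) .nil) rfl
      fun i hi => he i (Finset.mem_union_left _ hi)
  | esub k M B B' e s hB hk _ ih =>
    intro N f hN g e' s' he hs
    cases N <;> simp only [Term.rename, Term.esub.injEq, reduceCtorEq] at hN
    rename_i k N A
    obtain ⟨rfl, rfl, rfl⟩ := hN
    rw [renameBag_eq_map] at hB
    obtain ⟨A', hA, rfl⟩ := exists_perm_of_perm_map _ hB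
    refine .esub _ _ _ (A'.map (Term.rename g)) _ _ ?_ (by simpa using hk) (ih rfl ?_ hs)
    · rw [renameBag_eq_map]; exact hA.map _
    · refine FrameEq.extEnv (.map fun i hi => he i ?_) hk fun i hi => he i ?_
      · rw [fvBag_perm hA] at hi; simp [Term.fv, hi]
      · simp [Term.fv, hi]

theorem eval_rename_iff {M : Term} {f g : ℕ → ℕ} {e e' : ℕ → Clo} {s s' : Stack}
    (he : ∀ i ∈ M.fv, CloEq (e (f i)) (e' (g i))) (hs : StackEq s s') :
    Eval (M.rename f) e s ↔ Eval (M.rename g) e' s' :=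
  ⟨fun h => h.congr rfl he hs, fun h => h.congr rfl (fun i hi => (he i hi).symm) hs.symm⟩

theorem eval_env_iff {M : Term} {e e' : ℕ → Clo} {s s' : Stack}
    (he : ∀ i ∈ M.fv, CloEq (e i) (e' i)) (hs : StackEq s s') : Eval M e s ↔ Eval M e' s' := by
  have := eval_rename_iff (f := id) (g := id) he hs
  rwa [Term.rename_id] at this

theorem CloEq.shift (N : Term) (cs : List Clo) (e : ℕ → Clo) :
    CloEq (.mk (N.shift cs.length) (extEnv cs e)) (.mk N e) :=
  .rename _ fun i _ => by rw [extEnv_add]; exact .refl _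

theorem FrameEq.shift (B : Bag) (cs : List Clo) (e : ℕ → Clo) :
    FrameEq (shiftBag cs.length B, SharingPi.extEnv cs e) (B, e) := by
  rw [shiftBag, renameBag_eq_map]
  have := FrameEq.map (B := B) (f := fun i => i + cs.length) (g := id) (e := SharingPi.extEnv cs e) (e' := e)
    fun i _ => by rw [extEnv_add]; exact .refl _
  rwa [show B.map (Term.rename id) = B from
    (List.map_congr_left fun N _ => N.rename_id).trans (List.map_id' B)] at this

theorem eval_lsubs {M : Term} {B : Bag} {e : ℕ → Clo} {s : Stack} :
    Eval (M.lsubs B) e s ↔ Eval M (extEnv (closures B e) e) s := by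
  induction B generalizing M with
  | nil => rw [Term.lsubs, closures, List.map_nil, extEnv_nil]
  | cons N B ih =>
    rw [Term.lsubs, ih, eval_lsub]
    refine eval_env_iff (fun i _ => ?_) (.refl s)
    cases i with
    | zero =>
      have := CloEq.shift N (closures B e) e
      rwa [length_closures] at this
    | succ i =>
      rw [extEnv_one_succ]
      have : extEnv (closures (N :: B) e) e (i + 1) = extEnv (closures B e) e i := by
        simp [extEnv, closures]
      rw [this]
      exact .refl _

/-! ### The machine along reduction and precongruence -/

/-- The machine walks along the path to the head, pushing bags and extending the environment, and
then looks `x` up; head substitution merely anticipates the look-up. As `x` does not occur in the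
bags on the path, the environments `e₁` and `e₂` need not agree at `x`. The common source `N₀` with
the two renamings absorbs the shifts that accumulate along the path. -/
theorem eval_headSubst {M N₀ : Term} {x : ℕ} {f g : ℕ → ℕ} {e₁ e₂ e₀ : ℕ → Clo} {s₁ s₂ : Stack}
    (hM : M.Ok) (hx : M.head = .free x) (he : e₂ x = .mk (N₀.rename g) e₀)
    (h0 : ∀ i ∈ N₀.fv, CloEq (e₁ (f i)) (e₀ (g i)))
    (h12 : ∀ i ∈ M.fv, i ≠ x → CloEq (e₁ i) (e₂ i)) (hs : StackEq s₁ s₂) :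
    Eval (M.headSubst x (N₀.rename f)) e₁ s₁ ↔ Eval M e₂ s₂ := by
  induction M using Term.bagInduction generalizing x f e₁ e₂ s₁ s₂ with
  | var y =>
    simp only [Term.head, Head.free.injEq] at hx
    subst hx
    simp only [Term.headSubst, if_true, eval_var, he, Clo.mk.injEq]
    rw [eval_rename_iff h0 hs]
    constructor
    · exact fun h => ⟨_, _, ⟨rfl, rfl⟩, h⟩
    · rintro ⟨_, _, ⟨rfl, rfl⟩, h⟩; exact h
  | app M B ihM _ =>
    have hxB : x ∉ fvBag B := Finset.disjoint_left.1 hM.2.2 (Term.mem_fv_of_head hM.1 hx)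
    simp only [Term.headSubst, eval_app]
    refine exists_congr fun B' => and_congr_right fun hB => ?_
    refine ihM hM.1 hx he h0 (fun i hi => h12 i (by simp [Term.fv, hi])) (.cons (.of_env ?_) hs)
    intro i hi
    rw [fvBag_perm hB] at hi
    exact h12 i (by simp [Term.fv, hi]) fun h => hxB (h ▸ hi)
  | lsub M L ihM _ =>
    have h' : M.head = .free (x + 1) := Head.exit_eq_free (by simp) hx
    have hxL : x ∉ L.fv := Finset.disjoint_left.1 hM.2.2 (mem_down.2 (Term.mem_fv_of_head hM.1 h'))
    simp only [Term.headSubst, eval_lsub]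
    rw [Term.shift, Term.rename_rename]
    refine ihM hM.1 h' (by rw [extEnv_one_succ, he]) (fun i hi => ?_) (fun i hi hne => ?_) hs
    · simp only [Function.comp, extEnv_one_succ]; exact h0 i hi
    · cases i with
      | zero => exact .of_env fun i hi => h12 i (by simp [Term.fv, hi]) fun h => hxL (h ▸ hi)
      | succ i =>
        rw [extEnv_one_succ, extEnv_one_succ]
        exact h12 i (by simp [Term.fv, mem_down, hi]) (by simpa using hne)
  | esub k M B ihM _ =>
    have h' : M.head = .free (x + k) := by
      simp only [Term.head] at hx
      split_ifs at hx
      exact Head.exit_eq_free (by simp) hx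
    have hxB : x ∉ fvBag B :=
      Finset.disjoint_left.1 hM.2.2 (mem_down.2 (Term.mem_fv_of_head hM.1 h'))
    simp only [Term.headSubst, eval_esub]
    refine exists_congr fun B' => and_congr_right fun hB => and_congr_right fun hk => ?_
    have hk' : ∀ e, (closures B' e).length = k := fun e => by rw [length_closures, hk]
    rw [Term.shift, Term.rename_rename]
    refine ihM hM.1 h' (by rw [extEnv_add' (hk' _), he]) (fun i hi => ?_) (fun i hi hne => ?_) hs
    · simp only [Function.comp, extEnv_add' (hk' _)]; exact h0 i hi
    · by_cases hik : i < k
      · rw [extEnv_of_lt (by rw [hk']; exact hik), extEnv_of_lt (by rw [hk']; exact hik)]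
        simp only [closures, List.getElem_map]
        refine .of_env fun j hj => ?_
        have hj : j ∈ fvBag B := by
          rw [← fvBag_perm hB]; exact mem_fvBag_of_mem (List.getElem_mem _) hj
        exact h12 j (by simp [Term.fv, hj]) fun h => hxB (h ▸ hj)
      · obtain ⟨i, rfl⟩ := Nat.exists_eq_add_of_le' (not_lt.1 hik)
        rw [extEnv_add' (hk' _), extEnv_add' (hk' _)]
        exact h12 i (by simp [Term.fv, mem_down, hi]) (by simpa using hne)
  | share => exact hM.elim
  | _ => simp [Term.head] at hx

/-- Every rule rearranges the state without changing what the machine can do. The sum over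
permutations corresponds to the guessed ordering of the bag, and the failure rules lead from stuck
states to stuck states, the cause being a wrong length or a failing body. -/
theorem Red.eval_iff {M : Term} {E : Expr} (h : Red M E) (hM : M.Ok) :
    ∀ {e : ℕ → Clo} {s : Stack}, Eval M e s ↔ ∃ M' ∈ E, Eval M' e s := by
  induction h with
  | beta k M B =>
    intro e s
    simp [eval_app, eval_esub, eval_lam_cons]
  | exSub k M B hk _ _ =>
    intro e s
    simp only [eval_esub, List.mem_map, List.mem_permutations]
    constructor
    · rintro ⟨B', hB, -, h⟩
      exact ⟨_, ⟨B', hB, rfl⟩, eval_lsubs.2 h⟩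
    · rintro ⟨_, ⟨B', hB, rfl⟩, h⟩
      exact ⟨B', hB, hB.length_eq.trans hk, eval_lsubs.1 h⟩
  | linFetch M N hx =>
    intro e s
    simp only [List.mem_singleton, exists_eq_left, eval_lsub]
    have hok := Term.ok_headSubst (N := N.shift 1) hM.1 (Term.ok_shift.2 hM.2.1) hx
      fun i hi _ hiN => by
        obtain ⟨j, hj, rfl⟩ := Term.mem_fv_shift.1 hiN
        exact Finset.disjoint_left.1 hM.2.2 (mem_down.2 hi) hj
    have h0 : ∀ i ∈ (M.headSubst 0 (N.shift 1)).fv, i ≠ 0 := by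
      intro i hi
      rcases hok.2 i hi with h | h
      · exact h.2
      · obtain ⟨j, hj, rfl⟩ := Term.mem_fv_shift.1 h
        simp
    have h1 := eval_rename_iff (M := M.headSubst 0 (N.shift 1)) (f := fun i => i - 1) (g := id)
      (e := e) (e' := fun i => e (i - 1)) (fun _ _ => .refl _) (StackEq.refl s)
    rw [Term.rename_id] at h1
    rw [h1, Term.shift]
    refine (eval_headSubst (g := id) (e₀ := e) hM.1 hx ?_ (fun i _ => ?_) (fun i hi hi0 => ?_) (.refl s)).symm
    · rw [Term.rename_id, extEnv_one_zero]
    · exact .refl _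
    · obtain ⟨i, rfl⟩ := Nat.exists_eq_succ_of_ne_zero hi0
      rw [extEnv_one_succ]; exact .refl _
  | fail k M B hk =>
    intro e s
    simp only [eval_esub, List.mem_map]
    constructor
    · rintro ⟨B', hB, h, -⟩
      exact absurd (h.symm.trans hB.length_eq) hk
    · rintro ⟨_, ⟨_, _, rfl⟩, h⟩
      exact absurd h not_eval_fail
  | cons₁ S B =>
    intro e s
    simp [eval_app, not_eval_fail]
  | cons₂ k S B _ _ =>
    intro e s
    simp [eval_esub, not_eval_fail]
  | cons₃ S N _ =>
    intro e s
    simp [eval_lsub, not_eval_fail]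
  | ctxApp M E B _ ih =>
    intro e s
    simp only [eval_app, ih hM.1, List.mem_map]
    grind [eval_app]
  | ctxLsub M E N _ ih =>
    intro e s
    simp only [eval_lsub, ih hM.1, List.mem_map]
    grind [eval_lsub]
  | ctxShare => exact hM.elim
  | ctxEsub M E _ ih =>
    intro e s
    simp only [eval_esub, ih hM.1, List.mem_map]
    grind [eval_esub]

theorem perm_shiftBag_iff {k : ℕ} {B B' : Bag} :
    B'.Perm (shiftBag k B) ↔ ∃ A, A.Perm B ∧ B' = shiftBag k A := by
  simp only [shiftBag, renameBag_eq_map]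
  exact ⟨exists_perm_of_perm_map _, fun ⟨A, h1, h2⟩ => h2 ▸ h1.map _⟩

/-- The commutation laws exchange independent pushes and environment extensions. The resulting
states agree up to shifts inside closures and frames, which evaluation does not see. An empty
substitution extends the environment by nothing. -/
theorem Pre.eval_iff {M M' : Term} (h : Pre M M') (hM : M.Ok) :
    ∀ {e : ℕ → Clo} {s : Stack}, Eval M e s ↔ Eval M' e s := by
  have lsubApp : ∀ (M N : Term) (B : Bag) (e : ℕ → Clo) (s : Stack),
      Eval (.lsub (.app M (shiftBag 1 B)) N) e s ↔ Eval (.app (.lsub M N) B) e s := by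
    intro M N B e s
    simp only [eval_app, eval_lsub, perm_shiftBag_iff]
    constructor
    · rintro ⟨_, ⟨A, hA, rfl⟩, h⟩
      exact ⟨A, hA, (eval_env_iff (fun _ _ => .refl _)
        (.cons (FrameEq.shift A [.mk N e] e) (StackEq.refl s))).1 h⟩
    · rintro ⟨A, hA, h⟩
      exact ⟨_, ⟨A, hA, rfl⟩, (eval_env_iff (fun _ _ => .refl _)
        (.cons (FrameEq.shift A [.mk N e] e) (StackEq.refl s))).2 h⟩
  have esubApp : ∀ (k : ℕ) (M : Term) (A B : Bag) (e : ℕ → Clo) (s : Stack),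
      Eval (.esub k (.app M (shiftBag k A)) B) e s ↔ Eval (.app (.esub k M B) A) e s := by
    intro k M A B e s
    simp only [eval_app, eval_esub, perm_shiftBag_iff]
    have key : ∀ {A' B' : Bag}, B'.length = k →
        (Eval M (extEnv (closures B' e) e) ((shiftBag k A', extEnv (closures B' e) e) :: s) ↔
          Eval M (extEnv (closures B' e) e) ((A', e) :: s)) := by
      intro A' B' hk
      refine eval_env_iff (fun _ _ => .refl _) (.cons ?_ (StackEq.refl s))
      have := FrameEq.shift A' (closures B' e) e
      rwa [length_closures, hk] at this
    constructor
    · rintro ⟨B', hB, hk, _, ⟨A', hA, rfl⟩, h⟩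
      exact ⟨A', hA, B', hB, hk, (key hk).1 h⟩
    · rintro ⟨A', hA, B', hB, hk, h⟩
      exact ⟨B', hB, hk, _, ⟨A', hA, rfl⟩, (key hk).2 h⟩
  induction h with
  | refl => intro e s; exact Iff.rfl
  | trans _ _ _ h _ ih1 ih2 => intro e s; exact (ih1 hM).trans (ih2 (h.ok hM).1)
  | vacuous M =>
    intro e s
    rw [eval_esub]
    constructor
    · rintro ⟨B', hB, -, h⟩
      rwa [hB.eq_nil, closures, List.map_nil, extEnv_nil] at h
    · exact fun h => ⟨[], .refl _, rfl, by rwa [closures, List.map_nil, extEnv_nil]⟩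
  | appLsub M N B => intro e s; exact lsubApp M N B _ _
  | lsubApp M N B => intro e s; exact (lsubApp M N B _ _).symm
  | lsubLsub M N₁ N₂ =>
    intro e s
    simp only [eval_lsub]
    have h1 := eval_rename_iff (M := M) (f := id) (g := blockSwap 1 1)
      (e := extEnv [.mk (N₂.shift 1) (extEnv [.mk N₁ e] e)] (extEnv [.mk N₁ e] e))
      (e' := extEnv [.mk (N₁.shift 1) (extEnv [.mk N₂ e] e)] (extEnv [.mk N₂ e] e))
      (fun i _ => ?_) (StackEq.refl s)
    · rwa [Term.rename_id] at h1
    · match i with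
      | 0 => exact CloEq.shift N₂ [.mk N₁ e] e
      | 1 => exact (CloEq.shift N₁ [.mk N₂ e] e).symm
      | i + 2 =>
        have : blockSwap 1 1 (i + 2) = i + 2 := by simp [blockSwap]
        rw [this]
        simp only [id, extEnv_one_succ]
        exact .refl _
  | appEsub k M A B => intro e s; exact esubApp k M A B _ _
  | esubApp k M A B => intro e s; exact (esubApp k M A B _ _).symm
  | esubEsub k l M A B =>
    intro e s
    simp only [eval_esub, perm_shiftBag_iff]
    have key : ∀ {A' B' : Bag}, A'.length = l → B'.length = k →
        (Eval M (extEnv (closures (shiftBag k A') (extEnv (closures B' e) e))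
            (extEnv (closures B' e) e)) s ↔
          Eval (M.rename (blockSwap l k))
            (extEnv (closures (shiftBag l B') (extEnv (closures A' e) e))
            (extEnv (closures A' e) e)) s) := by
      intro A' B' hl hk
      have h1 := eval_rename_iff (M := M) (f := id) (g := blockSwap l k)
        (e := extEnv (closures (shiftBag k A') (extEnv (closures B' e) e))
            (extEnv (closures B' e) e))
        (e' := extEnv (closures (shiftBag l B') (extEnv (closures A' e) e))
            (extEnv (closures A' e) e))
        (fun i _ => ?_) (StackEq.refl s)
      · rwa [Term.rename_id] at h1
      have hA : ∀ d, (closures A' d).length = l := fun d => by rw [length_closures, hl]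
      have hB : ∀ d, (closures B' d).length = k := fun d => by rw [length_closures, hk]
      have hsA : ∀ d, (closures (shiftBag k A') d).length = l := fun d => by
        rw [length_closures, shiftBag, renameBag_eq_map, List.length_map, hl]
      have hsB : ∀ d, (closures (shiftBag l B') d).length = k := fun d => by
        rw [length_closures, shiftBag, renameBag_eq_map, List.length_map, hk]
      by_cases h1 : i < l
      · have : blockSwap l k i = i + k := by simp [blockSwap, h1]
        rw [this, extEnv_add' (hsB _), id, extEnv_of_lt (by rw [hsA]; exact h1),
          extEnv_of_lt (by rw [hA]; exact h1)]
        simp only [closures, shiftBag, renameBag_eq_map, List.getElem_map]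
        have := CloEq.shift A'[i] (closures B' e) e
        rwa [length_closures, hk] at this
      · obtain ⟨i, rfl⟩ := Nat.exists_eq_add_of_le' (not_lt.1 h1)
        by_cases h2 : i < k
        · have : blockSwap l k (i + l) = i := by
            simp only [blockSwap]; split_ifs <;> omega
          rw [this, id, extEnv_add' (hsA _), extEnv_of_lt (by rw [hB]; exact h2),
            extEnv_of_lt (by rw [hsB]; exact h2)]
          simp only [closures, shiftBag, renameBag_eq_map, List.getElem_map]
          have := CloEq.shift B'[i] (closures A' e) e
          rw [length_closures, hl] at this
          exact this.symm
        · obtain ⟨i, rfl⟩ := Nat.exists_eq_add_of_le' (not_lt.1 h2)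
          have : blockSwap l k (i + k + l) = i + l + k := by
            simp only [blockSwap]; split_ifs <;> omega
          rw [this, id, extEnv_add' (hsA _), extEnv_add' (hB _), extEnv_add' (hsB _),
            extEnv_add' (hA _)]
          exact .refl _
    have hlen : ∀ (k : ℕ) (B : Bag), (shiftBag k B).length = B.length := fun k B => by
      rw [shiftBag, renameBag_eq_map, List.length_map]
    constructor
    · rintro ⟨B', hB, hk, _, ⟨A', hA, rfl⟩, hl, h⟩
      rw [hlen] at hl
      exact ⟨A', hA, hl, _, ⟨B', hB, rfl⟩, by rw [hlen, hk], (key hl hk).1 h⟩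
    · rintro ⟨A', hA, hl, _, ⟨B', hB, rfl⟩, hk, h⟩
      rw [hlen] at hk
      exact ⟨B', hB, hk, _, ⟨A', hA, rfl⟩, by rw [hlen, hl], (key hl hk).2 h⟩
  | ctxApp M M' B _ ih =>
    intro e s
    simp only [eval_app, ih hM.1]
  | ctxLsub M M' N _ ih =>
    intro e s
    simp only [eval_lsub, ih hM.1]
  | ctxShare => exact hM.elim
  | ctxEsub M M' _ ih =>
    intro e s
    simp only [eval_esub, ih hM.1]

end SharingPi


namespace SharingPi

/-! ### Size -/

mutual
/-- The size of a term. -/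
def Term.size : Term → ℕ
  | .var _ => 1
  | .lam _ M => M.size + 1
  | .app M B => M.size + sizeBag B + 1
  | .lsub M N => M.size + N.size + 1
  | .fail _ => 1
  | .share _ M _ => M.size + 1
  | .esub _ M B => M.size + sizeBag B + 1
  | .tick => 1
/-- The size of a bag. -/
def sizeBag : List Term → ℕ
  | [] => 0
  | M :: B => M.size + 1 + sizeBag B
end

theorem sizeBag_eq_sum (B : Bag) : sizeBag B = (B.map fun N => N.size + 1).sum := by
  induction B with
  | nil => simp [sizeBag]
  | cons M B ih => simp [sizeBag, ih]

theorem sizeBag_perm {B B' : Bag} (h : B.Perm B') : sizeBag B = sizeBag B' := by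
  rw [sizeBag_eq_sum, sizeBag_eq_sum, (h.map _).sum_eq]

theorem Term.size_rename (f : ℕ → ℕ) (M : Term) : (M.rename f).size = M.size := by
  have bag : ∀ (f : ℕ → ℕ) (B : Bag), (∀ N ∈ B, (N.rename f).size = N.size) →
      sizeBag (renameBag f B) = sizeBag B := by
    intro f B h
    rw [renameBag_eq_map, sizeBag_eq_sum, sizeBag_eq_sum, List.map_map]
    exact congrArg List.sum (List.map_congr_left fun N hN => by simp [h N hN])
  induction M using Term.bagInduction generalizing f with
  | var | fail | tick => simp [Term.rename, Term.size]
  | lam k M ih | share k M x ih => simp [Term.rename, Term.size, ih]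
  | lsub M N ihM ihN => simp [Term.rename, Term.size, ihM, ihN]
  | app M B ihM ihB | esub k M B ihM ihB =>
    simp [Term.rename, Term.size, ihM, bag f B fun N hN => ihB N hN f]

theorem sizeBag_shift (k : ℕ) (B : Bag) : sizeBag (shiftBag k B) = sizeBag B := by
  rw [shiftBag, renameBag_eq_map, sizeBag_eq_sum, sizeBag_eq_sum, List.map_map]
  exact congrArg List.sum (List.map_congr_left fun N _ => by simp [Term.size_rename])

theorem Term.size_shift (k : ℕ) (M : Term) : (M.shift k).size = M.size := M.size_rename _

/-- The extra unit that `sizeBag` charges for each element pays for the substitution node created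
for it. Opening an explicit substitution therefore loses exactly the node of that substitution. -/
theorem Term.size_lsubs (M : Term) (B : Bag) : (M.lsubs B).size = M.size + sizeBag B := by
  induction B generalizing M with
  | nil => simp [Term.lsubs, sizeBag]
  | cons N B ih => simp only [Term.lsubs, ih, Term.size, sizeBag, Term.size_shift]; omega

/-- One variable node is exchanged for `N` and nothing is copied, so a fetch, which also removes the
substitution node, makes the term smaller. -/
theorem Term.size_headSubst {M N : Term} {x : ℕ} (hM : M.Ok) (h : M.head = .free x) :
    (M.headSubst x N).size + 1 = M.size + N.size := by
  induction M using Term.bagInduction generalizing x N with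
  | var y =>
    simp only [Term.head, Head.free.injEq] at h
    simp [Term.headSubst, h, Term.size]; omega
  | app M B ihM _ =>
    have := ihM (N := N) hM.1 h
    simp only [Term.headSubst, Term.size]; omega
  | lsub M L ihM _ =>
    have := ihM (N := N.shift 1) hM.1 (Head.exit_eq_free (by simp) h)
    rw [Term.size_shift] at this
    simp only [Term.headSubst, Term.size]; omega
  | esub k M B ihM _ =>
    have h' : M.head = .free (x + k) := by
      simp only [Term.head] at h
      split_ifs at h
      exact Head.exit_eq_free (by simp) h
    have := ihM (N := N.shift k) hM.1 h'
    rw [Term.size_shift] at this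
    simp only [Term.headSubst, Term.size]; omega
  | share => exact hM.elim
  | _ => simp [Term.head] at h

/-! ### Evaluation of successful terms -/

theorem eval_of_head_tick {M : Term} (hM : M.Ok) (h : M.head = .tick) (e : ℕ → Clo) (s : Stack) :
    Eval M e s := by
  induction M using Term.bagInduction generalizing e s with
  | tick => exact .tick e s
  | app M B ihM _ => exact .app _ _ B _ _ (.refl _) (ihM hM.1 h _ _)
  | lsub M L ihM _ => exact .lsub _ _ _ _ (ihM hM.1 (Head.exit_eq_tick (by simp) h) _ _)
  | esub k M B ihM _ =>
    simp only [Term.head] at h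
    split_ifs at h with hk
    exact .esub _ _ _ B _ _ (.refl _) hk.symm (ihM hM.1 (Head.exit_eq_tick (by simp) h) _ _)
  | share => exact hM.elim
  | _ => simp [Term.head] at h

theorem Expr.Pre.eval {E E' : Expr} (h : E.Pre E') (hE : ∀ M ∈ E, M.Ok) :
    (∀ M ∈ E', M.Ok) ∧
      ∀ {e s}, (∃ M ∈ E', Eval M e s) → ∃ M ∈ E, Eval M e s := by
  induction h with
  | refl => exact ⟨hE, id⟩
  | trans _ _ _ _ _ ih1 ih2 =>
    obtain ⟨h1, h2⟩ := ih1 hE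
    obtain ⟨h3, h4⟩ := ih2 h1
    exact ⟨h3, fun h => h2 (h4 h)⟩
  | perm E E' h => exact ⟨fun M hM => hE M (h.mem_iff.2 hM), fun ⟨M, h1, h2⟩ => ⟨M, h.mem_iff.2 h1, h2⟩⟩
  | ctx E₁ E₂ M M' h =>
    have hM : M.Ok := hE M (by simp)
    refine ⟨fun L hL => ?_, fun ⟨L, hL, h2⟩ => ?_⟩
    · rcases List.mem_append.1 hL with hL | hL
      · exact hE L (by simp [hL])
      · rcases List.mem_cons.1 hL with rfl | hL
        · exact (h.ok hM).1
        · exact hE L (by simp [hL])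
    · rcases List.mem_append.1 hL with hL | hL
      · exact ⟨L, by simp [hL], h2⟩
      · rcases List.mem_cons.1 hL with rfl | hL
        · exact ⟨M, by simp, (h.eval_iff hM).2 h2⟩
        · exact ⟨L, by simp [hL], h2⟩

theorem Expr.Red.eval {E E' : Expr} (h : E.Red E') (hE : ∀ M ∈ E, M.Ok) :
    (∀ M ∈ E', M.Ok) ∧
      ∀ {e s}, (∃ M ∈ E', Eval M e s) → ∃ M ∈ E, Eval M e s := by
  cases h with
  | ctx E₁ E₂ M E h =>
    have hM : M.Ok := hE M (by simp)
    refine ⟨fun L hL => ?_, fun ⟨L, hL, h2⟩ => ?_⟩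
    · simp only [List.append_assoc, List.mem_append] at hL
      rcases hL with hL | hL | hL
      · exact hE L (by simp [hL])
      · exact (h.ok hM L hL).1
      · exact hE L (by simp [hL])
    · simp only [List.append_assoc, List.mem_append] at hL
      rcases hL with hL | hL | hL
      · exact ⟨L, by simp [hL], h2⟩
      · exact ⟨M, by simp, (h.eval_iff hM).2 ⟨L, hL, h2⟩⟩
      · exact ⟨L, by simp [hL], h2⟩

theorem Expr.Success.eval {E : Expr} (h : E.Success) (hE : ∀ M ∈ E, M.Ok) (e : ℕ → Clo) :
    ∃ M ∈ E, Eval M e [] := by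
  obtain ⟨E', h, M, hM, ht⟩ := h
  induction h using Relation.ReflTransGen.head_induction_on with
  | refl => exact ⟨M, hM, eval_of_head_tick (hE M hM) ht e []⟩
  | head h _ ih =>
    obtain ⟨E₁, E₂, h1, h2, h3⟩ := h
    obtain ⟨h4, h5⟩ := h1.eval hE
    obtain ⟨h6, h7⟩ := h2.eval h4
    obtain ⟨h8, h9⟩ := h3.eval h6
    exact h5 (h7 (h9 (ih h8)))

/-! ### Success of terms that evaluate -/

/-- Abstractions below explicit linear substitutions. -/
inductive IsValue : Term → Prop
  | lam (k : ℕ) (M : Term) : IsValue (.lam k M)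
  | lsub (V N : Term) : IsValue V → IsValue (.lsub V N)

/-- The precongruence moves the bag inwards past the linear substitutions until it meets the
abstraction. The moves keep the size and β then removes a node. -/
theorem IsValue.app {V : Term} (h : IsValue V) (B : Bag) :
    ∃ M₁ M₂, Pre (.app V B) M₁ ∧ Red M₁ [M₂] ∧ M₂.size < (Term.app V B).size := by
  induction h generalizing B with
  | lam k M =>
    refine ⟨_, _, .refl _, .beta k M B, ?_⟩
    simp only [Term.size]; omega
  | lsub V N _ ih =>
    obtain ⟨M₁, M₂, h1, h2, h3⟩ := ih (shiftBag 1 B)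
    refine ⟨.lsub M₁ N, .lsub M₂ N, .trans _ _ _ (.lsubApp V N B) (.ctxLsub _ _ _ h1),
      .ctxLsub M₁ [M₂] N h2, ?_⟩
    simp only [Term.size, sizeBag_shift] at h3 ⊢; omega

theorem IsValue.not_eval_nil {V : Term} (h : IsValue V) (e : ℕ → Clo) : ¬ Eval V e [] := by
  induction h generalizing e with
  | lam => exact not_eval_lam_nil
  | lsub V N _ ih => rw [eval_lsub]; exact ih _

/-- One step towards `✓`, for a term with free variables. -/
theorem Eval.progress {M : Term} {e : ℕ → Clo} {s : Stack} (h : Eval M e s) (hM : M.Ok) :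
    M.head = .tick ∨ (∃ x, M.head = .free x) ∨
    (∃ M₁ E, Pre M M₁ ∧ Red M₁ E ∧ ∀ M' ∈ E, M'.size < M.size) ∨
    ∃ V, IsValue V ∧ Pre M V ∧ V.size ≤ M.size := by
  induction h with
  | tick => exact Or.inl rfl
  | var x => exact Or.inr (Or.inl ⟨x, rfl⟩)
  | app M B B' e s _ _ ih =>
    rcases ih hM.1 with h | h | ⟨M₁, E, h1, h2, h3⟩ | ⟨V, h1, h2, h3⟩
    · exact Or.inl h
    · exact Or.inr (Or.inl h)
    · refine Or.inr (Or.inr (Or.inl ⟨_, _, .ctxApp _ _ B h1, .ctxApp _ _ B h2, ?_⟩))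
      simp only [List.mem_map]
      rintro _ ⟨M', hM', rfl⟩
      have := h3 M' hM'
      simp only [Term.size]; omega
    · obtain ⟨M₁, M₂, h4, h5, h6⟩ := h1.app B
      refine Or.inr (Or.inr (Or.inl ⟨_, _, .trans _ _ _ (.ctxApp _ _ B h2) h4, h5, ?_⟩))
      simp only [List.mem_singleton, forall_eq]
      simp only [Term.size] at h6 ⊢; omega
  -- An abstraction does not step by itself; it is reported as a value, for an enclosing application
  -- to consume.
  | lam k M => exact Or.inr (Or.inr (Or.inr ⟨_, .lam k M, .refl _, le_rfl⟩))
  | lsub M N e s _ ih =>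
    rcases ih hM.1 with h | ⟨x, h⟩ | ⟨M₁, E, h1, h2, h3⟩ | ⟨V, h1, h2, h3⟩
    · exact Or.inl (by rw [Term.head, h]; rfl)
    · cases x with
      | zero =>
        refine Or.inr (Or.inr (Or.inl ⟨_, _, .refl _, .linFetch M N h, ?_⟩))
        simp only [List.mem_singleton, forall_eq]
        have := Term.size_headSubst (N := N.shift 1) hM.1 h
        rw [Term.size_shift] at this
        rw [Term.size_rename, Term.size]; omega
      | succ x => exact Or.inr (Or.inl ⟨x, by rw [Term.head, h]; rfl⟩)
    · refine Or.inr (Or.inr (Or.inl ⟨_, _, .ctxLsub _ _ N h1, .ctxLsub _ _ N h2, ?_⟩))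
      simp only [List.mem_map]
      rintro _ ⟨M', hM', rfl⟩
      have := h3 M' hM'
      simp only [Term.size]; omega
    · refine Or.inr (Or.inr (Or.inr ⟨_, .lsub V N h1, .ctxLsub _ _ N h2, ?_⟩))
      simp only [Term.size]; omega
  | esub k M B B' e s hB hk hev ih =>
    have hk' : B.length = k := hB.length_eq.symm.trans hk
    cases k with
    | succ k =>
      -- The body is not a failure term, because it evaluates; so the bag can be opened.
      refine Or.inr (Or.inr (Or.inl ⟨_, _, .refl _, .exSub (k + 1) M B hk' (by omega) ?_, ?_⟩))
      · rintro S rfl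
        exact not_eval_fail hev
      · simp only [List.mem_map, List.mem_permutations]
        rintro _ ⟨B'', hB, rfl⟩
        rw [Term.size_lsubs, Term.size, sizeBag_perm hB]; omega
    | zero =>
      -- The opening rule needs at least one shared variable. With none, the whole construct is
      -- discarded by the precongruence, and progress is that of `M`.
      obtain rfl : B = [] := List.length_eq_zero_iff.1 hk'
      have hsize : (Term.esub 0 M []).size = M.size + 1 := by simp [Term.size, sizeBag]
      rcases ih hM.1 with h | ⟨x, h⟩ | ⟨M₁, E, h1, h2, h3⟩ | ⟨V, h1, h2, h3⟩
      · exact Or.inl (by rw [Term.head, h]; rfl)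
      · exact Or.inr (Or.inl ⟨x, by rw [Term.head, h]; simp [Head.exit]⟩)
      · exact Or.inr (Or.inr (Or.inl ⟨_, _, .trans _ _ _ (.vacuous M) h1, h2,
          fun M' hM' => by have := h3 M' hM'; omega⟩))
      · exact Or.inr (Or.inr (Or.inr ⟨V, h1, .trans _ _ _ (.vacuous M) h2, by omega⟩))

/-- Induction on the size. Each step leaves a summand that still evaluates, while the other summands
are carried along in `E₁` and `E₂`. Closedness excludes a free variable as head, and a value does
not evaluate on the empty stack, so the process can only end with head ✓. -/
theorem Eval.success {M : Term} {e : ℕ → Clo} (h : Eval M e []) (hM : M.Ok) (hcl : M.fv = ∅)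
    (E₁ E₂ : Expr) : Expr.Success (E₁ ++ M :: E₂) := by
  induction hn : M.size using Nat.strong_induction_on generalizing M E₁ E₂ with
  | _ n ih =>
    rcases h.progress hM with ht | ⟨x, hx⟩ | ⟨M₁, E, h1, h2, h3⟩ | ⟨V, h1, h2, -⟩
    · exact ⟨_, .refl, M, by simp, ht⟩
    · have := Term.mem_fv_of_head hM hx
      simp [hcl] at this
    · obtain ⟨ok1, fv1⟩ := h1.ok hM
      obtain ⟨M', hM', hev⟩ := (h2.eval_iff ok1).1 ((h1.eval_iff hM).1 h)
      obtain ⟨ok2, fv2⟩ := h2.ok ok1 M' hM'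
      obtain ⟨a, b, rfl⟩ := List.append_of_mem hM'
      have step : Expr.Step (E₁ ++ M :: E₂) ((E₁ ++ a) ++ M' :: (b ++ E₂)) :=
        ⟨_, _, .ctx E₁ E₂ M M₁ h1, .ctx E₁ E₂ M₁ _ h2, by
          have : E₁ ++ (a ++ M' :: b) ++ E₂ = (E₁ ++ a) ++ M' :: (b ++ E₂) := by simp
          rw [this]; exact .refl _⟩
      obtain ⟨E', h4, h5⟩ := ih M'.size (hn ▸ h3 M' hM') hev ok2
        (Finset.subset_empty.1 (hcl ▸ fv2.trans fv1)) (E₁ ++ a) (b ++ E₂) rfl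
      exact ⟨E', .head step h4, h5⟩
    · exact absurd ((h2.eval_iff hM).1 h) (h1.not_eval_nil e)

/-! ### Closed proper terms are affine -/

theorem Term.mem_fv_iff_occ {M : Term} {x : ℕ} : x ∈ M.fv ↔ M.occ x ≠ 0 := by
  have bag : ∀ (x : ℕ) (B : Bag), (∀ N ∈ B, ∀ {x : ℕ}, x ∈ N.fv ↔ N.occ x ≠ 0) →
      (x ∈ fvBag B ↔ occBag x B ≠ 0) := by
    intro x B h
    induction B with
    | nil => simp [fvBag, occBag]
    | cons M B ih =>
      simp only [fvBag, occBag, Finset.mem_union, h M (by simp), ih fun N hN => h N (by simp [hN])]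
      omega
  induction M using Term.bagInduction generalizing x with
  | var y => simp [Term.fv, Term.occ]
  | fail S => simp [Term.fv, Term.occ]
  | tick => simp [Term.fv, Term.occ]
  | lam k M ih => simp [Term.fv, Term.occ, mem_down, ih]
  | lsub M N ihM ihN =>
    simp only [Term.fv, Term.occ, mem_down, Finset.mem_union, ihM, ihN]; omega
  | share k M y ih =>
    simp only [Term.fv, Term.occ, mem_down, Finset.mem_union, Finset.mem_singleton, ih]
    split_ifs <;> simp_all
  | app M B ihM ihB =>
    simp only [Term.fv, Term.occ, Finset.mem_union, ihM, bag x B ihB]; omega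
  | esub k M B ihM ihB =>
    simp only [Term.fv, Term.occ, Finset.mem_union, mem_down, ihM, bag x B ihB]; omega

theorem mem_fvBag_iff_occ {B : Bag} {x : ℕ} : x ∈ fvBag B ↔ occBag x B ≠ 0 := by
  induction B with
  | nil => simp [fvBag, occBag]
  | cons M B ih => simp only [fvBag, occBag, Finset.mem_union, Term.mem_fv_iff_occ, ih]; omega

/-- The hypotheses pass below a binder because the bound variables occur exactly once and are not
sharing variables. A sharing construct would share a variable that is free at that place, and this
is excluded all the way down. -/
theorem Term.ok_of_bindersOk {M : Term} (h : M.BindersOk) (hocc : ∀ x, M.occ x ≤ 1)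
    (hsh : ∀ x, ¬ M.Shares x) : M.Ok := by
  have bag : ∀ (B : Bag), BindersOkBag B → (∀ x, occBag x B ≤ 1) → (∀ x, ¬ SharesBag x B) →
      (∀ N ∈ B, N.BindersOk → (∀ x, N.occ x ≤ 1) → (∀ x, ¬ N.Shares x) → N.Ok) → OkBag B := by
    intro B
    induction B with
    | nil => simp [OkBag]
    | cons M B ih =>
      simp only [BindersOkBag, occBag, SharesBag, OkBag, Finset.disjoint_left, Term.mem_fv_iff_occ,
        mem_fvBag_iff_occ]
      intro h hocc hsh hN
      refine ⟨hN M (by simp) h.1 (fun x => by have := hocc x; omega) fun x => by have := hsh x; tauto,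
        ih h.2 (fun x => by have := hocc x; omega) (fun x => by have := hsh x; tauto)
          fun N hN' => hN N (by simp [hN']), fun x => by have := hocc x; omega⟩
  have occ_of : ∀ {k : ℕ} {M : Term}, M.BindsLinearly k → (∀ x, M.occ (x + k) ≤ 1) →
      ∀ x, M.occ x ≤ 1 := by
    intro k M hb h x
    by_cases hx : x < k
    · exact (hb x hx).1.le
    · obtain ⟨x, rfl⟩ := Nat.exists_eq_add_of_le' (not_lt.1 hx); exact h x
  have shares_of : ∀ {k : ℕ} {M : Term}, M.BindsLinearly k → (∀ x, ¬ M.Shares (x + k)) →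
      ∀ x, ¬ M.Shares x := by
    intro k M hb h x
    by_cases hx : x < k
    · exact (hb x hx).2
    · obtain ⟨x, rfl⟩ := Nat.exists_eq_add_of_le' (not_lt.1 hx); exact h x
  induction M using Term.bagInduction with
  | var | fail | tick => simp [Term.Ok]
  | lam k M ih => exact ih h.2 (occ_of h.1 hocc) (shares_of h.1 hsh)
  | share k M y => exact hsh y (Or.inr rfl)
  | lsub M N ihM ihN =>
    simp only [Term.occ, Term.Shares] at hocc hsh
    refine ⟨ihM h.2.1 (occ_of h.1 fun x => by have := hocc x; omega)
      (shares_of h.1 fun x => by have := hsh x; tauto),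
      ihN h.2.2 (fun x => by have := hocc x; omega) fun x => by have := hsh x; tauto, ?_⟩
    simp only [Finset.disjoint_left, mem_down, Term.mem_fv_iff_occ]
    exact fun x => by have := hocc x; omega
  | app M B ihM ihB =>
    simp only [Term.occ, Term.Shares] at hocc hsh
    refine ⟨ihM h.1 (fun x => by have := hocc x; omega) fun x => by have := hsh x; tauto,
      bag B h.2 (fun x => by have := hocc x; omega) (fun x => by have := hsh x; tauto) ihB, ?_⟩
    simp only [Finset.disjoint_left, mem_fvBag_iff_occ, Term.mem_fv_iff_occ]
    exact fun x => by have := hocc x; omega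
  | esub k M B ihM ihB =>
    simp only [Term.occ, Term.Shares] at hocc hsh
    refine ⟨ihM h.2.1 (occ_of h.1 fun x => by have := hocc x; omega)
      (shares_of h.1 fun x => by have := hsh x; tauto),
      bag B h.2.2 (fun x => by have := hocc x; omega) (fun x => by have := hsh x; tauto) ihB, ?_⟩
    simp only [Finset.disjoint_left, mem_down, mem_fvBag_iff_occ, Term.mem_fv_iff_occ]
    exact fun x => by have := hocc x; omega

theorem Term.mem_fv_of_shares {M : Term} {x : ℕ} (h : M.Shares x) : x ∈ M.fv := by
  have bag : ∀ (x : ℕ) (B : Bag), (∀ N ∈ B, ∀ {x : ℕ}, N.Shares x → x ∈ N.fv) →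
      SharesBag x B → x ∈ fvBag B := by
    intro x B h
    induction B with
    | nil => simp [SharesBag]
    | cons M B ih =>
      simp only [fvBag, SharesBag, Finset.mem_union]
      exact Or.imp (h M (by simp)) (ih fun N hN => h N (by simp [hN]))
  induction M using Term.bagInduction generalizing x with
  | var | fail | tick => simp [Term.Shares] at h
  | lam k M ih => exact mem_down.2 (ih h)
  | share k M y ih =>
    simp only [Term.fv, Finset.mem_union, mem_down, Finset.mem_singleton]
    exact h.imp (fun h => ih h) id
  | lsub M N ihM ihN =>
    simp only [Term.fv, Finset.mem_union, mem_down]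
    exact h.imp (fun h => ihM h) fun h => ihN h
  | app M B ihM ihB =>
    simp only [Term.fv, Finset.mem_union]
    exact h.imp (fun h => ihM h) (bag x B ihB)
  | esub k M B ihM ihB =>
    simp only [Term.fv, Finset.mem_union, mem_down]
    exact h.imp (fun h => ihM h) (bag x B ihB)

theorem Term.Proper.ok {M : Term} (h : M.Proper) (hcl : M.fv = ∅) : M.Ok :=
  Term.ok_of_bindersOk h.1 h.2 fun x hx => by simpa [hcl] using Term.mem_fv_of_shares hx

end SharingPi


namespace SharingPi

/-! ### Names used by translated terms -/

/-- Binders are linear, and the free names, which satisfy `A`, are used by one component each. -/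
def Proc.Affine (P : Proc) (A : ℕ → Prop) : Prop :=
  P.Lin ∧ (∀ n, P.cnt n ≤ 1) ∧ ∀ n, P.cnt n ≠ 0 → A n

namespace Proc.Affine

variable {P Q : Proc} {A B C : ℕ → Prop} {x y : ℕ}

theorem cnt_eq_zero (h : P.Affine A) {n : ℕ} (hn : ¬ A n) : P.cnt n = 0 := by
  by_contra hc
  exact hn (h.2.2 n hc)

theorem mono (h : P.Affine A) (hA : ∀ n, A n → B n) : P.Affine B :=
  ⟨h.1, h.2.1, fun n hn => hA n (h.2.2 n hn)⟩

theorem nil : Proc.nil.Affine A := ⟨trivial, fun _ => Nat.zero_le _, fun _ h => absurd rfl h⟩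

theorem tick : Proc.tick.Affine A := ⟨trivial, fun _ => Nat.zero_le _, fun _ h => absurd rfl h⟩

theorem fwd (h : x ≠ y) (hx : A x) (hy : A y) : (Proc.fwd x y).Affine A := by
  refine ⟨trivial, fun n => ?_, fun n hn => ?_⟩
  · simp only [Proc.cnt]; split_ifs <;> omega
  · simp only [Proc.cnt] at hn; split_ifs at hn <;> simp_all

theorem noneBar (hx : A x) : (Proc.noneBar x).Affine A := by
  refine ⟨trivial, fun n => ?_, fun n hn => ?_⟩
  · simp only [Proc.cnt]; split_ifs <;> omega
  · simp only [Proc.cnt] at hn; split_ifs at hn <;> simp_all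

theorem closeBar (hx : A x) : (Proc.closeBar x).Affine A := by
  refine ⟨trivial, fun n => ?_, fun n hn => ?_⟩
  · simp only [Proc.cnt]; split_ifs <;> omega
  · simp only [Proc.cnt] at hn; split_ifs at hn <;> simp_all

theorem noneAll {W : Finset ℕ} (h : ∀ n ∈ W, A n) : (Proc.noneAll W).Affine A := by
  refine ⟨Proc.lin_noneList _, fun n => ?_, fun n hn => h n ?_⟩
  · rw [Proc.cnt_noneAll]; split_ifs <;> omega
  · rw [Proc.cnt_noneAll] at hn; simpa using hn

theorem close (h : P.Affine A) (hx : A x) : (Proc.close x P).Affine A := by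
  refine ⟨h.1, fun n => ?_, fun n hn => ?_⟩
  · have := h.2.1 n
    simp only [Proc.cnt]; split_ifs <;> omega
  · by_cases hnx : n = x
    · exact hnx ▸ hx
    · exact h.2.2 n (by simpa [Proc.cnt, hnx] using hn)

theorem someBar (h : P.Affine A) (hx : A x) : (Proc.someBar x P).Affine A := by
  refine ⟨h.1, fun n => ?_, fun n hn => ?_⟩
  · have := h.2.1 n
    simp only [Proc.cnt]; split_ifs <;> omega
  · by_cases hnx : n = x
    · exact hnx ▸ hx
    · exact h.2.2 n (by simpa [Proc.cnt, hnx] using hn)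

theorem some (h : P.Affine A) (hx : A x) {W : Finset ℕ} (hW : ∀ n ∈ W, A n) :
    (Proc.some x W P).Affine A := by
  refine ⟨h.1, fun n => ?_, fun n hn => ?_⟩
  · have := h.2.1 n
    simp only [Proc.cnt]; split_ifs <;> omega
  · by_cases hnx : n = x ∨ n ∈ W
    · exact hnx.elim (fun h => h ▸ hx) (hW n)
    · exact h.2.2 n (by simpa [Proc.cnt, hnx] using hn)

theorem out (h : P.Affine A) (hx : B x) (hA : ∀ n, A (n + 1) → B n) : (Proc.out x P).Affine B := by
  refine ⟨⟨h.2.1 0, h.1⟩, fun n => ?_, fun n hn => ?_⟩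
  · have := h.2.1 (n + 1)
    simp only [Proc.cnt]; split_ifs <;> omega
  · by_cases hnx : n = x
    · exact hnx ▸ hx
    · exact hA n (h.2.2 _ (by simpa [Proc.cnt, hnx] using hn))

theorem inp (h : P.Affine A) (hx : B x) (hA : ∀ n, A (n + 1) → B n) : (Proc.inp x P).Affine B :=
  out h hx hA

theorem par (h : P.Affine A) (h' : Q.Affine B) (hd : ∀ n, A n → ¬ B n) (hA : ∀ n, A n → C n)
    (hB : ∀ n, B n → C n) : (Proc.par P Q).Affine C := by
  refine ⟨⟨h.1, h'.1⟩, fun n => ?_, fun n hn => ?_⟩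
  · by_cases hn : P.cnt n = 0
    · simpa [Proc.cnt, hn] using h'.2.1 n
    · simpa [Proc.cnt, h'.cnt_eq_zero (hd n (h.2.2 n hn))] using h.2.1 n
  · by_cases hP : P.cnt n = 0
    · exact hB n (h'.2.2 n (by simpa [Proc.cnt, hP] using hn))
    · exact hA n (h.2.2 n hP)

theorem nuPar (h : P.Affine A) (h' : Q.Affine B) (hd : ∀ n, A (n + 1) → ¬ B (n + 1))
    (hA : ∀ n, A (n + 1) → C n) (hB : ∀ n, B (n + 1) → C n) : (Proc.nu (.par P Q)).Affine C := by
  refine ⟨⟨add_le_add (h.2.1 0) (h'.2.1 0), h.1, h'.1⟩, fun n => ?_, fun n hn => ?_⟩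
  · by_cases hn : P.cnt (n + 1) = 0
    · simpa [Proc.cnt, hn] using h'.2.1 (n + 1)
    · simpa [Proc.cnt, h'.cnt_eq_zero (hd n (h.2.2 _ hn))] using h.2.1 (n + 1)
  · by_cases hP : P.cnt (n + 1) = 0
    · exact hB n (h'.2.2 _ (by simpa [Proc.cnt, hP] using hn))
    · exact hA n (h.2.2 _ hP)

theorem bigChoice : ∀ {l : List Proc}, (∀ P ∈ l, P.Affine A) → (Proc.bigChoice l).Affine A
  | [], _ => nil
  | [P], h => h P (by simp)
  | P :: Q :: l, h => by
    have hP := h P (by simp)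
    have hl := bigChoice (l := Q :: l) fun R hR => h R (by simp_all)
    refine ⟨⟨hP.1, hl.1⟩, fun n => max_le (hP.2.1 n) (hl.2.1 n), fun n hn => ?_⟩
    by_cases h0 : P.cnt n = 0
    · exact hl.2.2 n (by simpa [Proc.bigChoice, Proc.cnt, h0] using hn)
    · exact hP.2.2 n h0

end Proc.Affine

/-- A translation with free variables `V` uses the names for them and the name `u` linearly. -/
def Sem.Affine (F : Sem) (V : Finset ℕ) : Prop :=
  ∀ (ρ : ℕ → ℕ) (u : ℕ), Set.InjOn ρ V → (∀ z ∈ V, ρ z ≠ u) →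
    (F ρ u).Affine fun n => n = u ∨ ∃ z ∈ V, n = ρ z

/-- For `i ≤ j < i + r` the name of the variable `j` has not been received yet and `ρ j` is
meaningless, so these indices are exempt from every condition. A round crosses two name binders,
which explains the shifts by 2, and gives the variable `i` the name 0 just received. -/
theorem Sem.Affine.encShareAux {F : Sem} {V : Finset ℕ} (hF : F.Affine V) (r i : ℕ) (ρ : ℕ → ℕ)
    (x u : ℕ) (hρ : ∀ j ∈ V, ∀ j' ∈ V, ¬ (i ≤ j ∧ j < i + r) → ¬ (i ≤ j' ∧ j' < i + r) →
      ρ j = ρ j' → j = j') (hx : ∀ j ∈ V, ¬ (i ≤ j ∧ j < i + r) → ρ j ≠ x)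
    (hu : ∀ j ∈ V, ¬ (i ≤ j ∧ j < i + r) → ρ j ≠ u) (hxu : x ≠ u) :
    (encShareAux F V r i ρ x u).Affine
      fun n => n = x ∨ n = u ∨ ∃ j ∈ V, ¬ (i ≤ j ∧ j < i + r) ∧ n = ρ j := by
  induction r generalizing i ρ x u with
  | zero =>
    have h1 := hF (fun j => ρ j + 1) (u + 1) (fun j hj j' hj' h => hρ j hj j' hj' (by omega)
      (by omega) (by simpa using h)) fun z hz => by simpa using hu z hz (by omega)
    have h2 : (Proc.some 0 (insert (u + 1) (V.image fun j => ρ j + 1))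
        (.close 0 (F (fun j => ρ j + 1) (u + 1)))).Affine
        fun n => n = 0 ∨ n = u + 1 ∨ ∃ j ∈ V, n = ρ j + 1 :=
      .some (.close (h1.mono fun n h => .inr h) (.inl rfl)) (.inl rfl) fun n hn => by
        simp only [Finset.mem_insert, Finset.mem_image] at hn
        grind
    refine .someBar (.out (A := fun n => n = 0 ∨ n = x + 1 ∨ n = u + 1 ∨ ∃ j ∈ V, n = ρ j + 1)
      (.par h2 (.noneBar (A := fun n => n = x + 1) rfl) ?_ ?_ ?_) (.inl rfl) ?_) (.inl rfl)
    · rintro n (rfl | rfl | ⟨j, hj, rfl⟩) h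
      · simp at h
      · exact hxu (by simpa using h.symm)
      · exact hx j hj (by omega) (by simpa using h)
    · grind
    · grind
    · rintro n (h | h | h | ⟨j, hj, h⟩)
      · simp at h
      · exact .inl (by simpa using h)
      · exact .inr (.inl (by simpa using h))
      · exact .inr (.inr ⟨j, hj, by omega, by simpa using h⟩)
  | succ r ih =>
    have h1 := ih (i + 1) (fun j => if j = i then 0 else ρ j + 2) (x + 2) (u + 2)
      (fun j hj j' hj' hi hi' h => by
        split_ifs at h
        · omega
        · exact hρ j hj j' hj' (by omega) (by omega) (by simpa using h))
      (fun j hj hi => by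
        split_ifs
        · omega
        · simpa using hx j hj (by omega))
      (fun j hj hi => by
        split_ifs
        · omega
        · simpa using hu j hj (by omega)) (by omega)
    have h2 : (Proc.someBar (x + 1) (.some (x + 1) (insert (u + 1)
        ((V.filter (fun j => ¬ (i ≤ j ∧ j < i + (r + 1)))).image (fun j => ρ j + 1)))
        (.inp (x + 1) (SharingPi.encShareAux F V r (i + 1) (fun j => if j = i then 0 else ρ j + 2)
          (x + 2) (u + 2))))).Affine
        fun n => n = x + 1 ∨ n = u + 1 ∨ ∃ j ∈ V, ¬ (i ≤ j ∧ j < i + (r + 1)) ∧ n = ρ j + 1 := by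
      refine .someBar (.some (.inp h1 (.inl rfl) ?_) (.inl rfl) ?_) (.inl rfl)
      · rintro n (h | h | ⟨j, hj, hi, h⟩)
        · exact .inl (by simpa using h)
        · exact .inr (.inl (by simpa using h))
        · split_ifs at h
          exact .inr (.inr ⟨j, hj, by omega, by simpa using h⟩)
      · intro n hn
        simp only [Finset.mem_insert, Finset.mem_image, Finset.mem_filter] at hn
        rcases hn with h | ⟨j, ⟨hj, hi⟩, h⟩
        · exact .inr (.inl h)
        · exact .inr (.inr ⟨j, hj, hi, h.symm⟩)
    have h3 : (Proc.some 0 ∅ (.close 0 .nil)).Affine fun n => n = 0 :=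
      .some (A := fun n => n = 0) (W := ∅) (.close .nil rfl) rfl (by simp)
    refine .someBar (.out (.par (C := fun n => n = 0 ∨ n = x + 1 ∨ n = u + 1 ∨
      ∃ j ∈ V, ¬ (i ≤ j ∧ j < i + (r + 1)) ∧ n = ρ j + 1) h3 h2 ?_ ?_ ?_) (.inl rfl) ?_) (.inl rfl)
    · grind
    · grind
    · grind
    · rintro n (h | h | h | ⟨j, hj, hi, h⟩)
      · simp at h
      · exact .inl (by simpa using h)
      · exact .inr (.inl (by simpa using h))
      · exact .inr (.inr ⟨j, hj, by omega, by simpa using h⟩)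

theorem Sem.Affine.encShare {F : Sem} {V : Finset ℕ} (hF : F.Affine V) {k : ℕ} {ρ : ℕ → ℕ}
    {x u : ℕ} (hρ : Set.InjOn ρ (down k V)) (hx : ∀ j ∈ down k V, ρ j ≠ x)
    (hu : ∀ j ∈ down k V, ρ j ≠ u) (hxu : x ≠ u) :
    (encShare F V k ρ x u).Affine fun n => n = x ∨ n = u ∨ ∃ j ∈ down k V, n = ρ j := by
  have key : ∀ j ∈ V, ¬ (0 ≤ j ∧ j < 0 + k) → j - k ∈ down k V := fun j hj hk =>
    mem_down.2 (by rwa [Nat.sub_add_cancel (by omega)])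
  refine (hF.encShareAux k 0 _ x u (fun j hj j' hj' hk hk' h => ?_) (fun j hj hk => hx _ (key j hj hk))
    (fun j hj hk => hu _ (key j hj hk)) hxu).mono ?_
  · have := hρ (key j hj hk) (key j' hj' hk') h
    omega
  · rintro n (h | h | ⟨j, hj, hk, h⟩)
    · exact .inl h
    · exact .inr (.inl h)
    · exact .inr (.inr ⟨_, key j hj hk, h⟩)

theorem mem_fvSem {l : List (Finset ℕ × Sem)} {i : ℕ} : i ∈ fvSem l ↔ ∃ p ∈ l, i ∈ p.1 := by
  induction l with
  | nil => simp [fvSem]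
  | cons p l ih => simp [fvSem, ih]

theorem Sem.affine_encBag {l : List (Finset ℕ × Sem)} (hl : ∀ p ∈ l, Sem.Affine p.2 p.1)
    (hd : l.Pairwise fun p q => Disjoint p.1 q.1) {ρ : ℕ → ℕ} {x : ℕ}
    (hρ : Set.InjOn ρ (fvSem l)) (hx : ∀ j ∈ fvSem l, ρ j ≠ x) :
    (encBag l ρ x).Affine fun n => n = x ∨ ∃ j ∈ fvSem l, n = ρ j := by
  induction l generalizing ρ x with
  | nil =>
    refine .some (.inp (A := fun n => n = 0 ∨ n = x + 1) (.par (.someBar (A := fun n => n = 0)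
      (.closeBar rfl) rfl) (.some (A := fun n => n = x + 1) (.noneBar rfl) rfl (by simp))
      (by omega) (by omega) (by omega)) (.inl rfl) (by omega)) (.inl rfl) (by simp)
  | cons p l ih =>
    have hp : ∀ j ∈ p.1, j ∈ fvSem (p :: l) := fun j hj => Finset.mem_union_left _ hj
    have hl' : ∀ j ∈ fvSem l, j ∈ fvSem (p :: l) := fun j hj => Finset.mem_union_right _ hj
    rw [List.pairwise_cons] at hd
    have h1 := ih (fun q hq => hl q (by simp [hq])) hd.2 (ρ := fun j => ρ j + 2) (x := x + 2)
      (fun j hj j' hj' h => hρ (hl' j hj) (hl' j' hj') (by simpa using h))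
      (fun j hj => by simpa using hx j (hl' j hj))
    have h2 := hl p (by simp) (fun j => ρ j + 2) 0
      (fun j hj j' hj' h => hρ (hp j hj) (hp j' hj') (by simpa using h)) (by simp)
    have h3 : (Proc.par (encBag l (fun j => ρ j + 2) (x + 2)) (.noneBar 1)).Affine
        fun n => n = 1 ∨ n = x + 2 ∨ ∃ j ∈ fvSem l, n = ρ j + 2 :=
      .par h1 (.noneBar (A := fun n => n = 1) rfl) (by grind) (by grind) (by grind)
    have h4 : (Proc.some 0 (p.1.image fun j => ρ j + 2) (p.2 (fun j => ρ j + 2) 0)).Affine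
        fun n => n = 0 ∨ ∃ j ∈ p.1, n = ρ j + 2 :=
      .some h2 (.inl rfl) (by simp only [Finset.mem_image]; grind)
    refine .some (.inp (A := fun n => n = 0 ∨ n = x + 1 ∨ ∃ j ∈ fvSem (p :: l), n = ρ j + 1)
      (.some (.someBar (.out (.par (C := fun n => n = 0 ∨ n = 1 ∨ n = x + 2 ∨
        ∃ j ∈ fvSem (p :: l), n = ρ j + 2) h4 h3 ?_ ?_ ?_) (.inr (.inl rfl)) ?_) (.inr (.inl rfl)))
        (.inr (.inl rfl)) ?_) (.inl rfl) ?_) (.inl rfl) ?_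
    · rintro n (rfl | ⟨j, hj, rfl⟩) (h | h | ⟨j', hj', h⟩)
      · simp at h
      · simp at h
      · simp at h
      · simp at h
      · exact hx j (hp j hj) (by simpa using h)
      · have := hρ (hp j hj) (hl' j' hj') (by simpa using h)
        obtain ⟨q, hq, hjq⟩ := mem_fvSem.1 hj'
        exact Finset.disjoint_left.1 (hd.1 q hq) hj (this ▸ hjq)
    · grind
    · grind
    · grind
    · simp only [Finset.mem_insert, Finset.mem_image]; grind
    · grind
    · simp only [Finset.mem_image]; grind

theorem semBag_eq_map (B : Bag) : semBag B = B.map fun M => (M.fv, M.enc) := by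
  induction B with
  | nil => rfl
  | cons M B ih => simp [semBag, ih]

theorem fvSem_semBag (B : Bag) : fvSem (semBag B) = fvBag B := by
  induction B with
  | nil => rfl
  | cons M B ih => simp [semBag, fvSem, fvBag, ih]

theorem mem_permutations_semBag {B : Bag} {l : List (Finset ℕ × Sem)} :
    l ∈ (semBag B).permutations ↔ ∃ B' : Bag, B'.Perm B ∧ semBag B' = l := by
  simp only [semBag_eq_map, ← List.map_permutations, List.mem_map, List.mem_permutations]

theorem affine_encBag_semBag {B : Bag} (h : ∀ N ∈ B, N.enc.Affine N.fv) (hB : OkBag B) {ρ : ℕ → ℕ}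
    {x : ℕ} (hρ : Set.InjOn ρ (fvBag B)) (hx : ∀ j ∈ fvBag B, ρ j ≠ x) :
    (encBag (semBag B) ρ x).Affine fun n => n = x ∨ ∃ j ∈ fvBag B, n = ρ j := by
  rw [← fvSem_semBag] at *
  refine Sem.affine_encBag ?_ ?_ hρ hx
  · rw [semBag_eq_map]
    simpa using h
  · rw [semBag_eq_map, List.pairwise_map]
    exact (okBag_iff.1 hB).2

/-- At each parallel composition the two sides translate terms with disjoint free variables. As `ρ`
is injective on these and avoids `u`, the names are disjoint as well, and a restricted name has at
most one user on each side. -/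
theorem Term.Ok.affine_enc {M : Term} (h : M.Ok) : M.enc.Affine M.fv := by
  induction M using Term.bagInduction with
  | var x =>
    intro ρ u _ hu
    have : ρ x ≠ u := hu x (by simp [Term.fv])
    exact .someBar (.fwd this (.inr ⟨x, by simp [Term.fv], rfl⟩) (.inl rfl))
      (.inr ⟨x, by simp [Term.fv], rfl⟩)
  | lam k M ih =>
    intro ρ u hρ hu
    refine .someBar (.inp ((ih h).encShare (k := k) (fun i hi j hj h => hρ hi hj (by simpa using h))
      (by simp) (fun j hj => by simpa using hu j hj) (by simp)) (.inl rfl) ?_) (.inl rfl)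
    rintro n (h | h | ⟨j, hj, h⟩)
    · simp at h
    · exact .inl (by simpa using h)
    · exact .inr ⟨j, hj, by simpa using h⟩
  | app M B ihM ihB =>
    intro ρ u hρ hu
    obtain ⟨hM, hB, hd⟩ := h
    simp only [Term.fv, Finset.coe_union] at hρ hu
    refine .bigChoice ?_
    simp only [List.mem_map, mem_permutations_semBag]
    rintro P ⟨_, ⟨B', hB', rfl⟩, rfl⟩
    have hB2 : OkBag B' := hB.perm hB'.symm
    have hfv : fvBag B' = fvBag B := fvBag_perm hB'
    have h1 := ihM hM (fun j => ρ j + 1) 0 (fun i hi j hj h => hρ (.inl hi) (.inl hj)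
      (by simpa using h)) (by simp)
    have h2 := affine_encBag_semBag (fun N hN => ihB N (hB'.mem_iff.1 hN) ((okBag_iff.1 hB2).1 N hN))
      hB2 (ρ := fun j => ρ j + 2) (x := 0) (fun i hi j hj h => hρ (.inr (hfv ▸ hi))
      (.inr (hfv ▸ hj)) (by simpa using h)) (by simp)
    rw [hfv] at h2
    have h3 : (Proc.some 0 (insert (u + 1) ((fvBag B).image fun j => ρ j + 1))
        (.out 0 (.par (.fwd 1 (u + 2)) (encBag (semBag B') (fun j => ρ j + 2) 0)))).Affine
        fun n => n = 0 ∨ n = u + 1 ∨ ∃ z ∈ fvBag B, n = ρ z + 1 := by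
      refine .some (.out (.par (A := fun n => n = 1 ∨ n = u + 2)
        (C := fun n => n = 0 ∨ n = 1 ∨ n = u + 2 ∨ ∃ z ∈ fvBag B, n = ρ z + 2)
        (.fwd (by omega) (.inl rfl) (.inr rfl)) h2 ?_ ?_ ?_) (.inl rfl) ?_) (.inl rfl) ?_
      · rintro n (rfl | rfl) (h | ⟨z, hz, h⟩)
        · simp at h
        · simp at h
        · simp at h
        · exact hu z (Finset.mem_union_right _ hz) (by simpa using h.symm)
      · grind
      · grind
      · grind
      · simp only [Finset.mem_insert, Finset.mem_image]; grind
    refine .nuPar h1 h3 ?_ ?_ ?_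
    · rintro n (h | ⟨z, hz, h⟩) (h' | h' | ⟨z', hz', h'⟩)
      · simp at h
      · simp at h
      · simp at h
      · simp at h'
      · exact hu z (Finset.mem_union_left _ hz) (by omega)
      · have := hρ (.inl hz) (.inr hz') (by omega)
        exact Finset.disjoint_left.1 hd hz (this ▸ hz')
    · rintro n (h | ⟨z, hz, h⟩)
      · simp at h
      · exact .inr ⟨z, Finset.mem_union_left _ hz, by simpa using h⟩
    · rintro n (h | h | ⟨z, hz, h⟩)
      · simp at h
      · exact .inl (by simpa using h)
      · exact .inr ⟨z, Finset.mem_union_right _ hz, by simpa using h⟩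
  | lsub M N ihM ihN =>
    intro ρ u hρ hu
    obtain ⟨hM, hN, hd⟩ := h
    simp only [Term.fv, Finset.coe_union] at hρ hu
    have h1 := ihM hM (liftN 1 ρ) (u + 1) (fun i hi j hj h => by
        rcases i with - | i <;> rcases j with - | j <;> simp [liftN_one_zero, liftN_one_succ] at h ⊢
        exact hρ (.inl (mem_down.2 hi)) (.inl (mem_down.2 hj)) h) (fun i hi => by
        rcases i with - | i <;> simp [liftN_one_zero, liftN_one_succ]
        exact hu i (Finset.mem_union_left _ (mem_down.2 hi)))
    have h2 := ihN hN (fun j => ρ j + 1) 0 (fun i hi j hj h => hρ (.inr hi) (.inr hj)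
      (by simpa using h)) (by simp)
    refine .nuPar h1 (.some h2 (.inl rfl) (by simp only [Finset.mem_image]; grind)) ?_ ?_ ?_
    · rintro n (h | ⟨z, hz, h⟩) (h' | ⟨z', hz', h'⟩)
      · simp at h'
      · exact hu z' (Finset.mem_union_right _ hz') (by omega)
      · simp at h'
      · rcases z with - | z
        · simp [liftN_one_zero] at h
        · rw [liftN_one_succ] at h
          have := hρ (.inl (mem_down.2 hz)) (.inr hz') (by omega)
          exact Finset.disjoint_left.1 hd (mem_down.2 hz) (this ▸ hz')
    · rintro n (h | ⟨z, hz, h⟩)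
      · exact .inl (by simpa using h)
      · rcases z with - | z
        · simp [liftN_one_zero] at h
        · exact .inr ⟨z, Finset.mem_union_left _ (mem_down.2 hz), by simpa [liftN_one_succ] using h⟩
    · rintro n (h | ⟨z, hz, h⟩)
      · simp at h
      · exact .inr ⟨z, Finset.mem_union_right _ hz, by simpa using h⟩
  | fail S =>
    intro ρ u hρ hu
    refine .par (.noneBar (A := fun n => n = u) rfl)
      (.noneAll (A := fun n => ∃ z ∈ S, n = ρ z) (by simp only [Finset.mem_image]; grind)) ?_ ?_ ?_
    · rintro n rfl ⟨z, hz, h⟩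
      exact hu z hz h.symm
    · exact fun n h => .inl h
    · exact fun n h => .inr h
  | share => exact h.elim
  | esub k M B ihM ihB =>
    intro ρ u hρ hu
    obtain ⟨hM, hB, hd⟩ := h
    simp only [Term.fv, Finset.coe_union] at hρ hu
    refine .bigChoice ?_
    simp only [List.mem_map, mem_permutations_semBag]
    rintro P ⟨_, ⟨B', hB', rfl⟩, rfl⟩
    have hB2 : OkBag B' := hB.perm hB'.symm
    have hfv : fvBag B' = fvBag B := fvBag_perm hB'
    have h1 := (ihM hM).encShare (k := k) (ρ := fun j => ρ j + 1) (x := 0) (u := u + 1)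
      (fun i hi j hj h => hρ (.inl hi) (.inl hj) (by simpa using h)) (by simp)
      (fun j hj => by simpa using hu j (Finset.mem_union_left _ hj)) (by simp)
    have h2 := affine_encBag_semBag (fun N hN => ihB N (hB'.mem_iff.1 hN) ((okBag_iff.1 hB2).1 N hN))
      hB2 (ρ := fun j => ρ j + 1) (x := 0) (fun i hi j hj h => hρ (.inr (hfv ▸ hi))
      (.inr (hfv ▸ hj)) (by simpa using h)) (by simp)
    rw [hfv] at h2
    refine .nuPar h1 h2 ?_ ?_ ?_
    · rintro n (h | h | ⟨z, hz, h⟩) (h' | ⟨z', hz', h'⟩)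
      · simp at h
      · simp at h
      · simp at h'
      · exact hu z' (Finset.mem_union_right _ hz') (by omega)
      · simp at h'
      · have := hρ (.inl hz) (.inr hz') (by omega)
        exact Finset.disjoint_left.1 hd hz (this ▸ hz')
    · rintro n (h | h | ⟨z, hz, h⟩)
      · simp at h
      · exact .inl (by simpa using h)
      · exact .inr ⟨z, Finset.mem_union_left _ hz, by simpa using h⟩
    · rintro n (h | ⟨z, hz, h⟩)
      · simp at h
      · exact .inr ⟨z, Finset.mem_union_right _ hz, by simpa using h⟩
  | tick => exact fun _ _ _ _ => .tick

end SharingPi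


namespace SharingPi

/-! ### Matching executions of the two sides of a session -/

/-- Nothing happens in the session, or it is only told that it fails. -/
def Dead (α : Multiset Trace) : Prop := α = 0 ∨ α = {Trace.none}

theorem Dead.zero : Dead 0 := .inl rfl

theorem not_dead_some {c : Option Trace} : ¬ Dead {Trace.some c} := by
  rintro (h | h) <;> simp at h

/-- On a dead session the guard either has not moved or has taken its failure branch. In both cases
the body has not started, and at most `none` is passed on. -/
theorem Proc.Run.some_dead {x : ℕ} {W : Finset ℕ} {P : Proc} {γ : ℕ → Multiset Trace} {b : Bool}
    (h : (Proc.some x W P).Run γ b) (hd : Dead (γ x)) : b = false ∧ ∀ n, n ≠ x → Dead (γ n) := by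
  rcases h with (⟨rfl, hb⟩ | ⟨c, γ', _, _, rfl⟩) | ⟨hb, _, h⟩
  · exact ⟨hb, fun _ _ => .zero⟩
  · exact absurd (by simpa using hd) not_dead_some
  · exact ⟨hb, fun n hn => (h n hn).imp id fun h => h.2⟩

theorem Proc.Run.noneBar_dead {x : ℕ} {γ : ℕ → Multiset Trace} {b : Bool}
    (h : (Proc.noneBar x).Run γ b) : b = false ∧ Dead (γ x) ∧ ∀ n, n ≠ x → γ n = 0 := by
  obtain ⟨hb, rfl | rfl⟩ := h
  · exact ⟨hb, .zero, fun _ _ => rfl⟩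
  · exact ⟨hb, .inr (by simp), fun n hn => by simp [hn]⟩

/-- Equal traces force the partners into lock-step: either both are still idle, or both have passed
the prefix and their remaining sessions agree again. Iterating this reads the run of a protocol step
by step. -/
theorem Proc.Run.some_match {x y : ℕ} {W : Finset ℕ} {P Q : Proc} {γ δ : ℕ → Multiset Trace}
    {b d : Bool} (hP : (Proc.someBar x P).Run γ b) (hQ : (Proc.some y W Q).Run δ d)
    (h : γ x = δ y) : (γ = 0 ∧ δ = 0 ∧ b = false ∧ d = false) ∨
      ∃ γ' δ', P.Run γ' b ∧ Q.Run δ' d ∧ γ' x = δ' y ∧ (∀ n, n ≠ x → γ n = γ' n) ∧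
        ∀ n, n ≠ y → δ n = δ' n := by
  rcases hP with ⟨rfl, rfl⟩ | ⟨c, γ', hP, hc, rfl⟩
  · rcases hQ with (⟨rfl, rfl⟩ | ⟨c', δ', hQ, hc', rfl⟩) | ⟨rfl, hy, hQ⟩
    · exact .inl ⟨rfl, rfl, rfl, rfl⟩
    · simp at h
    · simp [hy] at h
  · rcases hQ with (⟨rfl, rfl⟩ | ⟨c', δ', hQ, hc', rfl⟩) | ⟨rfl, hy, hQ⟩
    · simp at h
    · simp only [Function.update_self, Multiset.singleton_inj, Trace.some.injEq] at h
      subst h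
      exact .inr ⟨γ', δ', hP, hQ, hc.trans hc'.symm, fun n hn => by simp [hn],
        fun n hn => by simp [hn]⟩
    · simp [hy] at h

theorem Proc.Run.comm_match {x y : ℕ} {P Q : Proc} {γ δ : ℕ → Multiset Trace} {b d : Bool}
    (hP : (Proc.out x P).Run γ b) (hQ : (Proc.inp y Q).Run δ d) (h : γ x = δ y) :
    (γ = 0 ∧ δ = 0 ∧ b = false ∧ d = false) ∨
      ∃ γ' δ' α, P.Run (consUse α γ') b ∧ Q.Run (consUse α δ') d ∧ γ' x = δ' y ∧
        (∀ n, n ≠ x → γ n = γ' n) ∧ ∀ n, n ≠ y → δ n = δ' n := by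
  rcases hP with ⟨rfl, rfl⟩ | ⟨a, c, γ', hP, hc, rfl⟩
  · rcases hQ with ⟨rfl, rfl⟩ | ⟨a', c', δ', hQ, hc', rfl⟩
    · exact .inl ⟨rfl, rfl, rfl, rfl⟩
    · simp at h
  · rcases hQ with ⟨rfl, rfl⟩ | ⟨a', c', δ', hQ, hc', rfl⟩
    · simp at h
    · simp only [Function.update_self, Multiset.singleton_inj, Trace.comm.injEq] at h
      obtain ⟨rfl, rfl⟩ := h
      exact .inr ⟨γ', δ', _, hP, hQ, hc.trans hc'.symm, fun n hn => by simp [hn],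
        fun n hn => by simp [hn]⟩

theorem Proc.Run.close_match {x y : ℕ} {P : Proc} {γ δ : ℕ → Multiset Trace} {b d : Bool}
    (hP : (Proc.close x P).Run γ b) (hQ : (Proc.closeBar y).Run δ d) :
    d = false ∧ ((γ = 0 ∧ b = false) ∨ ∃ γ', P.Run γ' b ∧ ∀ n, n ≠ x → γ n = γ' n) := by
  refine ⟨hQ.1, hP.imp id ?_⟩
  rintro ⟨γ', hP', _, rfl⟩
  exact ⟨γ', hP', fun n hn => by simp [hn]⟩

/-- An execution of an element of a bag that serves the session `α`. -/
def ItemRun (p : Finset ℕ × Sem) (ρ : ℕ → ℕ) (γ : ℕ → Multiset Trace) (α : Multiset Trace)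
    (b : Bool) : Prop :=
  ∃ ρ' x γ', Set.InjOn ρ' p.1 ∧ (∀ z ∈ p.1, ρ' z ≠ x) ∧
    (Proc.some x (p.1.image ρ') (p.2 ρ' x)).Run γ' b ∧ γ' x = α ∧ ∀ z ∈ p.1, γ' (ρ' z) = γ (ρ z)

/-- The elements of the bag `l` are handed over to the variables from `i` on of the body `F` of a
sharing construct. -/
def Served (F : Sem) (V : Finset ℕ) (r i : ℕ) (ρ : ℕ → ℕ) (u : ℕ) (γ : ℕ → Multiset Trace)
    (b : Bool) (l : List (Finset ℕ × Sem)) (σ : ℕ → ℕ) (δ : ℕ → Multiset Trace) (d : Bool) : Prop :=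
  l.length = r ∧ ∃ (ρ' : ℕ → ℕ) (u' : ℕ) (γ' : ℕ → Multiset Trace) (bs : ℕ → Bool), Set.InjOn ρ' V ∧ (∀ z ∈ V, ρ' z ≠ u') ∧ (F ρ' u').Run γ' b ∧
    γ' u' = γ u ∧ (∀ j ∈ V, ¬ (i ≤ j ∧ j < i + r) → γ' (ρ' j) = γ (ρ j)) ∧
    (d = true → ∃ m < r, bs m = true) ∧
    ∀ m p, l[m]? = Option.some p →
      ItemRun p σ δ (if i + m ∈ V then γ' (ρ' (i + m)) else 0) (bs m)

/-- Both protocols are followed in lock-step, by induction on the number of variables still to be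
served. If variables and elements run out together, the body runs with every element attached to its
variable. If one side runs out first, it announces `none`, and the guards spread the failure to `u`
and to all free variables. If the run stops before the end of the protocol, the sessions behind it
are idle. Except in the first case nothing has reached ✓ and every outer session is dead. -/
theorem served_or_dead {F : Sem} {V : Finset ℕ} (hF : F.Affine V) {r i : ℕ} {ρ : ℕ → ℕ}
    {x u : ℕ} (hρ : ∀ j ∈ V, ∀ j' ∈ V, ¬ (i ≤ j ∧ j < i + r) → ¬ (i ≤ j' ∧ j' < i + r) →
      ρ j = ρ j' → j = j') (hx : ∀ j ∈ V, ¬ (i ≤ j ∧ j < i + r) → ρ j ≠ x)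
    (hu : ∀ j ∈ V, ¬ (i ≤ j ∧ j < i + r) → ρ j ≠ u) (hxu : x ≠ u)
    {l : List (Finset ℕ × Sem)} (hl : ∀ p ∈ l, Sem.Affine p.2 p.1)
    (hd : l.Pairwise fun p q => Disjoint p.1 q.1) {σ : ℕ → ℕ} {y : ℕ}
    (hσ : Set.InjOn σ (fvSem l)) (hy : ∀ j ∈ fvSem l, σ j ≠ y)
    {γ δ : ℕ → Multiset Trace} {b d : Bool} (hP : (encShareAux F V r i ρ x u).Run γ b)
    (hQ : (encBag l σ y).Run δ d) (h : γ x = δ y) :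
    (b = false ∧ d = false ∧ Dead (γ u) ∧ (∀ j ∈ V, ¬ (i ≤ j ∧ j < i + r) → Dead (γ (ρ j))) ∧
      ∀ j ∈ fvSem l, Dead (δ (σ j))) ∨
    Served F V r i ρ u γ b l σ δ d := by
  induction r generalizing i ρ x u l σ y γ δ b d with
  | zero =>
    rcases l with - | ⟨p, l⟩
    · rcases hP.some_match hQ h with ⟨rfl, rfl, hb, hd⟩ | ⟨γ₁, δ₁, hP, hQ, h, hγ, hδ⟩
      · exact .inl ⟨hb, hd, .zero, fun _ _ _ => .zero, fun _ _ => .zero⟩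
      rcases hP.comm_match hQ h with ⟨rfl, rfl, hb, hd⟩ | ⟨γ₂, δ₂, α, hP, hQ, h, hγ', hδ'⟩
      · refine .inl ⟨hb, hd, ?_, fun j hj hi => ?_, by simp [fvSem]⟩
        · rw [hγ _ hxu.symm]; exact .zero
        · rw [hγ _ (hx j hj hi)]; exact .zero
      obtain ⟨γA, γB, bA, bB, hsum, rfl, hA, hB⟩ := hP
      obtain ⟨δA, δB, dA, dB, hsum', rfl, hA', hB'⟩ := hQ
      obtain ⟨rfl, -, hB⟩ := hB.noneBar_dead
      have hdB : dB = false := by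
        rcases hB' with (⟨-, hb⟩ | ⟨_, _, hb, -⟩) | ⟨hb, -⟩
        · exact hb
        · exact hb.1
        · exact hb
      have hB0 : δB 0 = 0 := hB'.eq_zero (by simp [Proc.cnt])
      have hγA : ∀ n, n ≠ x → γA (n + 1) = γ n := fun n hn => by
        have := congrFun hsum (n + 1)
        rw [hγ _ hn, hγ' _ hn]
        simpa [consUse, hB (n + 1) (by simpa using hn)] using this.symm
      have h0 : δA 0 = γA 0 := by
        have h1 := congrFun hsum 0
        have h2 := congrFun hsum' 0
        simp only [consUse, Pi.add_apply, hB 0 (by simp), hB0, add_zero] at h1 h2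
        rw [← h1, ← h2]
      simp only [hdB, Bool.or_false]
      rcases hA'.some_match hA h0 with ⟨rfl, rfl, rfl, rfl⟩ | ⟨δ₃, γ₃, hA', hA, h0, hδ₃, hγ₃⟩
      · refine .inl ⟨rfl, rfl, ?_, fun j hj hi => ?_, by simp [fvSem]⟩
        · rw [← hγA _ hxu.symm]; exact .zero
        · rw [← hγA _ (hx j hj hi)]; exact .zero
      obtain ⟨rfl, ⟨rfl, rfl⟩ | ⟨γ₄, hA, hγ₄⟩⟩ := hA.close_match hA'
      · refine .inl ⟨rfl, rfl, ?_, fun j hj hi => ?_, by simp [fvSem]⟩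
        · rw [← hγA _ hxu.symm, hγ₃ _ (by simp)]; exact .zero
        · rw [← hγA _ (hx j hj hi), hγ₃ _ (by simp)]; exact .zero
      · refine .inr ⟨rfl, _, _, γ₄, fun _ => false, fun j hj j' hj' h => hρ j hj j' hj' (by omega)
          (by omega) (by simpa using h), fun z hz => by simpa using hu z hz (by omega), hA, ?_, ?_,
          by simp, by simp⟩
        · rw [← hγA _ hxu.symm, hγ₃ _ (by simp), hγ₄ _ (by simp)]
        · intro j hj hi
          rw [← hγA _ (hx j hj hi), hγ₃ _ (by simp), hγ₄ _ (by simp)]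
    -- No variable is left but the bag still has an element. The closing `none` at `x` hits the
    -- guard in the bag, which passes it on to the name that guards the body of the sharing
    -- construct.
    · left
      rcases hP.some_match hQ h with ⟨rfl, rfl, hb, hd⟩ | ⟨γ₁, δ₁, hP, hQ, h, hγ, hδ⟩
      · exact ⟨hb, hd, .zero, fun _ _ _ => .zero, fun _ _ => .zero⟩
      rcases hP.comm_match hQ h with ⟨rfl, rfl, hb, hd⟩ | ⟨γ₂, δ₂, α, hP, hQ, h, hγ', hδ'⟩
      · refine ⟨hb, hd, ?_, fun j hj hi => ?_, fun j hj => ?_⟩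
        · rw [hγ _ hxu.symm]; exact .zero
        · rw [hγ _ (hx j hj hi)]; exact .zero
        · rw [hδ _ (hy j hj)]; exact .zero
      obtain ⟨γA, γB, bA, bB, hsum, rfl, hA, hB⟩ := hP
      obtain ⟨rfl, hBd, hB⟩ := hB.noneBar_dead
      have hγA : ∀ n, n ≠ x → γA (n + 1) = γ n := fun n hn => by
        have := congrFun hsum (n + 1)
        rw [hγ _ hn, hγ' _ hn]
        simpa [consUse, hB (n + 1) (by simpa using hn)] using this.symm
      have hAx : γA (x + 1) = 0 :=
        hA.eq_zero ((Proc.Affine.some (A := fun n => n ≠ x + 1) (.close ((hF _ _ (fun j hj j' hj' h =>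
          hρ j hj j' hj' (by omega) (by omega) (by simpa using h)) fun z hz => by
            simpa using hu z hz (by omega)).mono (by
              rintro n (rfl | ⟨z, hz, rfl⟩)
              · simpa using hxu.symm
              · simpa using hx z hz (by omega))) (by simp)) (by simp) (by
              simp only [Finset.mem_insert, Finset.mem_image]
              rintro n (rfl | ⟨z, hz, rfl⟩)
              · simpa using hxu.symm
              · simpa using hx z hz (by omega))).cnt_eq_zero (by simp))
      have hxd : Dead (consUse α δ₂ (y + 1)) := by
        have := congrFun hsum (x + 1)
        simp only [consUse, Pi.add_apply, hAx, zero_add] at this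
        simp only [consUse]
        rwa [← h, this]
      obtain ⟨rfl, hQd⟩ := hQ.some_dead hxd
      have h0 : γA 0 = α := by
        have h1 := congrFun hsum 0
        simpa only [consUse, Pi.add_apply, hB 0 (by simp), add_zero] using h1.symm
      obtain ⟨rfl, hAd⟩ := hA.some_dead (h0 ▸ hQd 0 (by simp))
      refine ⟨rfl, rfl, ?_, fun j hj hi => ?_, fun j hj => ?_⟩
      · rw [← hγA _ hxu.symm]; exact hAd _ (by simp)
      · rw [← hγA _ (hx j hj hi)]; exact hAd _ (by simp)
      · rw [hδ _ (hy j hj), hδ' _ (hy j hj)]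
        exact hQd (σ j + 1) (by simpa using hy j hj)
  | succ r ih =>
    have hA1 : ∀ {γ : ℕ → Multiset Trace} {b : Bool},
        (Proc.some 0 ∅ (.close 0 .nil)).Run γ b → b = false ∧ ∀ n, n ≠ 0 → γ n = 0 := by
      intro γ b h
      refine ⟨?_, fun n hn => h.eq_zero (by simp [Proc.cnt, hn])⟩
      rcases h with (⟨-, hb⟩ | ⟨_, _, ⟨-, hb⟩ | ⟨_, ⟨-, hb⟩, -⟩, -⟩) | ⟨hb, -⟩ <;> exact hb
    have hW : ∀ j ∈ V, ¬ (i ≤ j ∧ j < i + (r + 1)) → ρ j + 1 ≠ x + 1 := fun j hj hi => by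
      simpa using hx j hj hi
    rcases l with - | ⟨p, l⟩
    -- A variable is left but the bag is exhausted. The bag answers with `none`, and the guard of
    -- the sharing construct passes it on to `u` and to the free variables of the body.
    · left
      rcases hP.some_match hQ h with ⟨rfl, rfl, hb, hd⟩ | ⟨γ₁, δ₁, hP, hQ, h, hγ, hδ⟩
      · exact ⟨hb, hd, .zero, fun _ _ _ => .zero, by simp [fvSem]⟩
      rcases hP.comm_match hQ h with ⟨rfl, rfl, hb, hd⟩ | ⟨γ₂, δ₂, α, hP, hQ, h, hγ', hδ'⟩
      · refine ⟨hb, hd, ?_, fun j hj hi => ?_, by simp [fvSem]⟩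
        · rw [hγ _ hxu.symm]; exact .zero
        · rw [hγ _ (hx j hj hi)]; exact .zero
      obtain ⟨γA, γB, bA, bB, hsum, rfl, hA, hB⟩ := hP
      obtain ⟨δA, δB, dA, dB, hsum', rfl, hA', hB'⟩ := hQ
      obtain ⟨rfl, hA0⟩ := hA1 hA
      have hdA : dA = false := by
        rcases hA' with ⟨-, hb⟩ | ⟨_, _, ⟨hb, -⟩, -⟩ <;> exact hb
      have hγB : ∀ n, γB (n + 1) = γ₂ n := fun n => by
        simpa [consUse, hA0 (n + 1) (by simp)] using (congrFun hsum (n + 1)).symm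
      have hxB : γB (x + 1) = δB (y + 1) := by
        have h2 := congrFun hsum' (y + 1)
        have h3 : δA (y + 1) = 0 := hA'.eq_zero (by simp [Proc.cnt])
        simp only [consUse, Pi.add_apply, h3, zero_add] at h2
        rw [hγB, h, h2]
      simp only [hdA, Bool.false_or]
      have key : bB = false ∧ dB = false ∧ ∀ n, n ≠ x + 1 → Dead (γB n) := by
        rcases hB.some_match hB' hxB with ⟨rfl, rfl, rfl, rfl⟩ | ⟨γ₃, δ₃, hB, hB', hxB, hγ₃, hδ₃⟩
        · exact ⟨rfl, rfl, fun _ _ => .zero⟩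
        · obtain ⟨rfl, hd, -⟩ := hB'.noneBar_dead
          obtain ⟨rfl, hd⟩ := hB.some_dead (hxB ▸ hd)
          exact ⟨rfl, rfl, fun n hn => hγ₃ n hn ▸ hd n hn⟩
      refine ⟨key.1, key.2.1, ?_, fun j hj hi => ?_, by simp [fvSem]⟩
      · rw [hγ _ hxu.symm, hγ' _ hxu.symm, ← hγB]
        exact key.2.2 _ (by simpa using hxu.symm)
      · rw [hγ _ (hx j hj hi), hγ' _ (hx j hj hi), ← hγB]
        exact key.2.2 _ (hW j hj hi)
    · have hpl : ∀ j ∈ p.1, j ∈ fvSem (p :: l) := fun j hj => Finset.mem_union_left _ hj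
      have hll : ∀ j ∈ fvSem l, j ∈ fvSem (p :: l) := fun j hj => Finset.mem_union_right _ hj
      have hyj : ∀ j ∈ fvSem (p :: l), σ j + 1 ≠ y + 1 := fun j hj => by simpa using hy j hj
      rw [List.pairwise_cons] at hd
      rcases hP.some_match hQ h with ⟨rfl, rfl, hb, hd⟩ | ⟨γ₁, δ₁, hP, hQ, h, hγ, hδ⟩
      · exact .inl ⟨hb, hd, .zero, fun _ _ _ => .zero, fun _ _ => .zero⟩
      rcases hP.comm_match hQ h with ⟨rfl, rfl, hb, hd⟩ | ⟨γ₂, δ₂, α, hP, hQ, h, hγ', hδ'⟩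
      · refine .inl ⟨hb, hd, ?_, fun j hj hi => ?_, fun j hj => ?_⟩
        · rw [hγ _ hxu.symm]; exact .zero
        · rw [hγ _ (hx j hj hi)]; exact .zero
        · rw [hδ _ (hy j hj)]; exact .zero
      obtain ⟨γA, γB, bA, bB, hsum, rfl, hA, hB⟩ := hP
      obtain ⟨rfl, hA0⟩ := hA1 hA
      have hγB : ∀ n, γB (n + 1) = γ₂ n := fun n => by
        simpa [consUse, hA0 (n + 1) (by simp)] using (congrFun hsum (n + 1)).symm
      have hγu : γ u = γB (u + 1) := by rw [hγB, hγ _ hxu.symm, hγ' _ hxu.symm]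
      have hγj : ∀ j ∈ V, ¬ (i ≤ j ∧ j < i + (r + 1)) → γ (ρ j) = γB (ρ j + 1) := fun j hj hi => by
        rw [hγB, hγ _ (hx j hj hi), hγ' _ (hx j hj hi)]
      have hδj : ∀ j ∈ fvSem (p :: l), δ (σ j) = consUse α δ₂ (σ j + 1) := fun j hj => by
        rw [hδ _ (hy j hj), hδ' _ (hy j hj)]; rfl
      have hxu' : u + 1 ≠ x + 1 := by simpa using hxu.symm
      simp only [Bool.false_or]
      rcases hB.some_match hQ ((hγB x).trans h) with ⟨rfl, h2, hb, hd⟩ | ⟨γ₃, δ₃, hB, hQ, h, hγ₃, hδ₃⟩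
      · refine .inl ⟨hb, hd, ?_, fun j hj hi => ?_, fun j hj => ?_⟩
        · rw [hγu]; exact .zero
        · rw [hγj j hj hi]; exact .zero
        · rw [hδj j hj, h2]; exact .zero
      rcases hQ.some_match hB h.symm with ⟨rfl, rfl, hd, hb⟩ | ⟨δ₄, γ₄, hQ, hB, h, hδ₄, hγ₄⟩
      · refine .inl ⟨hb, hd, ?_, fun j hj hi => ?_, fun j hj => ?_⟩
        · rw [hγu, hγ₃ _ hxu']; exact .zero
        · rw [hγj j hj hi, hγ₃ _ (hW j hj hi)]; exact .zero
        · rw [hδj j hj, hδ₃ _ (hyj j hj)]; exact .zero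
      rcases hQ.comm_match hB h with ⟨rfl, rfl, hd, hb⟩ | ⟨δ₅, γ₅, β, hQ, hB, h, hδ₅, hγ₅⟩
      · refine .inl ⟨hb, hd, ?_, fun j hj hi => ?_, fun j hj => ?_⟩
        · rw [hγu, hγ₃ _ hxu', hγ₄ _ hxu']; exact .zero
        · rw [hγj j hj hi, hγ₃ _ (hW j hj hi), hγ₄ _ (hW j hj hi)]; exact .zero
        · rw [hδj j hj, hδ₃ _ (hyj j hj), hδ₄ _ (hyj j hj)]; exact .zero
      have hγu : γ u = γ₅ (u + 1) := by rw [hγu, hγ₃ _ hxu', hγ₄ _ hxu', hγ₅ _ hxu']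
      have hγj : ∀ j ∈ V, ¬ (i ≤ j ∧ j < i + (r + 1)) → γ (ρ j) = γ₅ (ρ j + 1) := fun j hj hi => by
        rw [hγj j hj hi, hγ₃ _ (hW j hj hi), hγ₄ _ (hW j hj hi), hγ₅ _ (hW j hj hi)]
      have hδj : ∀ j ∈ fvSem (p :: l), δ (σ j) = δ₅ (σ j + 1) := fun j hj => by
        rw [hδj j hj, hδ₃ _ (hyj j hj), hδ₄ _ (hyj j hj), hδ₅ _ (hyj j hj)]
      obtain ⟨δI, δR, dI, dR, hsum', rfl, hI, hR⟩ := hQ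
      obtain ⟨δL, δN, dL, dN, rfl, rfl, hL, hN⟩ := hR
      obtain ⟨rfl, -, hN⟩ := hN.noneBar_dead
      have hl2 : ∀ q ∈ l, Sem.Affine q.2 q.1 := fun q hq => hl q (by simp [hq])
      have hσl : Set.InjOn (fun j => σ j + 2) (fvSem l) := fun j hj j' hj' h =>
        hσ (hll j hj) (hll j' hj') (by simpa using h)
      have hyl : ∀ j ∈ fvSem l, (fun j => σ j + 2) j ≠ y + 2 := fun j hj => by
        simpa using hy j (hll j hj)
      have hσp : Set.InjOn (fun j => σ j + 2) p.1 := fun j hj j' hj' h =>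
        hσ (hpl j hj) (hpl j' hj') (by simpa using h)
      have hLz : ∀ n, ¬ (n = y + 2 ∨ ∃ j ∈ fvSem l, n = σ j + 2) → δL n = 0 := fun n hn =>
        hL.eq_zero ((Sem.affine_encBag hl2 hd.2 hσl hyl).cnt_eq_zero hn)
      have hIz : ∀ n, ¬ (n = 0 ∨ ∃ j ∈ p.1, n = σ j + 2) → δI n = 0 := fun n hn =>
        hI.eq_zero (((hl p (by simp) (fun j => σ j + 2) 0 hσp (by simp)).some (.inl rfl) (by
          simp only [Finset.mem_image]; grind)).cnt_eq_zero hn)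
      have hpd : ∀ j ∈ p.1, j ∉ fvSem l := fun j hj hjl => by
        obtain ⟨q, hq, hjq⟩ := mem_fvSem.1 hjl
        exact Finset.disjoint_left.1 (hd.1 q hq) hj hjq
      have hI0 : δI 0 = β := by
        have := congrFun hsum' 0
        simpa [consUse, hLz 0 (by simp), hN 0 (by simp)] using this.symm
      have hLy : δL (y + 2) = δ₅ (y + 1) := by
        have h1 := congrFun hsum' (y + 2)
        have h2 := hIz (y + 2) (by
          rintro (h | ⟨j, hj, h⟩)
          · simp at h
          · exact hy j (hpl j hj) (by simpa using h.symm))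
        simpa [consUse, h2, hN (y + 2) (by simp)] using h1.symm
      have hIj : ∀ j ∈ p.1, δI (σ j + 2) = δ (σ j) := fun j hj => by
        have h1 := congrFun hsum' (σ j + 2)
        have h2 := hLz (σ j + 2) (by
          rintro (h | ⟨j', hj', h⟩)
          · exact hy j (hpl j hj) (by simpa using h)
          · have := hσ (hpl j hj) (hll j' hj') (by simpa using h)
            exact hpd j hj (this ▸ hj'))
        rw [hδj j (hpl j hj)]
        simpa [consUse, h2, hN (σ j + 2) (by simp)] using h1.symm
      have hLj : ∀ j ∈ fvSem l, δL (σ j + 2) = δ (σ j) := fun j hj => by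
        have h1 := congrFun hsum' (σ j + 2)
        have h2 := hIz (σ j + 2) (by
          rintro (h | ⟨j', hj', h⟩)
          · simp at h
          · have := hσ (hll j hj) (hpl j' hj') (by simpa using h)
            exact hpd j' hj' (this ▸ hj))
        rw [hδj j (hll j hj)]
        simpa [consUse, h2, hN (σ j + 2) (by simp)] using h1.symm
      have hB' : ∀ j ∈ V, ¬ (i + 1 ≤ j ∧ j < i + 1 + r) →
          (i = j ∧ (if j = i then 0 else ρ j + 2) = 0) ∨
          (¬ (i ≤ j ∧ j < i + (r + 1)) ∧ (if j = i then 0 else ρ j + 2) = ρ j + 2) := by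
        intro j hj hi
        by_cases hji : j = i
        · exact .inl ⟨hji.symm, by simp [hji]⟩
        · exact .inr ⟨by omega, by simp [hji]⟩
      have hρ₁ : ∀ j ∈ V, ∀ j' ∈ V, ¬ (i + 1 ≤ j ∧ j < i + 1 + r) →
          ¬ (i + 1 ≤ j' ∧ j' < i + 1 + r) →
          (if j = i then 0 else ρ j + 2) = (if j' = i then 0 else ρ j' + 2) → j = j' := by
        intro j hj j' hj' hi hi' h
        rcases hB' j hj hi with ⟨rfl, h1⟩ | ⟨hi, h1⟩ <;> rcases hB' j' hj' hi' with ⟨h3, h2⟩ | ⟨hi', h2⟩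
        · exact h3
        · rw [h1, h2] at h; simp at h
        · rw [h1, h2] at h; simp at h
        · rw [h1, h2] at h; exact hρ j hj j' hj' hi hi' (by simpa using h)
      have hx₁ : ∀ j ∈ V, ¬ (i + 1 ≤ j ∧ j < i + 1 + r) →
          (if j = i then 0 else ρ j + 2) ≠ x + 2 := fun j hj hi h => by
        rcases hB' j hj hi with ⟨-, h1⟩ | ⟨hi, h1⟩ <;> rw [h1] at h
        · simp at h
        · exact hx j hj hi (by simpa using h)
      have hu₁ : ∀ j ∈ V, ¬ (i + 1 ≤ j ∧ j < i + 1 + r) →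
          (if j = i then 0 else ρ j + 2) ≠ u + 2 := fun j hj hi h => by
        rcases hB' j hj hi with ⟨-, h1⟩ | ⟨hi, h1⟩ <;> rw [h1] at h
        · simp at h
        · exact hu j hj hi (by simpa using h)
      -- A variable that the body does not use leaves the session of its element idle.
      have hi0 : i ∉ V → β = 0 := fun hi => by
        refine hB.eq_zero (i := 0) ((hF.encShareAux r (i + 1) _ (x + 2) (u + 2) hρ₁ hx₁ hu₁
          (by simpa using hxu)).cnt_eq_zero ?_)
        rintro (h | h | ⟨j, hj, hi', h⟩)
        · simp at h
        · simp at h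
        · rcases hB' j hj hi' with ⟨rfl, -⟩ | ⟨-, h1⟩
          · exact hi hj
          · rw [h1] at h; simp at h
      rcases ih hρ₁ hx₁ hu₁ (by simpa using hxu) hl2 hd.2 hσl hyl hB hL (by
          rw [hLy, h]; rfl) with ⟨rfl, rfl, hdu, hdj, hdl⟩ | ⟨hlen, ρ', u', γ', bs, hρ', hu', hFr, hγ'u, hγ'j, hbs, hit⟩
      · have hβ : Dead β := by
          by_cases hi : i ∈ V
          · simpa [consUse] using hdj i hi (by omega)
          · exact .inl (hi0 hi)
        obtain ⟨rfl, hdI⟩ := hI.some_dead (hI0 ▸ hβ)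
        refine .inl ⟨rfl, rfl, hγu ▸ hdu, fun j hj hi => ?_, fun j hj => ?_⟩
        · rw [hγj j hj hi]
          have := hdj j hj (by omega)
          rwa [if_neg (by omega)] at this
        · rcases Finset.mem_union.1 hj with hj | hj
          · rw [← hIj j hj]; exact hdI _ (by simp)
          · rw [← hLj j hj]; exact hdl j hj
      · right
        have hβ : (if i ∈ V then γ' (ρ' i) else 0) = β := by
          split_ifs with hi
          · rw [hγ'j i hi (by omega)]; simp [consUse]
          · exact (hi0 hi).symm
        refine ⟨by simp [hlen], ρ', u', γ', fun m => if m = 0 then dI else bs (m - 1), hρ', hu', hFr,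
          by rw [hγ'u, hγu]; rfl, fun j hj hi => ?_, fun hd => ?_, fun m q hm => ?_⟩
        · rw [hγj j hj hi, hγ'j j hj (by omega)]
          change consUse β γ₅ (if j = i then 0 else ρ j + 2) = _
          rw [if_neg (by omega)]; rfl
        · simp only [Bool.or_false, Bool.or_eq_true] at hd
          rcases hd with hd | hd
          · exact ⟨0, by omega, by simpa using hd⟩
          · obtain ⟨m, hm, hb⟩ := hbs hd
            exact ⟨m + 1, by omega, by simpa using hb⟩
        · rcases m with - | m
          · simp only [List.getElem?_cons_zero, Option.some.injEq] at hm
            subst hm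
            exact ⟨fun j => σ j + 2, 0, δI, hσp, by simp, by simpa using hI, by
              rw [hI0]; exact hβ.symm, hIj⟩
          · obtain ⟨ρ₂, x₂, γ₂, h1, h2, h3, h4, h5⟩ := hit m q (by simpa using hm)
            refine ⟨ρ₂, x₂, γ₂, h1, h2, by simpa using h3, ?_, fun z hz => ?_⟩
            · rw [h4, show i + 1 + m = i + (m + 1) by omega]
            · have hq : q ∈ l := List.mem_of_getElem? (by simpa using hm)
              rw [h5 z hz, hLj z (mem_fvSem.2 ⟨q, hq, hz⟩)]

end SharingPi


namespace SharingPi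

/-! ### From executions of the translation to the machine -/

/-- An execution of the translation of a closure serves the session `α`; `b` is a lower bound for
its success flag. -/
def Clo.Ans : Clo → Multiset Trace → Bool → Prop
  | .none => fun _ _ => False
  | .mk N e => fun α b => N.Ok ∧ ∃ (ρ : ℕ → ℕ) (x : ℕ) (γ : ℕ → Multiset Trace) (b₀ : Bool)
      (bs : ℕ → Bool), Set.InjOn ρ N.fv ∧ (∀ z ∈ N.fv, ρ z ≠ x) ∧
      (Proc.some x (N.fv.image ρ) (N.enc ρ x)).Run γ b₀ ∧ γ x = α ∧
      (∀ z ∈ N.fv, (e z).Ans (γ (ρ z)) (bs z)) ∧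
      (b = true → b₀ = true ∨ ∃ z ∈ N.fv, bs z = true)

/-- The term of a closure waits behind a guard at its name. If the session there is dead, the term
does not start and the sessions at its own free variables are dead too, so by recursion nothing
behind the closure reaches ✓. -/
theorem Clo.Ans.dead {c : Clo} {α : Multiset Trace} {b : Bool} (h : c.Ans α b) (hα : Dead α) :
    b = false := by
  induction c generalizing α b with
  | none => exact h.elim
  | mk N e ih =>
    obtain ⟨-, ρ, x, γ, b₀, bs, -, hx, hr, rfl, he, hb⟩ := h
    obtain ⟨rfl, hd⟩ := hr.some_dead hα
    by_contra hc
    rcases hb (by simpa using hc) with h | ⟨z, hz, h⟩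
    · simp at h
    · rw [ih z (he z hz) (hd _ (hx z hz))] at h
      simp at h

/-- The translation of the context of an application to the bag `B`, at the innermost name. -/
def frame (B : Bag) (ρ : ℕ → ℕ) (u : ℕ) : Proc :=
  .some 0 (insert (u + 1) ((fvBag B).image fun j => ρ j + 1))
    (.out 0 (.par (.fwd 1 (u + 2)) (encBag (semBag B) (fun j => ρ j + 2) 0)))

/-- An execution of the translation of a stack serves the session `α`. -/
def StackAns : Stack → Multiset Trace → Bool → Prop
  | [], α, b => α = 0 ∧ b = false
  | (B, e) :: s, α, b => OkBag B ∧ ∃ (ρ : ℕ → ℕ) (u : ℕ) (γ : ℕ → Multiset Trace) (b₀ b₁ : Bool)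
      (bs : ℕ → Bool), Set.InjOn ρ (fvBag B) ∧ (∀ z ∈ fvBag B, ρ z ≠ u) ∧
      (frame B ρ u).Run (consUse α γ) b₀ ∧ StackAns s (γ u) b₁ ∧
      (∀ z ∈ fvBag B, (e z).Ans (γ (ρ z)) (bs z)) ∧
      (b = true → b₀ = true ∨ b₁ = true ∨ ∃ z ∈ fvBag B, bs z = true)

theorem StackAns.dead {s : Stack} {α : Multiset Trace} {b : Bool} (h : StackAns s α b)
    (hα : Dead α) : b = false := by
  induction s generalizing α b with
  | nil => exact h.2
  | cons p s ih =>
    obtain ⟨B, e⟩ := p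
    obtain ⟨-, ρ, u, γ, b₀, b₁, bs, -, -, hr, hs, he, hb⟩ := h
    obtain ⟨rfl, hd⟩ := hr.some_dead hα
    by_contra hc
    rcases hb (by simpa using hc) with h | h | ⟨z, hz, h⟩
    · simp at h
    · rw [ih hs (hd (u + 1) (by simp))] at h
      simp at h
    · rw [(he z hz).dead (hd (ρ z + 1) (by simp))] at h
      simp at h

/-- A successful execution of the translation of a state of the machine. -/
def StateAns (M : Term) (e : ℕ → Clo) (s : Stack) : Prop :=
  M.Ok ∧ ∃ (ρ : ℕ → ℕ) (u : ℕ) (γ : ℕ → Multiset Trace) (b₀ b₁ : Bool) (bs : ℕ → Bool),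
    Set.InjOn ρ M.fv ∧ (∀ z ∈ M.fv, ρ z ≠ u) ∧ (M.enc ρ u).Run γ b₀ ∧ StackAns s (γ u) b₁ ∧
    (∀ z ∈ M.fv, (e z).Ans (γ (ρ z)) (bs z)) ∧
    (b₀ = true ∨ b₁ = true ∨ ∃ z ∈ M.fv, bs z = true)

theorem okBag_semBag {B : Bag} (hB : OkBag B) : (∀ p ∈ semBag B, Sem.Affine p.2 p.1) ∧
    (semBag B).Pairwise fun p q => Disjoint p.1 q.1 := by
  constructor
  · rw [semBag_eq_map]
    simpa using fun N hN => ((okBag_iff.1 hB).1 N hN).affine_enc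
  · rw [semBag_eq_map, List.pairwise_map]
    exact (okBag_iff.1 hB).2

-- This turns `served_or_dead` into a machine step. In the dead alternative no part of the state
-- could have reached ✓, against `hb`. Otherwise the elements of the bag become closures, and
-- success is followed to its carrier: success of an element, or of a closure that an element uses,
-- is counted as success of the closure of that element.
open Classical in
theorem StateAns.of_share {k : ℕ} {M : Term} {B : Bag} (hM : M.Ok) (hB : OkBag B) {ρ σ : ℕ → ℕ}
    {x u y : ℕ} (hρ : Set.InjOn ρ (down k M.fv)) (hx : ∀ z ∈ down k M.fv, ρ z ≠ x)
    (hu : ∀ z ∈ down k M.fv, ρ z ≠ u) (hxu : x ≠ u) (hσ : Set.InjOn σ (fvBag B))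
    (hy : ∀ z ∈ fvBag B, σ z ≠ y) {γ δ : ℕ → Multiset Trace} {b d : Bool}
    (hP : (encShare M.enc M.fv k ρ x u).Run γ b) (hQ : (encBag (semBag B) σ y).Run δ d)
    (h : γ x = δ y) {e e' : ℕ → Clo} {bs bs' : ℕ → Bool}
    (he : ∀ z ∈ down k M.fv, (e z).Ans (γ (ρ z)) (bs z))
    (he' : ∀ z ∈ fvBag B, (e' z).Ans (δ (σ z)) (bs' z)) {s : Stack} {b₁ : Bool}
    (hs : StackAns s (γ u) b₁) (hb : b = true ∨ d = true ∨ b₁ = true ∨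
      (∃ z ∈ down k M.fv, bs z = true) ∨ ∃ z ∈ fvBag B, bs' z = true) :
    B.length = k ∧ StateAns M (extEnv (closures B e') e) s := by
  have key : ∀ j ∈ M.fv, ¬ (0 ≤ j ∧ j < 0 + k) → j - k ∈ down k M.fv := fun j hj hk =>
    mem_down.2 (by rwa [Nat.sub_add_cancel (by omega)])
  obtain ⟨hB1, hB2⟩ := okBag_semBag hB
  rcases served_or_dead hM.affine_enc (fun j hj j' hj' hk hk' h => by
      have := hρ (key j hj hk) (key j' hj' hk') h
      omega) (fun j hj hk => hx _ (key j hj hk)) (fun j hj hk => hu _ (key j hj hk)) hxu hB1 hB2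
      (by rwa [fvSem_semBag]) (by rwa [fvSem_semBag]) hP hQ h with
    ⟨rfl, rfl, hdu, hdj, hdl⟩ | ⟨hlen, ρ', u', γ', it, hρ', hu', hr, hγu, hγj, hd, hit⟩
  · exfalso
    rw [fvSem_semBag] at hdl
    rcases hb with h | h | h | ⟨z, hz, h⟩ | ⟨z, hz, h⟩
    · simp at h
    · simp at h
    · rw [hs.dead hdu] at h
      simp at h
    · have := hdj (z + k) (mem_down.1 hz) (by omega)
      rw [Nat.add_sub_cancel] at this
      rw [(he z hz).dead this] at h
      simp at h
    · rw [(he' z hz).dead (hdl z hz)] at h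
      simp at h
  · rw [semBag_eq_map, List.length_map] at hlen
    have hit' : ∀ m N, B[m]? = some N → (Clo.mk N e').Ans
        (if 0 + m ∈ M.fv then γ' (ρ' (0 + m)) else 0)
        (decide (it m = true ∨ ∃ z ∈ N.fv, bs' z = true)) := by
      intro m N hN
      have hNB := List.mem_of_getElem? hN
      obtain ⟨ρ₁, x₁, γ₁, h1, h2, h3, h4, h5⟩ := hit m (N.fv, N.enc) (by simp [semBag_eq_map, hN])
      refine ⟨(okBag_iff.1 hB).1 N hNB, ρ₁, x₁, γ₁, it m, bs', h1, h2, h3, h4, fun z hz => ?_,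
        of_decide_eq_true⟩
      rw [h5 z hz]
      exact he' z (mem_fvBag_of_mem hNB hz)
    refine ⟨hlen, hM, ρ', u', γ', b, b₁, fun z => if z < k then
      decide (it z = true ∨ ∃ N, B[z]? = some N ∧ ∃ w ∈ N.fv, bs' w = true) else bs (z - k),
      hρ', hu', hr, hγu ▸ hs, fun z hz => ?_, ?_⟩
    · by_cases hzk : z < k
      · obtain ⟨N, hN⟩ : ∃ N, B[z]? = some N := ⟨B[z], List.getElem?_eq_getElem (by omega)⟩
        have := hit' z N hN
        simp only [zero_add, hz, if_true] at this
        simpa [extEnv, closures, hN, hzk] using this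
      · have := he _ (key z hz (by omega))
        rw [hγj z hz (by omega)]
        have hBz : B[z]? = none := List.getElem?_eq_none (by omega)
        simpa [extEnv, closures, hBz, hzk, hlen] using this
    · have item : ∀ m N, B[m]? = some N → (it m = true ∨ ∃ z ∈ N.fv, bs' z = true) →
          ∃ z ∈ M.fv, (if z < k then
            decide (it z = true ∨ ∃ N, B[z]? = some N ∧ ∃ w ∈ N.fv, bs' w = true)
            else bs (z - k)) = true := by
        intro m N hN hmb
        have hm : m < k := by
          by_contra hc
          rw [List.getElem?_eq_none (by omega)] at hN
          simp at hN
        -- An element whose variable does not occur in `M` serves an idle session and cannot carry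
        -- success, so the carrier found here remains visible in the new state.
        have hmM : m ∈ M.fv := by
          by_contra hc
          have := (hit' m N hN).dead (by simpa [hc] using Dead.zero)
          simp only [decide_eq_false_iff_not] at this
          exact this hmb
        refine ⟨m, hmM, ?_⟩
        rw [if_pos hm]
        simp only [decide_eq_true_eq]
        exact hmb.imp id fun h => ⟨N, hN, h⟩
      rcases hb with h | h | h | ⟨z, hz, h⟩ | ⟨z, hz, h⟩
      · exact .inl h
      · obtain ⟨m, hm, h⟩ := hd h
        exact .inr (.inr (item m B[m] (List.getElem?_eq_getElem (by omega)) (.inl h)))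
      · exact .inr (.inl h)
      · exact .inr (.inr ⟨z + k, mem_down.1 hz, by simpa using h⟩)
      · obtain ⟨N, hN, hz⟩ := mem_fvBag.1 hz
        obtain ⟨m, hm, rfl⟩ := List.mem_iff_getElem.1 hN
        exact .inr (.inr (item m B[m] (List.getElem?_eq_getElem hm) (.inr ⟨z, hz, h⟩)))

-- Termination measure for machine states, and inversion of machine steps

/-- The size of a closure. -/
def Clo.size : Clo → ℕ
  | .none => 0
  | .mk N e => N.size + ∑ z ∈ N.fv, (e z).size

/-- The size of a stack. -/
def stackSize : Stack → ℕ
  | [] => 0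
  | (B, e) :: s => sizeBag B + ∑ z ∈ fvBag B, (e z).size + stackSize s

/-- The size of a state of the machine. -/
def stateSize (M : Term) (e : ℕ → Clo) (s : Stack) : ℕ :=
  M.size + ∑ z ∈ M.fv, (e z).size + stackSize s

/-- The elements have disjoint free variables, so no entry of the environment is counted in two
closures. Without affinity the measure could grow when a bag is turned into closures. -/
theorem sum_size_closures_le {B : Bag} (hB : OkBag B) (e : ℕ → Clo) :
    ((closures B e).map Clo.size).sum ≤ sizeBag B + ∑ z ∈ fvBag B, (e z).size := by
  induction B with
  | nil => simp [closures, sizeBag, fvBag]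
  | cons N B ih =>
    have := ih hB.2.1
    simp only [closures, List.map_cons, List.sum_cons, Clo.size, sizeBag, fvBag] at this ⊢
    rw [Finset.sum_union hB.2.2]
    omega

theorem sum_size_extEnv_le (V : Finset ℕ) (cs : List Clo) (e : ℕ → Clo) :
    ∑ z ∈ V, (extEnv cs e z).size ≤
      (cs.map Clo.size).sum + ∑ z ∈ down cs.length V, (e z).size := by
  rw [← Finset.sum_filter_add_sum_filter_not V (fun z => z < cs.length)]
  refine add_le_add ?_ (le_of_eq ?_)
  · calc ∑ z ∈ V with z < cs.length, (extEnv cs e z).size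
        ≤ ∑ z ∈ Finset.range cs.length, (extEnv cs e z).size :=
          Finset.sum_le_sum_of_subset fun z hz => by simpa using (Finset.mem_filter.1 hz).2
      _ = (cs.map Clo.size).sum := by
          rw [← Fin.sum_univ_eq_sum_range (fun z => (extEnv cs e z).size), ← List.sum_ofFn]
          congr 1
          refine List.ext_getElem (by simp) fun i h _ => ?_
          simp [extEnv]
  · rw [down, Finset.sum_image]
    · refine Finset.sum_congr (by ext; simp) fun z hz => ?_
      have : ¬ z < cs.length := (Finset.mem_filter.1 hz).2 |> not_lt.2
      simp [extEnv, List.getElem?_eq_none (not_lt.1 this)]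
    · intro i hi j hj h
      have hi := (Finset.mem_filter.1 hi).2
      have hj := (Finset.mem_filter.1 hj).2
      dsimp only at h
      omega

theorem Proc.Run.bigChoice : ∀ {l : List Proc} {γ : ℕ → Multiset Trace} {b : Bool}, l ≠ [] →
    (Proc.bigChoice l).Run γ b → ∃ P ∈ l, P.Run γ b
  | [], _, _, h, _ => absurd rfl h
  | [P], _, _, _, h => ⟨P, by simp, h⟩
  | P :: Q :: l, _, _, _, h => by
    rcases h with h | h
    · exact ⟨P, by simp, h⟩
    · obtain ⟨R, hR, h⟩ := Proc.Run.bigChoice (by simp) h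
      exact ⟨R, by simp_all, h⟩

/-- With at most one user on each side, balance at the restricted name means agreement of the two
runs there. At a name unknown to one side, the other side accounts for the whole contribution. -/
theorem Proc.Run.nuPar {P Q : Proc} {A B : ℕ → Prop} {γ : ℕ → Multiset Trace} {b : Bool}
    (h : (Proc.nu (.par P Q)).Run γ b) (hP : P.Affine A) (hQ : Q.Affine B) :
    ∃ γ₁ γ₂ b₁ b₂, P.Run γ₁ b₁ ∧ Q.Run γ₂ b₂ ∧ b = (b₁ || b₂) ∧ γ₁ 0 = γ₂ 0 ∧
      (∀ n, ¬ B (n + 1) → γ₁ (n + 1) = γ n) ∧ ∀ n, ¬ A (n + 1) → γ₂ (n + 1) = γ n := by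
  obtain ⟨α, hα, γ₁, γ₂, b₁, b₂, hsum, hb, h1, h2⟩ := h
  refine ⟨γ₁, γ₂, b₁, b₂, h1, h2, hb, ?_, fun n hn => ?_, fun n hn => ?_⟩
  · rw [show α = γ₁ 0 + γ₂ 0 from congrFun hsum 0] at hα
    exact hα.eq_of_card_le ((h1.card_le 0).trans (hP.2.1 0)) ((h2.card_le 0).trans (hQ.2.1 0))
  · have : γ n = γ₁ (n + 1) + γ₂ (n + 1) := congrFun hsum (n + 1)
    rw [this, h2.eq_zero (hQ.cnt_eq_zero hn), add_zero]
  · have : γ n = γ₁ (n + 1) + γ₂ (n + 1) := congrFun hsum (n + 1)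
    rw [this, h1.eq_zero (hP.cnt_eq_zero hn), zero_add]

theorem affine_frame {B : Bag} (hB : OkBag B) {ρ : ℕ → ℕ} {u : ℕ} (hρ : Set.InjOn ρ (fvBag B))
    (hu : ∀ z ∈ fvBag B, ρ z ≠ u) :
    (frame B ρ u).Affine fun n => n = 0 ∨ n = u + 1 ∨ ∃ z ∈ fvBag B, n = ρ z + 1 := by
  have h2 := affine_encBag_semBag (fun N hN => ((okBag_iff.1 hB).1 N hN).affine_enc) hB
    (ρ := fun j => ρ j + 2) (x := 0) (fun i hi j hj h => hρ hi hj (by simpa using h)) (by simp)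
  refine .some (.out (.par (A := fun n => n = 1 ∨ n = u + 2)
    (C := fun n => n = 0 ∨ n = 1 ∨ n = u + 2 ∨ ∃ z ∈ fvBag B, n = ρ z + 2)
    (.fwd (by omega) (.inl rfl) (.inr rfl)) h2 ?_ ?_ ?_) (.inl rfl) ?_) (.inl rfl) ?_
  · rintro n (rfl | rfl) (h | ⟨z, hz, h⟩)
    · simp at h
    · simp at h
    · simp at h
    · exact hu z hz (by simpa using h.symm)
  · grind
  · grind
  · grind
  · simp only [Finset.mem_insert, Finset.mem_image]; grind

/-- The first of the inversions of machine steps. The run is split at the outermost restriction,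
affinity decides which part owns the session at each free name, and success is assigned to whichever
of the term, the stack and the closures carries it. -/
theorem StateAns.app {M : Term} {B : Bag} {e : ℕ → Clo} {s : Stack}
    (h : StateAns (.app M B) e s) : ∃ B', B'.Perm B ∧ StateAns M e ((B', e) :: s) := by
  obtain ⟨⟨hM, hB, hd⟩, ρ, u, γ, b₀, b₁, bs, hρ, hu, hr, hs, he, hb⟩ := h
  simp only [Term.fv, Finset.coe_union] at hρ hu he hb
  obtain ⟨P, hP, hr⟩ := hr.bigChoice (by simp [← List.length_pos_iff, List.length_permutations,
    Nat.factorial_pos])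
  simp only [List.mem_map, mem_permutations_semBag] at hP
  obtain ⟨_, ⟨B', hB', rfl⟩, rfl⟩ := hP
  have hB2 : OkBag B' := hB.perm hB'.symm
  have hfv : fvBag B' = fvBag B := fvBag_perm hB'
  have h1 := hM.affine_enc (fun j => ρ j + 1) 0 (fun i hi j hj h => hρ (.inl hi) (.inl hj)
    (by simpa using h)) (by simp)
  have h2 := affine_frame hB2 (ρ := ρ) (u := u) (fun i hi j hj h => hρ (.inr (hfv ▸ hi))
    (.inr (hfv ▸ hj)) h) (fun z hz => hu z (Finset.mem_union_right _ (hfv ▸ hz)))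
  rw [← hfv] at hr
  obtain ⟨γ₁, γ₂, c₁, c₂, hr₁, hr₂, rfl, h0, hγ₁, hγ₂⟩ := hr.nuPar h1 h2
  have hfr : (frame B' ρ u).Run (consUse (γ₁ 0) fun i => γ₂ (i + 1)) c₂ := by
    rw [h0, consUse_head_tail]; exact hr₂
  refine ⟨B', hB', hM, _, _, γ₁, c₁, c₂ || b₁ || decide (∃ z ∈ fvBag B, bs z = true), bs,
    fun i hi j hj h => hρ (.inl hi) (.inl hj) (by simpa using h), by simp, hr₁,
    ⟨hB2, ρ, u, _, c₂, b₁, bs, fun i hi j hj h => hρ (.inr (hfv ▸ hi)) (.inr (hfv ▸ hj)) h,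
      fun z hz => hu z (Finset.mem_union_right _ (hfv ▸ hz)), hfr, ?_, fun z hz => ?_, ?_⟩,
    fun z hz => ?_, ?_⟩
  · rw [hγ₂ u]
    · exact hs
    · rintro (h | ⟨z, hz, h⟩)
      · simp at h
      · exact hu z (Finset.mem_union_left _ hz) (by omega)
  · rw [hfv] at hz
    rw [hγ₂ (ρ z)]
    · exact he z (Finset.mem_union_right _ hz)
    · rintro (h | ⟨z', hz', h⟩)
      · simp at h
      · have := hρ (.inl hz') (.inr hz) (by omega)
        exact Finset.disjoint_left.1 hd hz' (this ▸ hz)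
  · rw [hfv]
    simp only [Bool.or_eq_true, decide_eq_true_eq, or_assoc, imp_self]
  · rw [hγ₁ (ρ z)]
    · exact he z (Finset.mem_union_left _ hz)
    · rintro (h | h | ⟨z', hz', h⟩)
      · simp at h
      · exact hu z (Finset.mem_union_left _ hz) (by omega)
      · have := hρ (.inl hz) (.inr (hfv ▸ hz')) (by omega)
        exact Finset.disjoint_left.1 hd hz (this ▸ hfv ▸ hz')
  · simp only [Bool.or_eq_true, decide_eq_true_eq, or_assoc] at hb ⊢
    rcases hb with h | h | h | ⟨z, hz, h⟩
    · exact .inl h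
    · exact .inr (.inl h)
    · exact .inr (.inr (.inl h))
    · rcases Finset.mem_union.1 hz with hz | hz
      · exact .inr (.inr (.inr (.inr ⟨z, hz, h⟩)))
      · exact .inr (.inr (.inr (.inl ⟨z, hz, h⟩)))

theorem StateAns.lsub {M N : Term} {e : ℕ → Clo} {s : Stack} (h : StateAns (.lsub M N) e s) :
    StateAns M (extEnv [.mk N e] e) s := by
  obtain ⟨⟨hM, hN, hd⟩, ρ, u, γ, b₀, b₁, bs, hρ, hu, hr, hs, he, hb⟩ := h
  simp only [Term.fv, Finset.coe_union] at hρ hu he hb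
  have hρ₁ : Set.InjOn (liftN 1 ρ) M.fv := fun i hi j hj h => by
    rcases i with - | i <;> rcases j with - | j <;> simp [liftN_one_zero, liftN_one_succ] at h ⊢
    exact hρ (.inl (mem_down.2 hi)) (.inl (mem_down.2 hj)) h
  have hu₁ : ∀ z ∈ M.fv, liftN 1 ρ z ≠ u + 1 := fun i hi => by
    rcases i with - | i <;> simp [liftN_one_zero, liftN_one_succ]
    exact hu i (Finset.mem_union_left _ (mem_down.2 hi))
  have hρ₂ : Set.InjOn (fun j => ρ j + 1) N.fv := fun i hi j hj h =>
    hρ (.inr hi) (.inr hj) (by simpa using h)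
  have h1 := hM.affine_enc _ _ hρ₁ hu₁
  have h2 := (hN.affine_enc _ 0 hρ₂ (by simp)).some (x := 0) (W := N.fv.image fun j => ρ j + 1)
    (.inl rfl) (by simp only [Finset.mem_image]; grind)
  obtain ⟨γ₁, γ₂, c₁, c₂, hr₁, hr₂, rfl, h0, hγ₁, hγ₂⟩ := hr.nuPar h1 h2
  have hA : (Clo.mk N e).Ans (γ₁ 0) (c₂ || decide (∃ z ∈ N.fv, bs z = true)) := by
    refine ⟨hN, _, 0, γ₂, c₂, bs, hρ₂, by simp, hr₂, h0.symm, fun z hz => ?_, by simp⟩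
    rw [hγ₂ (ρ z)]
    · exact he z (Finset.mem_union_right _ hz)
    · rintro (h | ⟨z', hz', h⟩)
      · exact hu z (Finset.mem_union_right _ hz) (by omega)
      · rcases z' with - | z'
        · simp [liftN_one_zero] at h
        · have := hρ (.inl (mem_down.2 hz')) (.inr hz) (by rw [liftN_one_succ] at h; omega)
          exact Finset.disjoint_left.1 hd (mem_down.2 hz') (this ▸ hz)
  refine ⟨hM, _, _, γ₁, c₁, b₁,
    fun z => if z = 0 then c₂ || decide (∃ z ∈ N.fv, bs z = true) else bs (z - 1), hρ₁, hu₁, hr₁,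
    ?_, fun z hz => ?_, ?_⟩
  · rw [hγ₁ u]
    · exact hs
    · rintro (h | ⟨z, hz, h⟩)
      · simp at h
      · exact hu z (Finset.mem_union_right _ hz) (by omega)
  · rcases z with - | z
    · exact hA
    · rw [liftN_one_succ, extEnv_one_succ, hγ₁ (ρ z)]
      · exact he z (Finset.mem_union_left _ (mem_down.2 hz))
      · rintro (h | ⟨z', hz', h⟩)
        · simp at h
        · have := hρ (.inl (mem_down.2 hz)) (.inr hz') (by omega)
          exact Finset.disjoint_left.1 hd (mem_down.2 hz) (this ▸ hz')
  · have item : (c₂ = true ∨ ∃ z ∈ N.fv, bs z = true) → ∃ z ∈ M.fv,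
        (if z = 0 then c₂ || decide (∃ z ∈ N.fv, bs z = true) else bs (z - 1)) = true := by
      intro h
      have h0M : 0 ∈ M.fv := by
        by_contra hc
        have := hA.dead (.inl (hr₁.eq_zero (h1.cnt_eq_zero (by
          rintro (h | ⟨z, hz, h⟩)
          · simp at h
          · rcases z with - | z
            · exact hc hz
            · simp [liftN_one_succ] at h))))
        simp only [Bool.or_eq_false_iff, decide_eq_false_iff_not] at this
        rcases h with h | h
        · simp [this.1] at h
        · exact this.2 h
      exact ⟨0, h0M, by simpa using h⟩
    simp only [Bool.or_eq_true, or_assoc] at hb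
    rcases hb with h | h | h | ⟨z, hz, h⟩
    · exact .inl h
    · exact .inr (.inr (item (.inl h)))
    · exact .inr (.inl h)
    · rcases Finset.mem_union.1 hz with hz | hz
      · exact .inr (.inr ⟨z + 1, mem_down.1 hz, by simpa using h⟩)
      · exact .inr (.inr (item (.inr ⟨z, hz, h⟩)))

theorem StateAns.esub {k : ℕ} {M : Term} {B : Bag} {e : ℕ → Clo} {s : Stack}
    (h : StateAns (.esub k M B) e s) :
    ∃ B', B'.Perm B ∧ B'.length = k ∧ StateAns M (extEnv (closures B' e) e) s := by
  obtain ⟨⟨hM, hB, hd⟩, ρ, u, γ, b₀, b₁, bs, hρ, hu, hr, hs, he, hb⟩ := h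
  simp only [Term.fv, Finset.coe_union] at hρ hu he hb
  obtain ⟨P, hP, hr⟩ := hr.bigChoice (by simp [← List.length_pos_iff, List.length_permutations,
    Nat.factorial_pos])
  simp only [List.mem_map, mem_permutations_semBag] at hP
  obtain ⟨_, ⟨B', hB', rfl⟩, rfl⟩ := hP
  have hB2 : OkBag B' := hB.perm hB'.symm
  have hfv : fvBag B' = fvBag B := fvBag_perm hB'
  have hρ₁ : Set.InjOn (fun j => ρ j + 1) (down k M.fv) := fun i hi j hj h =>
    hρ (.inl hi) (.inl hj) (by simpa using h)
  have hρ₂ : Set.InjOn (fun j => ρ j + 1) (fvBag B') := fun i hi j hj h =>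
    hρ (.inr (hfv ▸ hi)) (.inr (hfv ▸ hj)) (by simpa using h)
  have hu₁ : ∀ z ∈ down k M.fv, ρ z + 1 ≠ u + 1 := fun j hj => by
    simpa using hu j (Finset.mem_union_left _ hj)
  have h1 := hM.affine_enc.encShare (x := 0) (u := u + 1) hρ₁ (by simp) hu₁ (by simp)
  have h2 := affine_encBag_semBag (fun N hN => ((okBag_iff.1 hB2).1 N hN).affine_enc) hB2 (x := 0)
    hρ₂ (by simp)
  obtain ⟨γ₁, γ₂, c₁, c₂, hr₁, hr₂, rfl, h0, hγ₁, hγ₂⟩ := hr.nuPar h1 h2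
  refine ⟨B', hB', StateAns.of_share (bs := bs) (bs' := bs) (b₁ := b₁) hM hB2 hρ₁ (by simp) hu₁
    (by simp) hρ₂ (by simp) hr₁ hr₂ h0 (fun z hz => ?_) (fun z hz => ?_) ?_ ?_⟩
  · rw [hγ₁ (ρ z)]
    · exact he z (Finset.mem_union_left _ hz)
    · rintro (h | ⟨z', hz', h⟩)
      · simp at h
      · have := hρ (.inl hz) (.inr (hfv ▸ hz')) (by omega)
        exact Finset.disjoint_left.1 hd hz (this ▸ hfv ▸ hz')
  · rw [hfv] at hz
    rw [hγ₂ (ρ z)]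
    · exact he z (Finset.mem_union_right _ hz)
    · rintro (h | h | ⟨z', hz', h⟩)
      · simp at h
      · exact hu z (Finset.mem_union_right _ hz) (by omega)
      · have := hρ (.inl hz') (.inr hz) (by omega)
        exact Finset.disjoint_left.1 hd hz' (this ▸ hz)
  · rw [hγ₁ u]
    · exact hs
    · rintro (h | ⟨z, hz, h⟩)
      · simp at h
      · exact hu z (Finset.mem_union_right _ (hfv ▸ hz)) (by omega)
  · rw [hfv]
    simp only [Bool.or_eq_true, or_assoc] at hb
    rcases hb with h | h | h | ⟨z, hz, h⟩
    · exact .inl h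
    · exact .inr (.inl h)
    · exact .inr (.inr (.inl h))
    · rcases Finset.mem_union.1 hz with hz | hz
      · exact .inr (.inr (.inr (.inl ⟨z, hz, h⟩)))
      · exact .inr (.inr (.inr (.inr ⟨z, hz, h⟩)))

/-- An abstraction waits at `u` for an argument, and an empty stack contributes nothing there; then
all sessions are idle, against success. With a frame on the stack, the guard and the communication
are matched, and the forwarder of the frame shows the same trace `t` at `u` and at `v`, so the body
takes over the session with the rest of the stack. -/
theorem StateAns.lam {k : ℕ} {M : Term} {e : ℕ → Clo} {s : Stack} (h : StateAns (.lam k M) e s) :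
    ∃ B e' s', s = (B, e') :: s' ∧ OkBag B ∧ B.length = k ∧
      StateAns M (extEnv (closures B e') e) s' := by
  obtain ⟨hM, ρ, u, γ, b₀, b₁, bs, hρ, hu, hr, hs, he, hb⟩ := h
  have idle : γ = 0 → b₀ = false → b₁ = false → False := by
    rintro rfl rfl rfl
    rcases hb with h | h | ⟨z, hz, h⟩
    · simp at h
    · simp at h
    · rw [(he z hz).dead .zero] at h
      simp at h
  rcases s with - | ⟨⟨B, e'⟩, s⟩
  · exfalso
    obtain ⟨h0, hb₁⟩ := hs
    rcases hr with ⟨h1, h2⟩ | ⟨c, γ', -, -, rfl⟩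
    · exact idle h1 h2 hb₁
    · simp at h0
  obtain ⟨hB, σ, v, δ, d₀, d₁, bs', hσ, hv, hfr, hs, he', hd⟩ := hs
  have dead : γ u = 0 → γ = 0 → b₀ = false → consUse (γ u) δ = 0 → d₀ = false → False := by
    intro h0 h1 h2 h3 h4
    have hδ : δ = 0 := by
      funext n
      exact congrFun h3 (n + 1)
    refine idle h1 h2 ?_
    by_contra hc
    rcases hd (by simpa using hc) with h | h | ⟨z, hz, h⟩
    · simp [h4] at h
    · rw [hs.dead (.inl (by simp [hδ]))] at h
      simp at h
    · rw [(he' z hz).dead (.inl (by simp [hδ]))] at h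
      simp at h
  refine ⟨B, e', s, rfl, hB, ?_⟩
  rcases hr.some_match hfr rfl with ⟨h1, h3, h2, h4⟩ | ⟨γ₁, δ₁, hr, hfr, h, hγ₁, hδ₁⟩
  · exact (dead (by rw [h1]; rfl) h1 h2 h3 h4).elim
  rcases hfr.comm_match hr h.symm with ⟨rfl, rfl, hd₀, hb₀⟩ | ⟨δ₂, γ₂, α, hfr, hr, h, hδ₂, hγ₂⟩
  · exfalso
    rcases hb with h | h | ⟨z, hz, h⟩
    · simp [hb₀] at h
    · rcases hd h with h | h | ⟨z, hz, h⟩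
      · simp [hd₀] at h
      · rw [hs.dead (.inl (by simpa [consUse] using hδ₁ (v + 1) (by simp)))] at h
        simp at h
      · rw [(he' z hz).dead (.inl (by simpa [consUse] using hδ₁ (σ z + 1) (by simp)))] at h
        simp at h
    · rw [(he z hz).dead (.inl (by simpa using hγ₁ (ρ z) (hu z hz)))] at h
      simp at h
  obtain ⟨δF, δB, dF, dB, hsum, rfl, hF, hBr⟩ := hfr
  obtain ⟨rfl, t, rfl⟩ := hF
  have hσ₂ : Set.InjOn (fun j => σ j + 2) (fvBag B) := fun i hi j hj h =>
    hσ hi hj (by simpa using h)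
  have hBz : ∀ n, ¬ (n = 0 ∨ ∃ j ∈ fvBag B, n = σ j + 2) → δB n = 0 := fun n hn =>
    hBr.eq_zero ((affine_encBag_semBag (fun N hN => ((okBag_iff.1 hB).1 N hN).affine_enc) hB
      (x := 0) hσ₂ (by simp)).cnt_eq_zero hn)
  have hδ : ∀ n, δ n = δ₂ (n + 1) := fun n =>
    (hδ₁ (n + 1) (by simp)).trans (hδ₂ (n + 1) (by simp))
  have hγ : ∀ n, n ≠ u → γ n = γ₂ n := fun n hn => (hγ₁ n hn).trans (hγ₂ n hn)
  have hα : α = δB 0 := by simpa [consUse] using congrFun hsum 0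
  have ht : δ₂ 0 = sess t := by
    simpa [consUse, hBz 1 (by simp)] using congrFun hsum 1
  have ht' : δ v = sess t := by
    have hv' : δB (v + 2) = 0 := hBz _ (by
      rintro (h | ⟨z, hz, h⟩)
      · simp at h
      · exact hv z hz (by simpa using h.symm))
    rw [hδ]
    simpa [consUse, hv'] using congrFun hsum (v + 2)
  have hδB : ∀ z ∈ fvBag B, δB (σ z + 2) = δ (σ z) := fun z hz => by
    rw [hδ]
    simpa [consUse, hv z hz] using (congrFun hsum (σ z + 2)).symm
  refine StateAns.of_share (k := k) (M := M) (u := u + 1) (bs := bs) (bs' := bs') (b₁ := d₁) hM hB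
    (fun i hi j hj h => hρ hi hj (by simpa using h)) (by simp)
    (fun z hz => by simpa using hu z hz) (by simp) hσ₂ (by simp) hr hBr hα
    (fun z hz => ?_) (fun z hz => ?_) ?_ ?_
  · change (e z).Ans (γ₂ (ρ z)) (bs z)
    rw [← hγ _ (hu z hz)]
    exact he z hz
  · rw [hδB z hz]
    exact he' z hz
  · change StackAns s (γ₂ u) d₁
    rw [← h, ht, ← ht']
    exact hs
  · rcases hb with h | h | h
    · exact .inl h
    · rcases hd h with h | h | h
      · exact .inr (.inl (by simpa using h))
      · exact .inr (.inr (.inl h))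
      · exact .inr (.inr (.inr (.inr h)))
    · exact .inr (.inr (.inr (.inl h)))

/-- The variable unlocks the guard of its closure. The forwarder then shows the same trace at the
name of the closure and at `u`, so the term of the closure answers the stack directly. -/
theorem StateAns.var {x : ℕ} {e : ℕ → Clo} {s : Stack} (h : StateAns (.var x) e s) :
    ∃ N e', e x = .mk N e' ∧ StateAns N e' s := by
  obtain ⟨-, ρ, u, γ, b₀, b₁, bs, -, hu, hr, hs, he, hb⟩ := h
  have hx : x ∈ (Term.var x).fv := by simp [Term.fv]
  have hex := he x hx
  have hux := hu x hx
  cases hc : e x with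
  | none => rw [hc] at hex; exact hex.elim
  | mk N e' =>
    refine ⟨N, e', rfl, ?_⟩
    have hex' := hex
    rw [hc] at hex'
    obtain ⟨hN, σ, y, δ, d₀, bs', hσ, hy, hN', hδ, he', hd⟩ := hex'
    rcases hr.some_match hN' hδ.symm with ⟨rfl, rfl, rfl, rfl⟩ | ⟨γ₁, δ₁, hr, hN', h, hγ₁, hδ₁⟩
    · exfalso
      rcases hb with h | h | ⟨z, hz, h⟩
      · simp at h
      · rw [hs.dead .zero] at h
        simp at h
      · rw [(he z hz).dead .zero] at h
        simp at h
    · obtain ⟨rfl, t, rfl⟩ := hr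
      have h1 : δ₁ y = sess t := by
        rw [← h]
        simp [hux]
      have h2 : γ u = sess t := by
        rw [hγ₁ u hux.symm]
        simp [hux]
      refine ⟨hN, σ, y, δ₁, d₀, b₁, bs', hσ, hy, hN', by rwa [h1, ← h2], fun z hz => ?_, ?_⟩
      · rw [← hδ₁ _ (hy z hz)]
        exact he' z hz
      · rcases hb with hb | hb | ⟨z, hz, hb⟩
        · simp at hb
        · exact .inr (.inl hb)
        · simp only [Term.fv, Finset.mem_singleton] at hz
          subst hz
          rcases hd hb with h | h
          · exact .inl h
          · exact .inr (.inr h)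

theorem not_stateAns_fail {S : Finset ℕ} {e : ℕ → Clo} {s : Stack} :
    ¬ StateAns (.fail S) e s := by
  rintro ⟨-, ρ, u, γ, b₀, b₁, bs, hρ, hu, hr, hs, he, hb⟩
  obtain ⟨γ₁, γ₂, c₁, c₂, rfl, rfl, h1, h2⟩ := hr
  obtain ⟨rfl, hd, h1'⟩ := h1.noneBar_dead
  obtain ⟨rfl, h3⟩ := h2.noneAll
  have h2' : ∀ n, Dead (γ₂ n) := fun n => (h3 n).imp id fun h => h.2
  rcases hb with h | h | ⟨z, hz, h⟩
  · simp at h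
  · have : γ₂ u = 0 := by
      refine (h3 u).resolve_right ?_
      rintro ⟨h, -⟩
      obtain ⟨z, hz, h⟩ := Finset.mem_image.1 h
      exact hu z hz h
    rw [hs.dead (by simpa [this] using hd)] at h
    simp at h
  · rw [(he z hz).dead (by simpa [h1' _ (hu z hz)] using h2' _)] at h
    simp at h

/-- Induction on the total size of the state: every transition consumes a node, and by affinity
closures are distributed, never duplicated. Which transition comes next is forced by the preceding
inversions. The machine stops as soon as ✓ is the current term, so it need not be known which
component of the run reached ✓. -/
theorem StateAns.eval {M : Term} {e : ℕ → Clo} {s : Stack} (h : StateAns M e s) : Eval M e s := by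
  induction hn : stateSize M e s using Nat.strong_induction_on generalizing M e s with
  | _ n ih =>
    subst hn
    cases M with
    | var x =>
      obtain ⟨N, e', hx, h⟩ := h.var
      refine .var x e s N e' hx (ih _ ?_ h rfl)
      simp only [stateSize, Term.size, Term.fv, Finset.sum_singleton, hx, Clo.size]
      omega
    | lam k M =>
      obtain ⟨B, e', s, rfl, hB, rfl, h'⟩ := h.lam
      refine .lam _ M B e e' s rfl (ih _ ?_ h' rfl)
      have h1 := sum_size_extEnv_le M.fv (closures B e') e
      have h2 := sum_size_closures_le hB e'
      rw [length_closures] at h1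
      simp only [stateSize, stackSize, Term.size, Term.fv]
      omega
    | app M B =>
      have hd := h.1.2.2
      obtain ⟨B', hB', h⟩ := h.app
      refine .app M B B' e s hB' (ih _ ?_ h rfl)
      simp only [stateSize, stackSize, Term.size, Term.fv, Finset.sum_union hd, fvBag_perm hB',
        sizeBag_perm hB']
      omega
    | lsub M N =>
      have hd := h.1.2.2
      refine .lsub M N e s (ih _ ?_ h.lsub rfl)
      have h1 := sum_size_extEnv_le M.fv [.mk N e] e
      simp only [List.map_cons, List.map_nil, List.sum_cons, List.sum_nil, List.length_cons,
        List.length_nil, Clo.size, zero_add] at h1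
      simp only [stateSize, Term.size, Term.fv, Finset.sum_union hd]
      omega
    | fail S => exact (not_stateAns_fail h).elim
    | share k M x => exact h.1.elim
    | esub k M B =>
      have hd := h.1.2.2
      have hB := h.1.2.1
      obtain ⟨B', hB', rfl, h'⟩ := h.esub
      refine .esub _ M B B' e s hB' rfl (ih _ ?_ h' rfl)
      have h1 := sum_size_extEnv_le M.fv (closures B' e) e
      have h2 := sum_size_closures_le (hB.perm hB'.symm) e
      rw [length_closures] at h1
      rw [fvBag_perm hB', sizeBag_perm hB'] at h2
      simp only [stateSize, Term.size, Term.fv, Finset.sum_union hd]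
      omega
    | tick => exact .tick e s

end SharingPi


namespace SharingPi

/-! ### Structural congruence and reduction under renaming -/

theorem Proc.Cong.noneList_perm {l l' : List ℕ} (h : l.Perm l') :
    (Proc.noneList l).Cong (Proc.noneList l') := by
  induction h with
  | nil => exact .refl _
  | cons x _ ih => exact .par _ _ _ _ (.refl _) ih
  | swap x y l =>
    exact .trans _ _ _ (.symm _ _ (.parAssoc _ _ _))
      (.trans _ _ _ (.par _ _ _ _ (.parComm _ _) (.refl _)) (.parAssoc _ _ _))
  | trans _ _ ih1 ih2 => exact .trans _ _ _ ih1 ih2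

theorem Proc.rename_noneList (f : ℕ → ℕ) (l : List ℕ) :
    (Proc.noneList l).rename f = Proc.noneList (l.map f) := by
  induction l with
  | nil => rfl
  | cons x l ih => simp [Proc.noneList, Proc.rename, ih]

theorem Proc.Cong.rename_noneAll {f : ℕ → ℕ} {W : Finset ℕ} (hf : Set.InjOn f W) :
    ((Proc.noneAll W).rename f).Cong (Proc.noneAll (W.image f)) := by
  rw [Proc.noneAll, Proc.rename_noneList, Proc.noneAll]
  refine .noneList_perm ((List.perm_ext_iff_of_nodup ?_ (Finset.sort_nodup _ _)).2 fun a => by simp)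
  exact (Finset.sort_nodup _ _).map_on fun x hx y hy h => hf (by simpa using hx) (by simpa using hy) h

theorem Proc.rename_shift (f : ℕ → ℕ) (P : Proc) :
    P.shift.rename (liftN 1 f) = (P.rename f).shift := by
  simp only [Proc.shift, Proc.rename_rename]
  exact congrArg (P.rename ·) (funext fun i => liftN_one_succ f i)

theorem liftN_comp_blockSwap (f : ℕ → ℕ) :
    liftN 1 (liftN 1 f) ∘ blockSwap 1 1 = blockSwap 1 1 ∘ liftN 1 (liftN 1 f) := by
  funext i
  rcases i with - | - | i
  · simp [blockSwap, liftN]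
  · simp [blockSwap, liftN]
  · simp [blockSwap, liftN]

theorem Proc.Cong.rename {P Q : Proc} (h : P.Cong Q) : ∀ f, (P.rename f).Cong (Q.rename f) := by
  induction h with
  | refl => exact fun _ => .refl _
  | symm _ _ _ ih => exact fun f => .symm _ _ (ih f)
  | trans _ _ _ _ _ ih1 ih2 => exact fun f => .trans _ _ _ (ih1 f) (ih2 f)
  | out _ _ _ _ ih => exact fun f => .out _ _ _ (ih _)
  | inp _ _ _ _ ih => exact fun f => .inp _ _ _ (ih _)
  | par _ _ _ _ _ _ ih1 ih2 => exact fun f => .par _ _ _ _ (ih1 f) (ih2 f)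
  | nu _ _ _ ih => exact fun f => .nu _ _ (ih _)
  | close _ _ _ _ ih => exact fun f => .close _ _ _ (ih f)
  | someBar _ _ _ _ ih => exact fun f => .someBar _ _ _ (ih f)
  | some _ _ _ _ _ ih => exact fun f => .some _ _ _ _ (ih f)
  | choice _ _ _ _ _ _ ih1 ih2 => exact fun f => .choice _ _ _ _ (ih1 f) (ih2 f)
  | parNil => exact fun f => .parNil _
  | parComm => exact fun f => .parComm _ _
  | parAssoc => exact fun f => .parAssoc _ _ _
  | fwdComm => exact fun f => .fwdComm _ _
  | extrude P Q =>
    intro f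
    simp only [Proc.rename, Proc.rename_shift]
    exact .extrude _ _
  | distrib => exact fun f => .distrib _ _ _
  | choiceNil => exact fun f => .choiceNil
  | choiceComm => exact fun f => .choiceComm _ _
  | choiceAssoc => exact fun f => .choiceAssoc _ _ _
  | nuNil => exact fun f => .nuNil
  | nuNu P =>
    intro f
    simp only [Proc.rename, Proc.rename_rename, liftN_comp_blockSwap]
    rw [← Proc.rename_rename]
    exact .nuNu _

/-- Injectivity is needed for failure, where one `none` is emitted for each name of a set:
identifying two names would make one of them disappear from the image of the set. -/
theorem Proc.Red.rename {P Q : Proc} (h : P.Red Q) :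
    ∀ {f : ℕ → ℕ}, f.Injective → (P.rename f).Red (Q.rename f) := by
  induction h with
  | comm => exact fun _ => .comm _ _ _
  | forw y P =>
    intro f _
    simp only [Proc.rename, liftN_one_zero, liftN_one_succ]
    convert Proc.Red.forw (f y) (P.rename (liftN 1 f)) using 1
    simp only [Proc.inst, Proc.rename_rename]
    congr 1
    funext i
    rcases i with - | i
    · simp [liftN_one_zero]
    · simp [liftN_one_succ]
  | close => exact fun _ => .close _ _
  | some => exact fun _ => .some _ _ _ _
  | none x W Q =>
    exact fun hf => .cong _ _ _ _ (.refl _) (.none _ _ _)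
      (.symm _ _ (.rename_noneAll hf.injOn))
  | cong _ _ _ _ h1 _ h2 ih => exact fun hf => .cong _ _ _ _ (h1.rename _) (ih hf) (h2.rename _)
  | par _ _ _ _ ih => exact fun hf => .par _ _ _ (ih hf)
  | nu _ _ _ ih => exact fun hf => .nu _ _ (ih (liftN_injective hf 1))
  | choice _ _ _ _ ih => exact fun hf => .choice _ _ _ (ih hf)

theorem Proc.unguarded_rename (f : ℕ → ℕ) (P : Proc) : (P.rename f).Unguarded ↔ P.Unguarded := by
  induction P generalizing f <;> simp_all [Proc.rename, Proc.Unguarded]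

theorem Proc.Cong.unguarded_iff {P Q : Proc} (h : P.Cong Q) : P.Unguarded ↔ Q.Unguarded := by
  induction h with
  | symm _ _ _ ih => exact ih.symm
  | trans _ _ _ _ _ ih1 ih2 => exact ih1.trans ih2
  | _ => simp_all [Proc.Unguarded, Proc.shift, Proc.unguarded_rename] <;> tauto

theorem Proc.Success.of_cong {P Q : Proc} (hQ : Q.Success) (h : P.Cong Q) : P.Success := by
  obtain ⟨R, hR, hu⟩ := hQ
  rcases Relation.ReflTransGen.cases_head hR with rfl | ⟨Q', h1, h2⟩
  · exact ⟨P, .refl, h.unguarded_iff.2 hu⟩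
  · exact ⟨R, .head (.cong _ _ _ _ h h1 (.refl _)) h2, hu⟩

theorem Proc.Success.of_red {P Q : Proc} (hQ : Q.Success) (h : P.Red Q) : P.Success := by
  obtain ⟨R, hR, hu⟩ := hQ
  exact ⟨R, .head h hR, hu⟩

theorem Proc.Success.choice_right {P Q : Proc} (hQ : Q.Success) : (Proc.choice P Q).Success := by
  obtain ⟨R, hR, hu⟩ := hQ
  exact ⟨.choice P R, Relation.ReflTransGen.lift (p := Proc.Red) (Proc.choice P)
    (fun _ _ h => Proc.Red.choice _ _ _ h) _ _ hR, .inr hu⟩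

theorem Proc.Success.choice_left {P Q : Proc} (hP : P.Success) : (Proc.choice P Q).Success :=
  (hP.choice_right (P := Q)).of_cong (.choiceComm _ _)

/-! ### Restriction of a given name -/

/-- Make the name `x` the innermost one. -/
def abstr (x i : ℕ) : ℕ := if i = x then 0 else i + 1

theorem abstr_injective (x : ℕ) : Function.Injective (abstr x) := by
  intro i j h
  simp only [abstr] at h
  split_ifs at h <;> omega

/-- Restriction of the free name `x`. -/
def Proc.res (x : ℕ) (P : Proc) : Proc := .nu (P.rename (abstr x))

theorem Proc.cnt_res (x : ℕ) (P : Proc) (n : ℕ) :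
    (P.res x).cnt n = if n = x then 0 else P.cnt n := by
  simp only [Proc.res, Proc.cnt]
  split_ifs with h
  · refine Proc.cnt_rename_of_not_mem fun i hi => ?_
    simp only [abstr] at hi
    split_ifs at hi
    omega
  · have : n + 1 = abstr x n := by simp [abstr, h]
    rw [this]
    exact Proc.cnt_rename_of_unique fun j hj => abstr_injective x hj

theorem Proc.lin_res {x : ℕ} {P : Proc} : (P.res x).Lin ↔ P.cnt x ≤ 2 ∧ P.Lin := by
  have : (P.rename (abstr x)).cnt (abstr x x) = P.cnt x :=
    Proc.cnt_rename_of_unique fun j hj => abstr_injective x hj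
  simp only [abstr, if_true] at this
  simp only [Proc.res, Proc.Lin, Proc.lin_rename]
  rw [show (P.rename (abstr x)).cnt 0 = P.cnt x from this]

theorem Proc.Cong.res {P Q : Proc} (h : P.Cong Q) (x : ℕ) : (P.res x).Cong (Q.res x) :=
  .nu _ _ (h.rename _)

theorem Proc.Red.res {P Q : Proc} (h : P.Red Q) (x : ℕ) : (P.res x).Red (Q.res x) :=
  .nu _ _ (h.rename (abstr_injective x))

/-- Anonymous restrictions are replaced by restrictions of concrete fresh names, so that a process
can be handled as a flat list of components with free names below a list of restrictions. -/
theorem Proc.nu_eq_res {P : Proc} {x : ℕ} (h : P.cnt (x + 1) = 0) : .nu P = (P.inst x).res x := by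
  rw [Proc.res, Proc.inst, Proc.rename_rename, Proc.rename_eq_self]
  intro i hi
  rcases i with - | i
  · simp [abstr]
  · have : i ≠ x := by rintro rfl; exact hi h
    simp [abstr, this]

theorem Proc.rename_abstr {P : Proc} {x : ℕ} (h : P.cnt x = 0) : P.rename (abstr x) = P.shift := by
  refine Proc.rename_congr fun i hi => ?_
  have : i ≠ x := by rintro rfl; exact hi h
  simp [abstr, this]

/-- A vacuous restriction is narrowed to `0` by extrusion read backwards, and removed there. -/
theorem Proc.Cong.nu_shift (P : Proc) : (Proc.nu P.shift).Cong P :=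
  .trans _ _ _ (.nu _ _ (.trans _ _ _ (.symm _ _ (.parNil _)) (.parComm _ _)))
    (.trans _ _ _ (.symm _ _ (.extrude .nil P)) (.trans _ _ _ (.parComm _ _)
      (.trans _ _ _ (.par _ _ _ _ (.refl _) .nuNil) (.parNil _))))

theorem Proc.Cong.res_of_cnt {P : Proc} {x : ℕ} (h : P.cnt x = 0) : (P.res x).Cong P := by
  rw [Proc.res, Proc.rename_abstr h]
  exact .nu_shift P

theorem Proc.Cong.extrude_res {P Q : Proc} {x : ℕ} (h : Q.cnt x = 0) :
    (Proc.par (P.res x) Q).Cong ((Proc.par P Q).res x) := by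
  rw [Proc.res, Proc.res, Proc.rename, Proc.rename_abstr h]
  exact .extrude _ _

theorem Proc.Cong.res_res (P : Proc) (x y : ℕ) : ((P.res x).res y).Cong ((P.res y).res x) := by
  by_cases hxy : x = y
  · rw [hxy]; exact .refl _
  simp only [Proc.res, Proc.rename, Proc.rename_rename]
  have : liftN 1 (abstr x) ∘ abstr y = blockSwap 1 1 ∘ liftN 1 (abstr y) ∘ abstr x := by
    funext i
    simp only [Function.comp, abstr, liftN, blockSwap]
    grind
  have h := Proc.Cong.nuNu (P.rename (liftN 1 (abstr y) ∘ abstr x))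
  rw [Proc.rename_rename] at h
  rw [this]
  exact h

theorem Proc.Red.res_fwd {P : Proc} {x y : ℕ} (hxy : x ≠ y) :
    ((Proc.par (.fwd x y) P).res x).Red (P.rename fun i => if i = x then y else i) := by
  have h1 : (Proc.par (.fwd x y) P).res x = .nu (.par (.fwd 0 (y + 1)) (P.rename (abstr x))) := by
    simp [Proc.res, Proc.rename, abstr, hxy.symm]
  rw [h1]
  convert Proc.Red.forw y (P.rename (abstr x)) using 1
  rw [Proc.inst, Proc.rename_rename]
  congr 1
  funext i
  by_cases h : i = x <;> simp [abstr, h]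

theorem Proc.Cong.nu_choice (P Q : Proc) :
    (Proc.nu (.choice P Q)).Cong (.choice (.nu P) (.nu Q)) := by
  have h : ∀ R : Proc, R.Cong (.par .nil R) := fun R =>
    .trans _ _ _ (.symm _ _ (.parNil _)) (.parComm _ _)
  exact .trans _ _ _ (.nu _ _ (h _)) (.trans _ _ _ (.distrib _ _ _)
    (.choice _ _ _ _ (.nu _ _ (.symm _ _ (h _))) (.nu _ _ (.symm _ _ (h _)))))

/-- The law that distributes parallel composition over choice is available only below a restriction;
a vacuous one is introduced for this purpose and removed from both branches. -/
theorem Proc.Cong.par_choice (P Q R : Proc) :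
    (Proc.par R (.choice P Q)).Cong (.choice (.par R P) (.par R Q)) :=
  .trans _ _ _ (.symm _ _ (.nu_shift _)) (.trans _ _ _ (.distrib R.shift P.shift Q.shift)
    (.choice _ _ _ _ (.nu_shift (.par R P)) (.nu_shift (.par R Q))))

theorem Proc.exists_fresh (P : Proc) : ∃ k, ∀ n, k ≤ n → P.cnt n = 0 := by
  induction P with
  | nil | tick => exact ⟨0, fun _ _ => rfl⟩
  | out x P ih | inp x P ih =>
    obtain ⟨k, hk⟩ := ih
    refine ⟨max k (x + 1), fun n hn => ?_⟩
    have : n ≠ x := by omega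
    simp [Proc.cnt, this, hk (n + 1) (by omega)]
  | par P Q ihP ihQ | choice P Q ihP ihQ =>
    obtain ⟨k, hk⟩ := ihP
    obtain ⟨l, hl⟩ := ihQ
    exact ⟨max k l, fun n hn => by simp [Proc.cnt, hk n (by omega), hl n (by omega)]⟩
  | nu P ih =>
    obtain ⟨k, hk⟩ := ih
    exact ⟨k, fun n hn => hk (n + 1) (by omega)⟩
  | fwd x y =>
    refine ⟨max (x + 1) (y + 1), fun n hn => ?_⟩
    have h1 : n ≠ x := by omega
    have h2 : n ≠ y := by omega
    simp [Proc.cnt, h1, h2]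
  | closeBar x | noneBar x =>
    refine ⟨x + 1, fun n hn => ?_⟩
    have h1 : n ≠ x := by omega
    simp [Proc.cnt, h1]
  | close x P ih | someBar x P ih =>
    obtain ⟨k, hk⟩ := ih
    refine ⟨max k (x + 1), fun n hn => ?_⟩
    have : n ≠ x := by omega
    simp [Proc.cnt, this, hk n (by omega)]
  | some x W P ih =>
    obtain ⟨k, hk⟩ := ih
    refine ⟨max k (max (x + 1) (W.sup id + 1)), fun n hn => ?_⟩
    have h1 : n ≠ x := by omega
    have h2 : n ∉ W := fun h => by
      have := Finset.le_sup (f := id) h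
      simp only [id] at this
      omega
    simp [Proc.cnt, h1, h2, hk n (by omega)]

/-! ### Configurations -/

/-- Restriction of a list of names. -/
def Proc.resList (X : List ℕ) (P : Proc) : Proc := X.foldr Proc.res P

theorem Proc.Cong.resList {P Q : Proc} (h : P.Cong Q) (X : List ℕ) :
    (P.resList X).Cong (Q.resList X) := by
  induction X with
  | nil => exact h
  | cons x X ih => exact ih.res x

theorem Proc.Red.resList {P Q : Proc} (h : P.Red Q) (X : List ℕ) :
    (P.resList X).Red (Q.resList X) := by
  induction X with
  | nil => exact h
  | cons x X ih => exact ih.res x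

theorem Proc.resList_append (X Y : List ℕ) (P : Proc) :
    P.resList (X ++ Y) = (P.resList Y).resList X := List.foldr_append

theorem Proc.Cong.resList_perm {X Y : List ℕ} (h : X.Perm Y) (P : Proc) :
    (P.resList X).Cong (P.resList Y) := by
  induction h with
  | nil => exact .refl _
  | cons x _ ih => exact ih.res x
  | swap x y X => exact .res_res _ _ _
  | trans _ _ ih1 ih2 => exact .trans _ _ _ ih1 ih2

theorem Proc.Cong.resList_choice (X : List ℕ) (P Q : Proc) :
    ((Proc.choice P Q).resList X).Cong (.choice (P.resList X) (Q.resList X)) := by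
  induction X with
  | nil => exact .refl _
  | cons x X ih => exact .trans _ _ _ (ih.res x) (.nu_choice _ _)

theorem Proc.cnt_resList (X : List ℕ) (P : Proc) (n : ℕ) :
    (P.resList X).cnt n = if n ∈ X then 0 else P.cnt n := by
  induction X with
  | nil => simp [Proc.resList]
  | cons x X ih =>
    rw [Proc.resList, List.foldr_cons, Proc.cnt_res]
    change (if n = x then 0 else (P.resList X).cnt n) = _
    rw [ih]
    by_cases h : n = x <;> simp [h]

theorem Proc.lin_of_resList {X : List ℕ} {P : Proc} (h : (P.resList X).Lin) :
    P.Lin ∧ ∀ n ∈ X, P.cnt n ≤ 2 := by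
  induction X with
  | nil => exact ⟨h, by simp⟩
  | cons x X ih =>
    obtain ⟨h1, h2⟩ := Proc.lin_res.1 h
    obtain ⟨h3, h4⟩ := ih h2
    refine ⟨h3, fun n hn => ?_⟩
    by_cases hX : n ∈ X
    · exact h4 n hX
    · obtain rfl : n = x := by simpa [hX] using hn
      change (P.resList X).cnt n ≤ 2 at h1
      rwa [Proc.cnt_resList, if_neg hX] at h1

theorem Proc.Unguarded.resList {P : Proc} (h : P.Unguarded) (X : List ℕ) :
    (P.resList X).Unguarded := by
  induction X with
  | nil => exact h
  | cons x X ih => exact (Proc.unguarded_rename _ _).2 ih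

/-- If names are used linearly then `P`, with the names in `X` restricted, can succeed. -/
def Proc.Wins (X : List ℕ) (P : Proc) : Prop :=
  (P.resList X).Lin → (∀ n, (P.resList X).cnt n ≤ 2) → (P.resList X).Success

theorem Proc.Wins.of_cong {X Y : List ℕ} {P Q : Proc} (h : Q.Wins Y)
    (hPQ : (P.resList X).Cong (Q.resList Y)) : P.Wins X := fun h1 h2 =>
  (h (hPQ.lin_iff.1 h1) fun n => hPQ.cnt_eq n ▸ h2 n).of_cong hPQ

theorem Proc.Wins.of_red {X Y : List ℕ} {P Q : Proc} (h : Q.Wins Y)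
    (hPQ : (P.resList X).Red (Q.resList Y)) : P.Wins X := fun h1 h2 => by
  obtain ⟨h3, h4⟩ := hPQ.lin_and_cnt_le h1 h2
  exact (h h3 fun n => (h4 n).trans (h2 n)).of_red hPQ

theorem Proc.Wins.of_cnt {X : List ℕ} {P : Proc} (h : (∀ n, P.cnt n ≤ 2) → P.Wins X) :
    P.Wins X := fun h1 h2 => by
  refine h (fun n => ?_) h1 h2
  by_cases hn : n ∈ X
  · exact (Proc.lin_of_resList h1).2 n hn
  · have := h2 n
    rwa [Proc.cnt_resList, if_neg hn] at this

theorem Proc.Wins.choice_left {X : List ℕ} {P Q : Proc} (h : P.Wins X) :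
    (Proc.choice P Q).Wins X := fun h1 h2 => by
  have hc := Proc.Cong.resList_choice X P Q
  exact (h (hc.lin_iff.1 h1).1 fun n => (le_max_left _ _).trans (hc.cnt_eq n ▸ h2 n)
    ).choice_left.of_cong hc

-- Success of multisets of parallel components below restrictions

/-- Parallel composition of a list of processes. -/
def Proc.parList : List Proc → Proc
  | [] => .nil
  | P :: l => .par P (Proc.parList l)

theorem Proc.Cong.parList_perm {l l' : List Proc} (h : l.Perm l') :
    (Proc.parList l).Cong (Proc.parList l') := by
  induction h with
  | nil => exact .refl _
  | cons x _ ih => exact .par _ _ _ _ (.refl _) ih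
  | swap x y l =>
    exact .trans _ _ _ (.symm _ _ (.parAssoc _ _ _))
      (.trans _ _ _ (.par _ _ _ _ (.parComm _ _) (.refl _)) (.parAssoc _ _ _))
  | trans _ _ ih1 ih2 => exact .trans _ _ _ ih1 ih2

theorem Proc.rename_parList (f : ℕ → ℕ) (l : List Proc) :
    (Proc.parList l).rename f = Proc.parList (l.map (Proc.rename f)) := by
  induction l with
  | nil => rfl
  | cons x l ih => simp [Proc.parList, Proc.rename, ih]

theorem Proc.cnt_parList (l : List Proc) (n : ℕ) :
    (Proc.parList l).cnt n = (l.map fun P => P.cnt n).sum := by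
  induction l with
  | nil => rfl
  | cons x l ih => simp [Proc.parList, Proc.cnt, ih]

/-- The parallel composition of `m`, with the names in `X` restricted, can succeed. -/
def Win (X : List ℕ) (m : Multiset Proc) : Prop :=
  ∀ l : List Proc, (l : Multiset Proc) = m → (Proc.parList l).Wins X

theorem win_coe {X : List ℕ} {l : List Proc} : Win X (l : Multiset Proc) ↔ (Proc.parList l).Wins X :=
  ⟨fun h => h l rfl, fun h _ hl =>
    h.of_cong ((Proc.Cong.parList_perm (Multiset.coe_eq_coe.1 hl)).resList X)⟩

namespace Win

variable {X : List ℕ} {P Q R : Proc} {m : Multiset Proc}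

theorem of_cong (h : Win X (Q ::ₘ m)) (hPQ : P.Cong Q) : Win X (P ::ₘ m) := by
  induction m using Quotient.inductionOn with
  | _ l =>
    exact win_coe (l := P :: l).2 (.of_cong (win_coe (l := Q :: l).1 h)
      ((Proc.Cong.par _ _ _ _ hPQ (.refl _)).resList X))

theorem par (h : Win X (P ::ₘ Q ::ₘ m)) : Win X (.par P Q ::ₘ m) := by
  induction m using Quotient.inductionOn with
  | _ l =>
    exact win_coe (l := .par P Q :: l).2 (.of_cong (win_coe (l := P :: Q :: l).1 h)
      ((Proc.Cong.parAssoc _ _ _).resList X))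

theorem red (h : Win X (R ::ₘ m)) (hR : (Proc.par P Q).Red R) : Win X (P ::ₘ Q ::ₘ m) := by
  induction m using Quotient.inductionOn with
  | _ l =>
    refine win_coe (l := P :: Q :: l).2 (.of_red (win_coe (l := R :: l).1 h) (Proc.Red.resList ?_ X))
    exact .cong _ _ _ _ (.trans _ _ _ (.symm _ _ (.parAssoc _ _ _)) (.parComm _ _))
      (.par _ _ _ hR) (.parComm _ _)

/-- Freshness for the processes at hand is arranged internally. The set `S` lists further names to
avoid, so that a later renaming does not confuse `x` with names given by an environment. -/
theorem nu (S : Finset ℕ) (h : ∀ x ∉ S, Win (x :: X) (P.inst x ::ₘ m)) : Win X (.nu P ::ₘ m) := by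
  induction m using Quotient.inductionOn with
  | _ l =>
    obtain ⟨k, hk⟩ := (Proc.par P (Proc.parList l)).exists_fresh
    obtain ⟨x, hx⟩ := Infinite.exists_notMem_finset (S ∪ Finset.range k)
    simp only [Finset.mem_union, Finset.mem_range, not_or, not_lt] at hx
    have h1 := hk (x + 1) (by omega)
    have h2 := hk x (by omega)
    simp only [Proc.cnt, Nat.add_eq_zero_iff] at h1 h2
    have hcong : (Proc.par (.nu P) (Proc.parList l)).Cong
        ((Proc.par (P.inst x) (Proc.parList l)).res x) := by
      rw [Proc.nu_eq_res h1.1]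
      exact .extrude_res h2.2
    refine win_coe (l := .nu P :: l).2
      (.of_cong (win_coe (l := P.inst x :: l).1 (h x hx.1)) ?_)
    refine .trans _ _ _ (hcong.resList X) ?_
    change ((Proc.parList (P.inst x :: l)).resList [x] |>.resList X).Cong _
    rw [← Proc.resList_append]
    exact .resList_perm (by simp) _

theorem choice_left (h : Win X (P ::ₘ m)) : Win X (.choice P Q ::ₘ m) := by
  induction m using Quotient.inductionOn with
  | _ l =>
    refine win_coe (l := .choice P Q :: l).2 (.of_cong (Y := X) ?_ (Proc.Cong.resList
      (.trans _ _ _ (.parComm _ _) (.par_choice P Q (Proc.parList l))) X))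
    exact .choice_left (.of_cong (win_coe (l := P :: l).1 h) ((Proc.Cong.parComm _ _).resList X))

theorem choice_right (h : Win X (Q ::ₘ m)) : Win X (.choice P Q ::ₘ m) :=
  of_cong (choice_left h) (.choiceComm _ _)

theorem bigChoice : ∀ {l : List Proc}, P ∈ l → Win X (P ::ₘ m) → Win X (Proc.bigChoice l ::ₘ m)
  | [], h, _ => absurd h (by simp)
  | [Q], h, hP => by
    obtain rfl : P = Q := by simpa using h
    exact hP
  | Q :: R :: l, h, hP => by
    rcases List.mem_cons.1 h with rfl | h
    · exact choice_left hP
    · exact choice_right (bigChoice h hP)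

/-- The forwarder uses up the restriction of `x`. Its reduct no longer contains `x`, so a vacuous
restriction of `x` can be put back and the list `X` stays the same. -/
theorem fwd {x y : ℕ} (hx : x ∈ X) (hxy : x ≠ y)
    (h : Win X (m.map (Proc.rename fun i => if i = x then y else i))) : Win X (.fwd x y ::ₘ m) := by
  induction m using Quotient.inductionOn with
  | _ l =>
    set f : ℕ → ℕ := fun i => if i = x then y else i
    have h0 : (Proc.parList (l.map (Proc.rename f))).cnt x = 0 := by
      rw [← Proc.rename_parList]
      refine Proc.cnt_rename_of_not_mem fun i hi => ?_
      simp only [f] at hi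
      split_ifs at hi with h1
      · exact absurd hi.symm hxy
      · exact absurd hi h1
    have hX : ∀ P : Proc, (P.resList X).Cong ((P.res x).resList (X.erase x)) := fun P => by
      refine .trans _ _ _ (.resList_perm (Y := X.erase x ++ [x]) ?_ P) ?_
      · exact (List.perm_cons_erase hx).trans (by simpa using List.perm_append_comm (l₁ := [x]))
      · rw [Proc.resList_append]; exact .refl _
    refine win_coe (l := .fwd x y :: l).2 (.of_red (win_coe (l := l.map (Proc.rename f)).1
      (by simpa using h)) ?_)
    refine .cong _ _ _ _ (hX _) ((Proc.Red.res_fwd hxy).resList _) ?_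
    refine .trans _ _ _ ?_ (.symm _ _ (hX _))
    rw [← Proc.rename_parList] at h0 ⊢
    exact (Proc.Cong.symm _ _ (.res_of_cnt h0)).resList _

theorem tick : Win X (.tick ::ₘ m) := by
  induction m using Quotient.inductionOn with
  | _ l =>
    exact win_coe (l := .tick :: l).2 fun _ _ =>
      ⟨_, .refl, Proc.Unguarded.resList (P := Proc.parList (.tick :: l)) (Or.inl trivial) X⟩

/-- The linearity assumptions hidden in `Proc.Wins` are made available here: a name already seen in
two components is used by no other. -/
theorem of_cnt (h : (∀ n, (m.map fun P => P.cnt n).sum ≤ 2) → Win X m) : Win X m := by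
  induction m using Quotient.inductionOn with
  | _ l => exact win_coe.2 (.of_cnt fun h1 => win_coe.1 (h (by simpa [Proc.cnt_parList] using h1)))

theorem of_cong_snd (h : Win X (P ::ₘ R ::ₘ m)) (hQR : Q.Cong R) : Win X (P ::ₘ Q ::ₘ m) := by
  rw [Multiset.cons_swap] at h ⊢
  exact h.of_cong hQR

end Win

end SharingPi


namespace SharingPi

/-! ### Translations under renaming -/

/-- Renaming commutes with a translation with free variables `V`. -/
def Sem.Natural (F : Sem) (V : Finset ℕ) : Prop :=
  ∀ (f ρ : ℕ → ℕ) (u : ℕ), (∀ i ∈ V, ∀ j ∈ V, f (ρ i) = f (ρ j) → ρ i = ρ j) →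
    ((F ρ u).rename f).Cong (F (fun i => f (ρ i)) (f u))

theorem Sem.Natural.encShareAux {F : Sem} {V : Finset ℕ} (hF : F.Natural V) (r i : ℕ)
    (f ρ : ℕ → ℕ) (x u : ℕ) (hf : ∀ j ∈ V, ∀ j' ∈ V, ¬ (i ≤ j ∧ j < i + r) →
      ¬ (i ≤ j' ∧ j' < i + r) → f (ρ j) = f (ρ j') → ρ j = ρ j') :
    ((encShareAux F V r i ρ x u).rename f).Cong
      (encShareAux F V r i (fun j => f (ρ j)) (f x) (f u)) := by
  induction r generalizing i f ρ x u with
  | zero =>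
    have h := hF (liftN 1 f) (fun j => ρ j + 1) (u + 1) fun j hj j' hj' h => by
      simp only [liftN_one_succ, add_left_inj] at h ⊢
      exact hf j hj j' hj' (by omega) (by omega) h
    simp only [liftN_one_succ] at h
    simp only [SharingPi.encShareAux, Proc.rename, Finset.image_insert, Finset.image_image,
      Function.comp_def, liftN_one_zero, liftN_one_succ]
    exact .someBar _ _ _ (.out _ _ _ (.par _ _ _ _ (.some _ _ _ _ (.close _ _ _ h)) (.refl _)))
  | succ r ih =>
    have h := ih (i + 1) (liftN 1 (liftN 1 f)) (fun j => if j = i then 0 else ρ j + 2) (x + 2) (u + 2)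
      fun j hj j' hj' hi hi' h => by
        by_cases h1 : j = i <;> by_cases h2 : j' = i <;>
          simp only [h1, h2, if_true, if_false, liftN_one_zero, liftN_one_succ, add_left_inj,
            reduceCtorEq] at h ⊢
        exact hf j hj j' hj' (by omega) (by omega) h
    have he : (fun j => liftN 1 (liftN 1 f) (if j = i then 0 else ρ j + 2)) =
        fun j => if j = i then 0 else f (ρ j) + 2 := by
      funext j
      split_ifs <;> simp [liftN_one_zero, liftN_one_succ]
    simp only [he, liftN_one_succ] at h
    simp only [SharingPi.encShareAux, Proc.rename, Finset.image_insert, Finset.image_image,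
      Finset.image_empty, Function.comp_def, liftN_one_zero, liftN_one_succ]
    exact .someBar _ _ _ (.out _ _ _ (.par _ _ _ _ (.refl _)
      (.someBar _ _ _ (.some _ _ _ _ (.inp _ _ _ h)))))

theorem Sem.Natural.encShare {F : Sem} {V : Finset ℕ} (hF : F.Natural V) (k : ℕ)
    (f ρ : ℕ → ℕ) (x u : ℕ) (hf : ∀ j ∈ down k V, ∀ j' ∈ down k V, f (ρ j) = f (ρ j') → ρ j = ρ j') :
    ((encShare F V k ρ x u).rename f).Cong (encShare F V k (fun j => f (ρ j)) (f x) (f u)) := by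
  have key : ∀ j ∈ V, ¬ (0 ≤ j ∧ j < 0 + k) → j - k ∈ down k V := fun j hj hk =>
    mem_down.2 (by rwa [Nat.sub_add_cancel (by omega)])
  exact hF.encShareAux k 0 f _ x u fun j hj j' hj' hk hk' h =>
    hf _ (key j hj hk) _ (key j' hj' hk') h

theorem Sem.natural_encBag {l : List (Finset ℕ × Sem)} (hl : ∀ p ∈ l, Sem.Natural p.2 p.1)
    (f ρ : ℕ → ℕ) (x : ℕ) (hf : ∀ j ∈ fvSem l, ∀ j' ∈ fvSem l, f (ρ j) = f (ρ j') → ρ j = ρ j') :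
    ((encBag l ρ x).rename f).Cong (encBag l (fun j => f (ρ j)) (f x)) := by
  induction l generalizing f ρ x with
  | nil =>
    simp only [encBag, Proc.rename, Finset.image_empty, liftN_one_zero, liftN_one_succ]
    exact .refl _
  | cons p l ih =>
    have hp : ∀ j ∈ p.1, j ∈ fvSem (p :: l) := fun j hj => Finset.mem_union_left _ hj
    have hl' : ∀ j ∈ fvSem l, j ∈ fvSem (p :: l) := fun j hj => Finset.mem_union_right _ hj
    have h1 := ih (fun q hq => hl q (by simp [hq])) (liftN 1 (liftN 1 f)) (fun j => ρ j + 2) (x + 2)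
      fun j hj j' hj' h => by
        simp only [liftN_one_succ, add_left_inj] at h ⊢
        exact hf j (hl' j hj) j' (hl' j' hj') h
    have h2 := hl p (by simp) (liftN 1 (liftN 1 f)) (fun j => ρ j + 2) 0
      fun j hj j' hj' h => by
        simp only [liftN_one_succ, add_left_inj] at h ⊢
        exact hf j (hp j hj) j' (hp j' hj') h
    simp only [liftN_one_zero, liftN_one_succ] at h1 h2
    simp only [encBag, Proc.rename, Finset.image_insert, Finset.image_image, Function.comp_def,
      liftN_one_zero, liftN_one_succ]
    exact .some _ _ _ _ (.inp _ _ _ (.some _ _ _ _ (.someBar _ _ _ (.out _ _ _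
      (.par _ _ _ _ (.some _ _ _ _ h2) (.par _ _ _ _ h1 (.refl _)))))))

theorem Proc.rename_bigChoice (f : ℕ → ℕ) : ∀ l : List Proc,
    (Proc.bigChoice l).rename f = Proc.bigChoice (l.map (Proc.rename f))
  | [] => rfl
  | [_] => rfl
  | P :: Q :: l => by
    have := Proc.rename_bigChoice f (Q :: l)
    simp only [Proc.bigChoice, Proc.rename, List.map_cons] at this ⊢
    rw [this]

theorem Proc.Cong.bigChoice {α : Type*} {g h : α → Proc} : ∀ {l : List α},
    (∀ a ∈ l, (g a).Cong (h a)) → (Proc.bigChoice (l.map g)).Cong (Proc.bigChoice (l.map h))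
  | [], _ => .refl _
  | [a], hl => hl a (by simp)
  | a :: b :: l, hl => .choice _ _ _ _ (hl a (by simp))
      (Proc.Cong.bigChoice (l := b :: l) fun c hc => hl c (by simp_all))

theorem natural_encBag_semBag {B : Bag} (h : ∀ N ∈ B, N.enc.Natural N.fv) (f ρ : ℕ → ℕ) (x : ℕ)
    (hf : ∀ j ∈ fvBag B, ∀ j' ∈ fvBag B, f (ρ j) = f (ρ j') → ρ j = ρ j') :
    ((encBag (semBag B) ρ x).rename f).Cong (encBag (semBag B) (fun j => f (ρ j)) (f x)) := by
  rw [← fvSem_semBag] at hf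
  refine Sem.natural_encBag ?_ f ρ x hf
  rw [semBag_eq_map]
  simpa using h

/-- Congruence is the best possible: the translation of `fail` lists its names in increasing order,
which a renaming need not respect. -/
theorem Term.natural_enc (M : Term) : M.enc.Natural M.fv := by
  induction M using Term.bagInduction with
  | var x => exact fun f ρ u _ => .refl _
  | lam k M ih =>
    intro f ρ u hf
    have h := ih.encShare k (liftN 1 f) (fun j => ρ j + 1) 0 (u + 1) fun i hi j hj h => by
      simp only [liftN_one_succ, add_left_inj] at h ⊢
      exact hf i hi j hj h
    simp only [liftN_one_zero, liftN_one_succ] at h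
    exact .someBar _ _ _ (.inp _ _ _ h)
  | app M B ihM ihB =>
    intro f ρ u hf
    simp only [Term.fv, Finset.mem_union] at hf
    simp only [Term.enc, Proc.rename_bigChoice, List.map_map]
    refine .bigChoice fun l hl => ?_
    obtain ⟨B', hB', rfl⟩ := mem_permutations_semBag.1 hl
    have hfv : fvBag B' = fvBag B := fvBag_perm hB'
    have h1 := ihM (liftN 1 f) (fun j => ρ j + 1) 0 fun i hi j hj h => by
      simp only [liftN_one_succ, add_left_inj] at h ⊢
      exact hf i (.inl hi) j (.inl hj) h
    have h2 := natural_encBag_semBag (fun N hN => ihB N (hB'.mem_iff.1 hN)) (liftN 1 (liftN 1 f))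
      (fun j => ρ j + 2) 0 fun i hi j hj h => by
        simp only [liftN_one_succ, add_left_inj] at h ⊢
        exact hf i (.inr (hfv ▸ hi)) j (.inr (hfv ▸ hj)) h
    simp only [liftN_one_zero, liftN_one_succ] at h1 h2
    simp only [Proc.rename, Finset.image_insert, Finset.image_image, Function.comp_def,
      liftN_one_zero, liftN_one_succ]
    exact .nu _ _ (.par _ _ _ _ h1 (.some _ _ _ _ (.out _ _ _ (.par _ _ _ _ (.refl _) h2))))
  | lsub M N ihM ihN =>
    intro f ρ u hf
    simp only [Term.fv, Finset.mem_union, mem_down] at hf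
    have h1 := ihM (liftN 1 f) (liftN 1 ρ) (u + 1) fun i hi j hj h => by
      rcases i with - | i <;> rcases j with - | j <;>
        simp only [liftN_one_zero, liftN_one_succ, add_left_inj, reduceCtorEq] at h ⊢
      exact hf i (.inl hi) j (.inl hj) h
    have h2 := ihN (liftN 1 f) (fun j => ρ j + 1) 0 fun i hi j hj h => by
      simp only [liftN_one_succ, add_left_inj] at h ⊢
      exact hf i (.inr hi) j (.inr hj) h
    have he : (fun i => liftN 1 f (liftN 1 ρ i)) = liftN 1 fun i => f (ρ i) := liftN_comp 1 f ρ
    rw [he] at h1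
    simp only [liftN_one_zero, liftN_one_succ] at h1 h2
    simp only [Term.enc, Proc.rename, Finset.image_image, Function.comp_def, liftN_one_zero,
      liftN_one_succ]
    exact .nu _ _ (.par _ _ _ _ h1 (.some _ _ _ _ h2))
  | fail S =>
    intro f ρ u hf
    have h := Proc.Cong.rename_noneAll (f := f) (W := S.image ρ) fun a ha b hb h => by
      obtain ⟨i, hi, rfl⟩ := Finset.mem_image.1 ha
      obtain ⟨j, hj, rfl⟩ := Finset.mem_image.1 hb
      exact hf i hi j hj h
    rw [Finset.image_image] at h
    exact .par _ _ _ _ (.refl _) h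
  | share k M x ih =>
    intro f ρ u hf
    exact ih.encShare k f ρ (ρ x) u fun i hi j hj h =>
      hf i (Finset.mem_union_left _ hi) j (Finset.mem_union_left _ hj) h
  | esub k M B ihM ihB =>
    intro f ρ u hf
    simp only [Term.fv, Finset.mem_union] at hf
    simp only [Term.enc, Proc.rename_bigChoice, List.map_map]
    refine .bigChoice fun l hl => ?_
    obtain ⟨B', hB', rfl⟩ := mem_permutations_semBag.1 hl
    have hfv : fvBag B' = fvBag B := fvBag_perm hB'
    have h1 := ihM.encShare k (liftN 1 f) (fun j => ρ j + 1) 0 (u + 1) fun i hi j hj h => by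
      simp only [liftN_one_succ, add_left_inj] at h ⊢
      exact hf i (.inl hi) j (.inl hj) h
    have h2 := natural_encBag_semBag (fun N hN => ihB N (hB'.mem_iff.1 hN)) (liftN 1 f)
      (fun j => ρ j + 1) 0 fun i hi j hj h => by
        simp only [liftN_one_succ, add_left_inj] at h ⊢
        exact hf i (.inr (hfv ▸ hi)) j (.inr (hfv ▸ hj)) h
    simp only [liftN_one_zero, liftN_one_succ] at h1 h2
    exact .nu _ _ (.par _ _ _ _ h1 h2)
  | tick => exact fun f ρ u _ => .refl _

end SharingPi


namespace SharingPi

/-! ### The translation simulates the machine -/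

namespace Win

variable {X : List ℕ} {P Q R : Proc} {m m' : Multiset Proc} {x : ℕ}

theorem of_eq (h : Win X m') (e : m = m') : Win X m := e ▸ h

theorem swap (h : Win X (Q ::ₘ P ::ₘ m)) : Win X (P ::ₘ Q ::ₘ m) :=
  h.of_eq (Multiset.cons_swap _ _ _)

theorem rotate (h : Win X (R ::ₘ P ::ₘ Q ::ₘ m)) : Win X (P ::ₘ Q ::ₘ R ::ₘ m) :=
  h.of_eq (by rw [Multiset.cons_swap Q R, Multiset.cons_swap P R])

theorem some {W : Finset ℕ} (h : Win X (P ::ₘ Q ::ₘ m)) :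
    Win X (.someBar x P ::ₘ .some x W Q ::ₘ m) := h.par.red (.some _ _ _ _)

theorem close (h : Win X (P ::ₘ m)) : Win X (.closeBar x ::ₘ .close x P ::ₘ m) :=
  h.red (.close _ _)

theorem comm (S : Finset ℕ) (h : ∀ y ∉ S, Win (y :: X) (Q.inst y ::ₘ P.inst y ::ₘ m)) :
    Win X (.out x Q ::ₘ .inp x P ::ₘ m) :=
  (nu S fun y hy => (h y hy).par).red (.comm _ _ _)

end Win

/-- The translation of an element of a bag at the name `x`. -/
def itemAt (p : Finset ℕ × Sem) (σ : ℕ → ℕ) (x : ℕ) : Proc := .some x (p.1.image σ) (p.2 σ x)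

/-- The successful alternative of `served_or_dead`, played forwards. Each round performs the
handshake, passes a fresh name for one variable and starts an element of the bag at that name. The
confirmations left behind are collected in `G`, which stays arbitrary in the hypothesis because they
are never needed again. The term `d` is only a default value for indexing the list. -/
theorem Win.serve {F : Sem} {V : Finset ℕ} (hF : F.Natural V) {r i : ℕ} {ρ : ℕ → ℕ} {y u : ℕ}
    {l : List (Finset ℕ × Sem)} (hl : l.length = r) (hln : ∀ p ∈ l, Sem.Natural p.2 p.1)
    {σ : ℕ → ℕ} {X : List ℕ} {m : Multiset Proc} (d : Finset ℕ × Sem)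
    (h : ∀ Y ρ' G, (∀ j, ¬ (i ≤ j ∧ j < i + r) → ρ' j = ρ j) → (∀ n < r, ρ' (i + n) ∈ Y) →
      Win (Y ++ X) (F ρ' u ::ₘ (∑ n ∈ Finset.range r, {itemAt (l.getD n d) σ (ρ' (i + n))} + m + G))) :
    Win X (encShareAux F V r i ρ y u ::ₘ encBag l σ y ::ₘ m) := by
  induction r generalizing i ρ l X m with
  | zero =>
    obtain rfl := List.length_eq_zero_iff.1 hl
    refine .some (.comm ∅ fun a _ => ?_)
    have hc := hF (fun i => if i = 0 then a else i - 1) (fun j => ρ j + 1) (u + 1) (by simp)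
    simp only [Nat.add_eq_zero_iff, one_ne_zero, and_false, if_false, Nat.add_sub_cancel] at hc
    refine .par (.rotate (.par (.rotate (.swap (.some (.close (.of_cong (.of_eq (h [a] ρ
      (.some y ∅ (.noneBar y) ::ₘ .noneBar y ::ₘ 0) (fun _ _ => rfl) (by simp)) ?_) hc)))))))
    congr 1
    simp only [Finset.range_zero, Finset.sum_empty, ← Multiset.singleton_add]
    simp only [Proc.rename, Finset.image_empty, Nat.add_eq_zero_iff, one_ne_zero, and_false, if_false,
      Nat.add_sub_cancel]
    abel
  | succ r ih =>
    obtain ⟨p, l, rfl⟩ : ∃ p l', l = p :: l' := List.exists_cons_of_length_eq_add_one hl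
    have hlr : l.length = r := by simpa using hl
    refine .some (.comm ∅ fun a _ => .par (.rotate (.rotate ?_)))
    -- The new name `b` of the variable must differ from the names already given to variables of the
    -- body, or the translation would not commute with the instantiation. The auxiliary name `a`
    -- does not occur in the body and needs no such condition.
    refine .some (.swap (.some (.comm (V.image ρ) fun b hb => ?_)))
    -- The two instantiations combined: the index 0 becomes `b`, the index 1 becomes `a`, and all
    -- others drop by 2.
    set f : ℕ → ℕ := (fun i => if i = 0 then b else i - 1) ∘
      liftN 1 (fun i => if i = 0 then a else i - 1) with hf
    have f0 : f 0 = b := rfl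
    have f2 : ∀ n, f (n + 2) = n := fun n => by simp [hf, liftN]
    have hb' : ∀ j ∈ V, b ≠ ρ j := fun j hj h => hb (Finset.mem_image.2 ⟨j, hj, h.symm⟩)
    have h1 := hF.encShareAux r (i + 1) f (fun j => if j = i then 0 else ρ j + 2) (y + 2) (u + 2)
      fun j hj j' hj' _ _ h => by
        by_cases h1 : j = i <;> by_cases h2 : j' = i <;>
          simp only [h1, h2, if_true, if_false, f0, f2] at h ⊢
        · exact absurd h (hb' j' hj')
        · exact absurd h.symm (hb' j hj)
        · rw [h]
    have h2 := Sem.natural_encBag (l := l) (fun q hq => hln q (by simp [hq])) f (fun j => σ j + 2) (y + 2)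
      fun j _ j' _ h => by
        simp only [f2] at h ⊢
        rw [h]
    have h3 : (Proc.rename f (.some 0 (p.1.image fun j => σ j + 2) (p.2 (fun j => σ j + 2) 0))).Cong
        (itemAt p σ b) := by
      have := hln p (by simp) f (fun j => σ j + 2) 0 fun j _ j' _ h => by
        simp only [f2] at h ⊢
        rw [h]
      simp only [f0, f2] at this
      simp only [Proc.rename, Finset.image_image, Function.comp_def, f0, f2]
      exact .some _ _ _ _ this
    simp only [f2] at h1 h2
    have he : (fun j => f (if j = i then 0 else ρ j + 2)) = fun j => if j = i then b else ρ j := by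
      funext j
      split_ifs
      · rfl
      · exact f2 _
    rw [he] at h1
    rw [hf, ← Proc.rename_rename] at h1 h2 h3
    refine .of_cong (.of_cong_snd (.par (.rotate (.rotate (.par (.rotate ?_))))) h1)
      (.par _ _ _ _ h3 (.par _ _ _ _ h2 (.refl _)))
    refine ih hlr (fun q hq => hln q (by simp [hq])) fun Y ρ' G hρ' hY => ?_
    have hi : ρ' i = b := by rw [hρ' i (by omega), if_pos rfl]
    have h4 := h (Y ++ [b, a]) ρ' (.noneBar a ::ₘ (Proc.some 0 ∅ (.close 0 .nil)).inst a ::ₘ G)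
      (fun j hj => by rw [hρ' j (by omega), if_neg (by omega)]) fun n hn => by
        rcases n with - | n
        · simp [hi]
        · have := hY n (by omega)
          rw [show i + 1 + n = i + (n + 1) by omega] at this
          simp [this]
    rw [List.append_assoc] at h4
    refine .of_eq h4 ?_
    have h5 : Proc.rename (fun i => if i = 0 then b else i - 1)
        (Proc.rename (liftN 1 fun i => if i = 0 then a else i - 1) (Proc.noneBar 1)) = .noneBar a := rfl
    rw [Finset.sum_range_succ', h5, ← Proc.inst]
    simp only [List.getD_cons_zero, Nat.add_zero, hi, List.getD_cons_succ, Nat.add_assoc, Nat.add_comm 1]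
    congr 1
    simp only [← Multiset.singleton_add]
    abel

end SharingPi


namespace SharingPi

/-! ### Processes that provide closures and stacks -/

/-- The processes `m` provide the closure at the name `x`, with restricted names in `X`. -/
def Clo.Items (X : List ℕ) : Clo → ℕ → Multiset Proc → Prop
  | .none, _, _ => False
  | .mk N e, x, m => N.Ok ∧ x ∈ X ∧ ∃ (ρ : ℕ → ℕ) (f : ℕ → Multiset Proc),
      (∀ z ∈ N.fv, (e z).Items X (ρ z) (f z)) ∧
        itemAt (N.fv, N.enc) ρ x ::ₘ ∑ z ∈ N.fv, f z ≤ m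

/-- The consumer at the name `v` of an argument bag, whose result is used at `u`. -/
def frameAt (B : Bag) (ρ : ℕ → ℕ) (v u : ℕ) : Proc :=
  .some v (insert u ((fvBag B).image ρ))
    (.out v (.par (.fwd (v + 1) (u + 1)) (encBag (semBag B) (fun j => ρ j + 1) 0)))

/-- The processes `m` provide the stack at the name `u`, with restricted names in `X`. -/
def StackItems (X : List ℕ) : Stack → ℕ → Multiset Proc → Prop
  | [], _, _ => True
  | (B, e) :: s, u, m => u ∈ X ∧ OkBag B ∧ ∃ (ρ : ℕ → ℕ) (u' : ℕ) (f : ℕ → Multiset Proc)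
      (K : Multiset Proc), (∀ z ∈ fvBag B, (e z).Items X (ρ z) (f z)) ∧ StackItems X s u' K ∧
        frameAt B ρ u u' ::ₘ (∑ z ∈ fvBag B, f z + K) ≤ m

theorem Clo.Items.mono {X X' : List ℕ} (hX : X ⊆ X') {c : Clo} {x : ℕ} {m : Multiset Proc}
    (h : c.Items X x m) : c.Items X' x m := by
  induction c generalizing x m with
  | none => exact h
  | mk N e ih =>
    obtain ⟨h1, h2, ρ, f, h3, h4⟩ := h
    exact ⟨h1, hX h2, ρ, f, fun z hz => ih z (h3 z hz), h4⟩

theorem StackItems.mono {X X' : List ℕ} (hX : X ⊆ X') {s : Stack} {u : ℕ} {m : Multiset Proc}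
    (h : StackItems X s u m) : StackItems X' s u m := by
  induction s generalizing u m with
  | nil => trivial
  | cons p s ih =>
    obtain ⟨h1, h2, ρ, u', f, K, h3, h4, h5⟩ := h
    exact ⟨hX h1, h2, ρ, u', f, K, fun z hz => (h3 z hz).mono hX, ih h4, h5⟩

theorem Clo.Items.exists_cnt {X : List ℕ} {c : Clo} {x : ℕ} {m : Multiset Proc}
    (h : c.Items X x m) : ∃ P ∈ m, 1 ≤ P.cnt x := by
  cases c with
  | none => exact h.elim
  | mk N e =>
    obtain ⟨_, _, ρ, f, _, h⟩ := h
    refine ⟨_, Multiset.subset_of_le h (Multiset.mem_cons_self _ _), ?_⟩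
    simp [itemAt, Proc.cnt]

theorem cnt_le_sum {m : Multiset Proc} {P : Proc} (h : P ∈ m) (n : ℕ) :
    P.cnt n ≤ (m.map fun P => P.cnt n).sum :=
  Multiset.single_le_sum (by simp) _ (Multiset.mem_map_of_mem _ h)

theorem sum_block_le {α : Type*} (k : ℕ) (V : Finset ℕ) (f g : ℕ → Multiset α) :
    ∑ z ∈ V, (if z < k then f z else g (z - k)) ≤ ∑ z ∈ Finset.range k, f z + ∑ z ∈ down k V, g z := by
  rw [Finset.sum_ite]
  refine add_le_add (Finset.sum_le_sum_of_subset fun z hz => ?_) (le_of_eq ?_)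
  · simpa using (Finset.mem_filter.1 hz).2
  · rw [down, Finset.sum_image]
    · simp only [not_lt]
    · intro i hi j hj h
      simp only [Finset.coe_filter, Set.mem_ofPred_eq] at hi hj h
      omega

theorem sum_range_bag {α : Type*} {B : Bag} (hB : OkBag B) (g : ℕ → Multiset α) :
    ∑ n ∈ Finset.range B.length, ∑ z ∈ (B.getD n .tick).fv, g z = ∑ z ∈ fvBag B, g z := by
  induction B with
  | nil => simp [fvBag]
  | cons _ B ih =>
    obtain ⟨_, h2, h3⟩ := hB
    rw [List.length_cons, Finset.sum_range_succ', fvBag, Finset.sum_union h3, ← ih h2, add_comm]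
    simp

/-- The processes `m` simulate the machine started at `M`. -/
def Simulates (M : Term) (e : ℕ → Clo) (s : Stack) : Prop :=
  ∀ (X : List ℕ) (ρ : ℕ → ℕ) (u : ℕ) (f : ℕ → Multiset Proc) (K m : Multiset Proc), M.Ok →
    (∀ z ∈ M.fv, (e z).Items X (ρ z) (f z)) → StackItems X s u K → ∑ z ∈ M.fv, f z + K ≤ m →
      Win X (M.enc ρ u ::ₘ m)

/-- After `Win.serve` each element stands at the name of its variable and, together with the
providers of its own free variables, provides a closure. The providers `g` of the bag can be divided
among the elements because these have disjoint free variables. -/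
theorem Simulates.share {M : Term} {k : ℕ} {B : Bag} {e e' : ℕ → Clo} {s : Stack}
    (h : Simulates M (extEnv (closures B e') e) s) (hM : M.Ok) (hB : OkBag B) (hk : B.length = k)
    {X : List ℕ} {ρ σ : ℕ → ℕ} {y u : ℕ} {f g : ℕ → Multiset Proc} {K m : Multiset Proc}
    (hf : ∀ z ∈ down k M.fv, (e z).Items X (ρ z) (f z))
    (hg : ∀ z ∈ fvBag B, (e' z).Items X (σ z) (g z)) (hs : StackItems X s u K)
    (hm : ∑ z ∈ down k M.fv, f z + ∑ z ∈ fvBag B, g z + K ≤ m) :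
    Win X (encShare M.enc M.fv k ρ y u ::ₘ encBag (semBag B) σ y ::ₘ m) := by
  refine Win.serve M.natural_enc (by simp [semBag_eq_map, hk])
    (by simpa [semBag_eq_map] using fun N _ => N.natural_enc) (Term.tick.fv, Term.tick.enc)
    fun Y ρ' G h1 h2 => ?_
  have hX : X ⊆ Y ++ X := fun _ => List.mem_append_right _
  have hd : ∀ n, (semBag B).getD n (Term.tick.fv, Term.tick.enc) =
      ((B.getD n .tick).fv, (B.getD n .tick).enc) := fun n => by
    rw [semBag_eq_map, List.getD_map]
  simp only [hd]
  refine h (Y ++ X) ρ' u (fun z => if z < k then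
    itemAt ((B.getD z .tick).fv, (B.getD z .tick).enc) σ (ρ' z) ::ₘ ∑ w ∈ (B.getD z .tick).fv, g w
    else f (z - k)) K _ hM (fun z hz => ?_) (hs.mono hX) ?_
  · by_cases hzk : z < k
    · have hl : z < B.length := by omega
      rw [if_pos hzk, extEnv_of_lt (by rwa [length_closures])]
      have hz' : B[z] ∈ B := List.getElem_mem hl
      simp only [closures, List.getElem_map, List.getD_eq_getElem _ _ hl]
      refine ⟨(okBag_iff.1 hB).1 _ hz', List.mem_append_left _ ?_, σ, g, fun w hw =>
        (hg w (mem_fvBag_of_mem hz' hw)).mono hX, le_rfl⟩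
      simpa using h2 z hzk
    · obtain ⟨z, rfl⟩ := Nat.exists_eq_add_of_le' (not_lt.1 hzk)
      rw [if_neg hzk, extEnv_add' (by rw [length_closures, hk]), h1 _ (by omega)]
      simp only [Nat.add_sub_cancel]
      exact (hf z (mem_down.2 hz)).mono hX
  -- Elements whose variable does not occur in `M` are left over, which is why the providers are
  -- only required to be contained in the available processes.
  · refine (add_le_add_left (sum_block_le _ _ _ _) _).trans ?_
    simp only [← Multiset.singleton_add, Finset.sum_add_distrib]
    subst hk
    rw [sum_range_bag hB]
    refine le_trans (le_of_eq ?_) ((add_le_add_right hm _).trans (Multiset.le_add_right _ G))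
    simp only [Nat.zero_add]
    abel

end SharingPi


-- Machine steps as process reductions

namespace SharingPi

theorem frameAt_cong {B : Bag} (f ρ : ℕ → ℕ) (v u : ℕ)
    (hf : ∀ i ∈ fvBag B, ∀ j ∈ fvBag B, f (ρ i) = f (ρ j) → ρ i = ρ j) :
    ((frameAt B ρ v u).rename f).Cong (frameAt B (fun i => f (ρ i)) (f v) (f u)) := by
  have h := natural_encBag_semBag (B := B) (fun N _ => N.natural_enc) (liftN 1 f)
    (fun j => ρ j + 1) 0 fun i hi j hj h => by
      simp only [liftN_one_succ, add_left_inj] at h ⊢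
      exact hf i hi j hj h
  simp only [liftN_one_zero, liftN_one_succ] at h
  simp only [frameAt, Proc.rename, Finset.image_insert, Finset.image_image, Function.comp_def,
    liftN_one_succ]
  exact .some _ _ _ _ (.out _ _ _ (.par _ _ _ _ (.refl _) h))

theorem Proc.rename_ite_eq_self {P : Proc} {a b : ℕ} (h : P.cnt a = 0) :
    P.rename (fun i => if i = a then b else i) = P :=
  Proc.rename_eq_self fun i hi => if_neg fun e : i = a => hi (e ▸ h)

theorem map_rename_ite_eq_self {m : Multiset Proc} {a b : ℕ} (h : ∀ P ∈ m, P.cnt a = 0) :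
    m.map (Proc.rename fun i => if i = a then b else i) = m :=
  (Multiset.map_congr rfl fun P hP => Proc.rename_ite_eq_self (h P hP)).trans (Multiset.map_id m)

/-- Each machine step corresponds to a few reductions. A choice of ordering selects a branch of the
translation, a push leaves a frame waiting at a new name, and a look-up unlocks a closure and
forwards its name. Processes that are no longer needed remain as garbage, which is why the statement
holds for every larger multiset `m`. -/
theorem Eval.simulates {M : Term} {e : ℕ → Clo} {s : Stack} (h : Eval M e s) : Simulates M e s := by
  induction h with
  | tick e s => exact fun _ _ _ _ _ _ _ _ _ _ => .tick
  | var x e s N e' hx _ ih =>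
    intro X ρ u f K m _ hf hs hm
    have h1 := hf x (by simp [Term.fv])
    rw [hx] at h1
    obtain ⟨hN, ha, ρ', f', h2, h3⟩ := h1
    simp only [Term.fv, Finset.sum_singleton] at hm
    obtain ⟨m', rfl⟩ := Multiset.le_iff_exists_add.1 ((add_le_add_left h3 K).trans hm)
    simp only [Term.enc, Multiset.cons_add]
    generalize ρ x = a at ha ⊢
    -- The name `a` is used by the variable and by the guard of its closure, hence by nothing else.
    -- This gives `a ≠ u`, and the renaming done by the forwarder affects only the body of the
    -- closure.
    refine .of_cnt fun hc => .some ?_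
    have hca := hc a
    simp only [Multiset.map_cons, Multiset.sum_cons, itemAt, Proc.cnt, if_true, true_or] at hca
    have hau : a ≠ u := by
      rintro rfl
      simp only [if_true] at hca
      omega
    have h0 : ((∑ z ∈ N.fv, f' z + K + m').map fun P => P.cnt a).sum = 0 := by omega
    have h0' : ∀ P ∈ ∑ z ∈ N.fv, f' z + K + m', P.cnt a = 0 := fun P hP =>
      Nat.le_zero.1 (h0 ▸ cnt_le_sum hP a)
    have hρ' : ∀ z ∈ N.fv, ρ' z ≠ a := fun z hz h => by
      obtain ⟨P, hP, h1⟩ := (h2 z hz).exists_cnt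
      have := h0' P (Multiset.mem_add.2 (.inl (Multiset.mem_add.2 (.inl
        (Multiset.mem_sum.2 ⟨z, hz, hP⟩)))))
      rw [h] at h1
      omega
    refine .fwd ha hau ?_
    rw [Multiset.map_cons]
    refine .of_cong ?_ (N.natural_enc _ ρ' a fun i hi j hj h => by
      simpa [hρ' i hi, hρ' j hj] using h)
    rw [map_rename_ite_eq_self h0', if_pos rfl]
    exact ih X _ u f' K _ hN (fun z hz => by simpa [hρ' z hz] using h2 z hz) hs
      (Multiset.le_add_right _ _)
  | app M B B' e s hB _ ih =>
    intro X ρ u f K m hM hf hs hm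
    obtain ⟨hM, hOB, hd⟩ := hM
    simp only [Term.fv, Finset.mem_union] at hf hm
    rw [Finset.sum_union hd] at hm
    refine .bigChoice (List.mem_map.2 ⟨_, mem_permutations_semBag.2 ⟨B', hB, rfl⟩, rfl⟩)
      (.nu ∅ fun v _ => .par ?_)
    refine .of_cong (.of_cong_snd (.of_eq (m' := M.enc ρ v ::ₘ frameAt B' ρ v u ::ₘ m) ?_ rfl)
      (?_ : Proc.Cong _ (frameAt B' ρ v u))) ?_
    · refine ih (v :: X) ρ v f (frameAt B' ρ v u ::ₘ (∑ z ∈ fvBag B', f z + K)) _ hM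
        (fun z hz => (hf z (.inl hz)).mono (List.subset_cons_self _ _))
        ⟨by simp, hOB.perm hB.symm, ρ, u, f, K, fun z hz => (hf z (.inr (fvBag_perm hB ▸ hz))).mono
          (List.subset_cons_self _ _), hs.mono (List.subset_cons_self _ _), le_rfl⟩ ?_
      rw [Multiset.add_cons, ← add_assoc, fvBag_perm hB]
      exact Multiset.cons_le_cons _ hm
    · have := frameAt_cong (B := B') (fun i => if i = 0 then v else i - 1) (fun j => ρ j + 1) 0 (u + 1)
        (by simp)
      simp only [frameAt, fvBag_perm hB] at this ⊢
      exact this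
    · exact M.natural_enc (fun i => if i = 0 then v else i - 1) (fun j => ρ j + 1) 0 (by simp)
  | lam k M B e e' s hk _ ih =>
    intro X ρ u f K m hM hf hs hm
    obtain ⟨hu, hB, σ, u', g, K', hg, hs, hK⟩ := hs
    obtain ⟨m', rfl⟩ := Multiset.le_iff_exists_add.1 ((add_le_add_right hK _).trans hm)
    rw [Multiset.add_cons, Multiset.cons_add]
    simp only [Term.fv] at hf
    refine .some (.swap (.comm {u} fun y hy => .par ?_))
    have hyu : y ≠ u := by simpa using hy
    have c1 := M.natural_enc.encShare k (fun i => if i = 0 then y else i - 1) (fun j => ρ j + 1) 0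
      (u + 1) (by simp)
    have c2 := natural_encBag_semBag (B := B) (fun N _ => N.natural_enc)
      (fun i => if i = 0 then y else i - 1) (fun j => σ j + 1) 0 (by simp)
    simp only [if_true, Nat.add_eq_zero_iff, one_ne_zero, and_false, if_false,
      Nat.add_sub_cancel] at c1 c2
    refine .rotate (.of_cong (.rotate (.of_cong (.rotate ?_) c2)) c1)
    simp only [Proc.rename, Nat.add_eq_zero_iff, one_ne_zero, and_false, if_false,
      Nat.add_sub_cancel]
    -- The name `u` is held by the forwarder and by the sharing process. So `u` and `u'` differ, no
    -- other component holds `u`, and forwarding redirects only the result of the body.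
    refine .of_cnt fun hc => ?_
    have hcu := hc u
    have hsh : 1 ≤ (encShare M.enc M.fv k (fun j => ρ j) y u).cnt u := by
      cases k <;> simp only [encShare, encShareAux, Proc.cnt, Finset.mem_insert, true_or, or_true,
        if_true] <;> omega
    simp only [Multiset.map_cons, Multiset.sum_cons, Proc.cnt, if_true, Term.fv] at hcu
    obtain ⟨huu, h0⟩ : u ≠ u' ∧ (encBag (semBag B) (fun j => σ j) y).cnt u = 0 ∧
        ((∑ z ∈ down k M.fv, f z + (∑ z ∈ fvBag B, g z + K') + m').map fun P => P.cnt u).sum = 0 := by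
      split_ifs at hcu with h
      · omega
      · exact ⟨h, by omega⟩
    have h0' : ∀ P ∈ ∑ z ∈ down k M.fv, f z + (∑ z ∈ fvBag B, g z + K') + m', P.cnt u = 0 :=
      fun P hP => Nat.le_zero.1 (h0.2 ▸ cnt_le_sum hP u)
    have hρ : ∀ z ∈ down k M.fv, ρ z ≠ u := fun z hz h => by
      obtain ⟨P, hP, h1⟩ := (hf z hz).exists_cnt
      have := h0' P (Multiset.mem_add.2 (.inl (Multiset.mem_add.2 (.inl
        (Multiset.mem_sum.2 ⟨z, hz, hP⟩)))))
      rw [h] at h1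
      omega
    refine .fwd (List.mem_cons_of_mem _ hu) huu ?_
    rw [Multiset.map_cons, Multiset.map_cons, Proc.rename_ite_eq_self h0.1]
    rw [map_rename_ite_eq_self (by exact h0')]
    have c3 := M.natural_enc.encShare k (fun i => if i = u then u' else i) ρ y u
      fun i hi j hj h => by simpa [hρ i hi, hρ j hj] using h
    rw [if_neg hyu, if_pos rfl] at c3
    refine .swap (.of_cong (ih.share hM hB hk (f := f) (g := g) (K := K') (fun z hz => ?_)
      (fun z hz => (hg z hz).mono (List.subset_cons_self _ _))
      (hs.mono (List.subset_cons_self _ _)) ?_) c3)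
    · rw [if_neg (hρ z hz)]
      exact (hf z hz).mono (List.subset_cons_self _ _)
    · rw [add_assoc]
      exact Multiset.le_add_right _ _
  | lsub M N e s _ ih =>
    intro X ρ u f K m hM hf hs hm
    obtain ⟨hM, hN, hd⟩ := hM
    simp only [Term.fv, Finset.mem_union] at hf hm
    rw [Finset.sum_union hd] at hm
    -- The name of the substituted variable must avoid those of the other variables of `M`, so that
    -- the translation of `M` commutes with the instantiation.
    refine .nu ((down 1 M.fv).image ρ) fun y hy => .par ?_
    have hy' : ∀ z, z + 1 ∈ M.fv → ρ z ≠ y := fun z hz h =>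
      hy (Finset.mem_image.2 ⟨z, mem_down.2 hz, h⟩)
    have c1 := M.natural_enc (fun i => if i = 0 then y else i - 1) (liftN 1 ρ) (u + 1)
      fun i hi j hj h => by
        rcases i with - | i <;> rcases j with - | j <;>
          simp only [liftN_one_zero, liftN_one_succ, if_true, Nat.add_eq_zero_iff, one_ne_zero,
            and_false, if_false, Nat.add_sub_cancel] at h ⊢
        · exact absurd h.symm (hy' j hj)
        · exact absurd h (hy' i hi)
        · rw [h]
    have c2 := N.natural_enc (fun i => if i = 0 then y else i - 1) (fun j => ρ j + 1) 0 (by simp)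
    simp only [if_true, Nat.add_eq_zero_iff, one_ne_zero, and_false, if_false,
      Nat.add_sub_cancel] at c1 c2
    refine .of_cong (.of_cong_snd (.of_eq (m' := M.enc _ u ::ₘ itemAt (N.fv, N.enc) ρ y ::ₘ m) ?_ rfl)
      (?_ : Proc.Cong _ (itemAt (N.fv, N.enc) ρ y))) c1
    · refine ih (y :: X) _ u (fun z => if z < 1 then itemAt (N.fv, N.enc) ρ y ::ₘ ∑ z ∈ N.fv, f z
        else f (z - 1)) K _ hM (fun z hz => ?_) (hs.mono (List.subset_cons_self _ _)) ?_
      · rcases z with - | z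
        · exact ⟨hN, by simp [liftN_one_zero], ρ, f, fun z hz => (hf z (.inr hz)).mono (List.subset_cons_self _ _),
            le_rfl⟩
        · simp only [extEnv_one_succ, liftN_one_succ]
          exact (hf z (.inl (mem_down.2 hz))).mono (List.subset_cons_self _ _)
      · refine (add_le_add_left (sum_block_le _ _ _ _) _).trans ?_
        rw [Finset.sum_range_one, Multiset.cons_add, Multiset.cons_add]
        refine Multiset.cons_le_cons _ (le_trans (le_of_eq ?_) hm)
        abel
    · simp only [itemAt, Proc.rename, Finset.image_image, Function.comp_def, if_true]
      exact .some _ _ _ _ c2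
  | esub k M B B' e s hB hk _ ih =>
    intro X ρ u f K m hM hf hs hm
    obtain ⟨hM, hOB, hd⟩ := hM
    simp only [Term.fv, Finset.mem_union] at hf hm
    rw [Finset.sum_union hd] at hm
    refine .bigChoice (List.mem_map.2 ⟨_, mem_permutations_semBag.2 ⟨B', hB, rfl⟩, rfl⟩)
      (.nu ∅ fun y _ => .par ?_)
    have c1 := M.natural_enc.encShare k (fun i => if i = 0 then y else i - 1) (fun j => ρ j + 1) 0
      (u + 1) (by simp)
    have c2 := natural_encBag_semBag (B := B') (fun N _ => N.natural_enc)
      (fun i => if i = 0 then y else i - 1) (fun j => ρ j + 1) 0 (by simp)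
    simp only [if_true, Nat.add_eq_zero_iff, one_ne_zero, and_false, if_false,
      Nat.add_sub_cancel] at c1 c2
    refine .of_cong (.of_cong_snd ?_ c2) c1
    refine ih.share hM (hOB.perm hB.symm) hk (f := f) (g := f) (K := K)
      (fun z hz => (hf z (.inl hz)).mono (List.subset_cons_self _ _))
      (fun z hz => (hf z (.inr (fvBag_perm hB ▸ hz))).mono (List.subset_cons_self _ _))
      (hs.mono (List.subset_cons_self _ _)) ?_
    rwa [fvBag_perm hB]

end SharingPi


-- Success sensitivity

namespace SharingPi

theorem Win.success {P : Proc} (h : Win [] {P}) (hl : P.Lin) (hc : ∀ n, P.cnt n ≤ 1) : P.Success := by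
  have h1 := win_coe (l := [P]).1 h
  have hP : (Proc.parList [P]).Cong P := .parNil P
  exact (h1 (hP.lin_iff.2 hl) fun n => (hP.cnt_eq n ▸ hc n).trans (by simp)).of_cong
    (.symm _ _ hP)

/-- Both directions pass through evaluation on the empty stack, where a closed term makes the
environment immaterial. The only name that the translation can use freely is `u`, and at most once;
this supplies the linearity needed by the trace semantics and by the simulation. -/
theorem Expr.success_iff {E : Expr} (hsyn : E.Proper) (hcl : E.Closed) (u : ℕ) :
    E.Success ↔ (E.enc u).Success := by
  have hok : ∀ M ∈ E, M.Ok := fun M hM => (hsyn.2 M hM).ok (hcl M hM)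
  have haff : (Expr.enc E u).Affine (· = u) := .bigChoice fun P hP => by
    obtain ⟨M, hM, rfl⟩ := List.mem_map.1 hP
    refine ((hok M hM).affine_enc id u Function.injective_id.injOn ?_).mono ?_ <;> simp [hcl M hM]
  constructor
  · intro h
    obtain ⟨M, hM, h⟩ := h.eval hok fun _ => .none
    refine Win.success (Win.bigChoice (m := 0) (List.mem_map_of_mem hM) ?_) haff.1 haff.2.1
    exact h.simulates [] id u (fun _ => 0) 0 0 (hok M hM) (by simp [hcl M hM]) trivial (by simp)
  · intro h
    obtain ⟨P, hP, hr⟩ := (h.run haff.1 haff.2.1).bigChoice (by simpa using hsyn.1)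
    obtain ⟨M, hM, rfl⟩ := List.mem_map.1 hP
    have hM' : StateAns M (fun _ => .none) [] := ⟨hok M hM, id, u, 0, true, false, fun _ => false,
      Function.injective_id.injOn, by simp [hcl M hM], hr, ⟨rfl, rfl⟩, by simp [hcl M hM], .inl rfl⟩
    obtain ⟨E₁, E₂, rfl⟩ := List.append_of_mem hM
    exact hM'.eval.success (hok M hM) (hcl M hM) E₁ E₂

end SharingPi

theorem mainTheorem5 (E : SharingPi.Expr) (hsyn : SharingPi.Expr.Proper E)
    (hwf : SharingPi.Expr.WellFormed E) (hcl : SharingPi.Expr.Closed E) (u : ℕ) :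
    SharingPi.Expr.Success E ↔ SharingPi.Proc.Success (SharingPi.Expr.enc E u) :=
  SharingPi.Expr.success_iff hsyn hcl u
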